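/- Let $M$ be an oriented smooth manifold (Hausdorff, second countable) of dimension $n\ge 1$, $F\to M$ a smooth real vector bundle of finite rank, and $\tilde F^*=F^*\otimes\Lambda^nT^*M$ its bundle of dual densities. Write $\Gamma$ for spaces of smooth sections and $\cdot$ for the fibrewise pairing of $\tilde F^*$ with $F$, whose values are $n$-forms. *Causal structure.* A chronal cone bundle $C\subset TM$ assigns to each point a non-empty open convex salient cone (one containing no affine line) in the tangent space, such that $C$ is open in $TM$ and the strict dual cone bundle $C^{\circledast}_x=\{u\in T_x^*M : u(v)>0\ \forall v\in\bar C_x\setminus 0\}$ is open in $T^*M$. Then $I^{\pm}(K)$ is the set of end points of smooth curves starting in $K$, tangent to $C$ (for $+$) or to $-C$ (for $-$), and $I(K)=I^+(K)\cup I^-(K)\cup K$. A causal curve is a locally Lipschitz curve with almost every velocity in $\bar C\setminus0$. A Cauchy surface is a smooth embedded hypersurface, no two points of which (distinct or not) are joined by a causal curve, that meets every inextensible causal curve exactly once; $C$ is globally hyperbolic if there is one. $\Gamma_0,\Gamma_+,\Gamma_-,\Gamma_{SC}$ are the sections whose support is compact, or contained in $\overline{I^+(K)}$, $\overline{I^-(K)}$,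 $\overline{I(K)}$, respectively, for some compact $K\subset M$. *Operators.* Let $f,f^*\colon\Gamma(F)\to\Gamma(\tilde F^*)$ be linear differential operators that are mutually adjoint with Green form $G$: $G\colon\Gamma(F)\times\Gamma(F)\to\Omega^{n-1}(M)$ is a bilinear differential operator with $f[\phi]\cdot\psi-\phi\cdot f^*[\psi]=\mathrm dG[\phi,\psi]$ for all $\phi,\psi\in\Gamma(F)$. Let both be Green hyperbolic with respect to the same globally hyperbolic $C$: for each sign and each $\tilde\alpha^*\in\Gamma_\pm(\tilde F^*)$ there is a unique $\phi\in\Gamma_\pm(F)$ with $f[\phi]=\tilde\alpha^*$, it satisfies $\operatorname{supp}\phi\subseteq\overline{I^\pm(\operatorname{supp}\tilde\alpha^*)}$, and it is denoted $\mathrm G_\pm[\tilde\alpha^*]$; likewise for $f^*$, with $\mathrm G^*_\pm$. Put $\mathrm G=\mathrm G_+-\mathrm G_-$ and $\mathrm G^*=\mathrm G^*_+-\mathrm G^*_-$. *Pairing.* Let $\iota\colon\Sigma\subset M$ be a future oriented Cauchy surface: it is spacelike, that is, conormal to a field of covectors in $C^{\circledast}$, and is oriented as the boundary of its past. For $\psi,\xi\in\Gamma_{SC}(F)$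 with $f[\psi]=0$ and $f^*[\xi]=0$ the Green pairing is $\langle\psi,\xi\rangle_G=\int_\Sigma\iota^*G[\psi,\xi]$. *Claim.* The form $\iota^*G[\psi,\xi]$ has compact support for all such $\psi,\xi$. If $\psi=\mathrm G[\tilde\alpha^*]$ and $\xi=\mathrm G^*[\tilde\beta^*]$ with $\tilde\alpha^*,\tilde\beta^*\in\Gamma_0(\tilde F^*)$, then $\psi,\xi\in\Gamma_{SC}(F)$, $f[\psi]=0$, $f^*[\xi]=0$, and $$\langle\psi,\xi\rangle_G=\int_M\tilde\alpha^*\cdot\xi=\int_M\tilde\alpha^*\cdot\mathrm G^*[\tilde\beta^*]=-\int_M\mathrm G[\tilde\alpha^*]\cdot\tilde\beta^*=-\int_M\psi\cdot\tilde\beta^*.$$ Moreover the Green pairing is non-degenerate: if $\psi\in\Gamma_{SC}(F)$, $f[\psi]=0$, and $\langle\psi,\xi\rangle_G=0$ for all $\xi\in\Gamma_{SC}(F)$ with $f^*[\xi]=0$, then $\psi=0$; and if $\xi\in\Gamma_{SC}(F)$, $f^*[\xi]=0$, and $\langle\psi,\xi\rangle_G=0$ for all $\psi\in\Gamma_{SC}(F)$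 with $f[\psi]=0$, then $\xi=0$. -/

import Mathlib

open scoped Manifold ContDiff Topology NNReal
open Set Filter MeasureTheory Bundle

noncomputable section

namespace Conal

/-! ### Differential forms on smooth manifolds -/

section Forms

variable {n : ℕ} {N : Type*} [TopologicalSpace N] [ChartedSpace (EuclideanSpace ℝ (Fin n)) N]

/-- A (not necessarily smooth) differential `k`-form on the `n`-manifold `N`. -/
abbrev Form (n : ℕ) (N : Type*) [TopologicalSpace N]
    [ChartedSpace (EuclideanSpace ℝ (Fin n)) N] (k : ℕ) : Type _ :=
  ∀ x : N, TangentSpace (𝓡 n) x [⋀^Fin k]→L[ℝ] ℝ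

/-- The coordinate expression of a `k`-form in the preferred chart at `x`: the pullback of the form
along the inverse of the chart, a form on the target of the chart. -/
def Form.inChart {k : ℕ} (θ : Form n N k) (x : N) (u : EuclideanSpace ℝ (Fin n)) :
    EuclideanSpace ℝ (Fin n) [⋀^Fin k]→L[ℝ] ℝ :=
  (θ ((extChartAt (𝓡 n) x).symm u)).compContinuousLinearMap
    (mfderiv 𝓘(ℝ, EuclideanSpace ℝ (Fin n)) (𝓡 n) (extChartAt (𝓡 n) x).symm u)

/-- A form is smooth if all its coordinate expressions are. -/
def Form.IsSmooth {k : ℕ} (θ : Form n N k) : Prop :=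
  ∀ x : N, ContDiffOn ℝ ∞ (θ.inChart x) (extChartAt (𝓡 n) x).target

/-- The real vector space `Ω^k(N)` of smooth `k`-forms. -/
def smoothForms (n : ℕ) (N : Type*) [TopologicalSpace N]
    [ChartedSpace (EuclideanSpace ℝ (Fin n)) N] (k : ℕ) : Submodule ℝ (Form n N k) where
  carrier := {θ | θ.IsSmooth}
  zero_mem' := fun x => by
    have : Form.inChart (0 : Form n N k) x = fun _ => 0 := by
      funext u; ext v; rfl
    rw [this]; exact contDiffOn_const
  add_mem' := fun {θ η} hθ hη x => by
    have : Form.inChart (θ + η) x = fun u => θ.inChart x u + η.inChart x u := by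
      funext u; ext v; rfl
    rw [this]; exact (hθ x).add (hη x)
  smul_mem' := fun c θ hθ x => by
    have : Form.inChart (c • θ) x = fun u => c • θ.inChart x u := by
      funext u; ext v; rfl
    rw [this]; exact (hθ x).const_smul c

/-- The exterior derivative, computed at each point `x` in the preferred chart at `x`. -/
def Form.d {k : ℕ} (θ : Form n N k) : Form n N (k + 1) := fun x =>
  (extDeriv (θ.inChart x) (extChartAt (𝓡 n) x x)).compContinuousLinearMap
    (mfderiv (𝓡 n) 𝓘(ℝ, EuclideanSpace ℝ (Fin n)) (extChartAt (𝓡 n) x) x)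

/-- The pullback of a form along a map of manifolds. -/
def Form.pullback {n' : ℕ} {N' : Type*} [TopologicalSpace N']
    [ChartedSpace (EuclideanSpace ℝ (Fin n')) N'] {k : ℕ} (ι : N' → N) (θ : Form n N k) :
    Form n' N' k := fun s =>
  (θ (ι s)).compContinuousLinearMap (mfderiv (𝓡 n') (𝓡 n) ι s)

/-- The support of a section of a family of vector spaces: the closure of the set where it does
not vanish. -/
def supp {X : Type*} [TopologicalSpace X] {V : X → Type*} [∀ x, Zero (V x)] (φ : ∀ x, V x) :
    Set X :=
  closure {x | φ x ≠ 0}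

/-! ### Orientations and integration of top degree forms -/

/-- A tuple of `k` vectors is positive for an orientation of a `k`-dimensional space if a volume
form representing the orientation is positive on it. For `k = 0` an orientation is a sign, and the
empty tuple is positive exactly when the sign is. -/
def IsPositiveFrame {T : Type*} [AddCommGroup T] [Module ℝ T] {k : ℕ}
    (o : Orientation ℝ T (Fin k)) (v : Fin k → T) : Prop :=
  ∃ (θ : T [⋀^Fin k]→ₗ[ℝ] ℝ) (hθ : θ ≠ 0), rayOfNeZero ℝ θ hθ = o ∧ 0 < θ v

/-- The coordinate frame `∂/∂x¹, …, ∂/∂xⁿ` of the preferred chart at `x`, at the point with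
coordinates `u`. -/
def coordFrame (x : N) (u : EuclideanSpace ℝ (Fin n)) :
    Fin n → TangentSpace (𝓡 n) ((extChartAt (𝓡 n) x).symm u) := fun i =>
  mfderiv 𝓘(ℝ, EuclideanSpace ℝ (Fin n)) (𝓡 n) (extChartAt (𝓡 n) x).symm u
    (EuclideanSpace.single i (1 : ℝ) : EuclideanSpace ℝ (Fin n))

/-- An orientation of a manifold: an orientation of each tangent space, depending continuously on
the point (coordinate frames do not change sign near a point). -/
structure ManifoldOrientation (n : ℕ) (N : Type*) [TopologicalSpace N]
    [ChartedSpace (EuclideanSpace ℝ (Fin n)) N] where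
  at' : ∀ x : N, Orientation ℝ (TangentSpace (𝓡 n) x) (Fin n)
  continuous' : ∀ x : N, ∀ᶠ u in 𝓝 (extChartAt (𝓡 n) x x),
    (IsPositiveFrame (at' ((extChartAt (𝓡 n) x).symm u)) (coordFrame x u) ↔
      IsPositiveFrame (at' ((extChartAt (𝓡 n) x).symm (extChartAt (𝓡 n) x x)))
        (coordFrame x (extChartAt (𝓡 n) x x)))

/-- A smooth partition of unity subordinate to the preferred charts. -/
theorem exists_chartPartition (n : ℕ) (N : Type*) [TopologicalSpace N]
    [ChartedSpace (EuclideanSpace ℝ (Fin n)) N] [IsManifold (𝓡 n) ∞ N] [T2Space N]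
    [SecondCountableTopology N] :
    ∃ ρ : SmoothPartitionOfUnity N (𝓡 n) N univ,
      ρ.IsSubordinate fun x => (chartAt (EuclideanSpace ℝ (Fin n)) x).source := by
  have : LocallyCompactSpace N := Manifold.locallyCompact_of_finiteDimensional (𝓡 n)
  exact SmoothPartitionOfUnity.exists_isSubordinate_chartAt_source (𝓡 n) N

open Classical in
/-- The integral of a compactly supported form of top degree over an oriented manifold: the form is
cut into pieces by a smooth partition of unity subordinate to charts, and the coefficient of each
piece in the coordinates of its chart, with the sign of the chart, is integrated against Lebesgue
measure. (For continuous forms with compact support the sum is finite and does not depend on the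
partition.) -/
def formIntegral [IsManifold (𝓡 n) ∞ N] [T2Space N] [SecondCountableTopology N]
    (o : ManifoldOrientation n N) (θ : Form n N n) : ℝ :=
  ∑ᶠ x : N, ∫ u in (extChartAt (𝓡 n) x).target,
    (exists_chartPartition n N).choose x ((extChartAt (𝓡 n) x).symm u) *
      ((if IsPositiveFrame (o.at' ((extChartAt (𝓡 n) x).symm u)) (coordFrame x u)
          then 1 else -1) *
        θ ((extChartAt (𝓡 n) x).symm u) (coordFrame x u))

end Forms

/-! ### Causal structure on conal manifolds -/

section Causal

variable {m : ℕ} {M : Type*} [TopologicalSpace M]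
  [ChartedSpace (EuclideanSpace ℝ (Fin (m + 1))) M] [IsManifold (𝓡 (m + 1)) ∞ M]

/-- A chronal cone bundle `C ⊆ TM`: every fibre is a proper (non-empty, open, convex, salient) cone
and both `C` and its strict dual cone bundle in `T*M` are open. Openness of `C` makes the fibres
open, and makes `C` a smooth bundle over `M` (a surjective submersion with convex fibres). The last
field, closedness of the bundle of closed cones in `TM`, is equivalent to openness of the strict
dual cone bundle. -/
structure ChronalConeBundle (m : ℕ) (M : Type*) [TopologicalSpace M]
    [ChartedSpace (EuclideanSpace ℝ (Fin (m + 1))) M] [IsManifold (𝓡 (m + 1)) ∞ M] where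
  cone : ∀ x : M, Set (TangentSpace (𝓡 (m + 1)) x)
  nonempty' : ∀ x, (cone x).Nonempty
  smul_mem' : ∀ x, ∀ v ∈ cone x, ∀ t : ℝ, 0 < t → t • v ∈ cone x
  convex' : ∀ x, Convex ℝ (cone x)
  salient' : ∀ x, ∀ p v : TangentSpace (𝓡 (m + 1)) x, (∀ t : ℝ, p + t • v ∈ cone x) → v = 0
  isOpen' : IsOpen {p : TangentBundle (𝓡 (m + 1)) M | p.2 ∈ cone p.1}
  isClosed_closure' : IsClosed {p : TangentBundle (𝓡 (m + 1)) M | p.2 ∈ closure (cone p.1)}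

namespace ChronalConeBundle

variable (C : ChronalConeBundle m M)

/-- The strict convex dual cone at `x`: the future oriented spacelike covectors. -/
def spacelikeCovectors (x : M) : Set (TangentSpace (𝓡 (m + 1)) x →L[ℝ] ℝ) :=
  {l | ∀ v ∈ closure (C.cone x), v ≠ 0 → 0 < l v}

/-- `x ≪ y`: there is a smooth future directed timelike curve from `x` to `y`. -/
def Precedes (x y : M) : Prop :=
  ∃ γ : ℝ → M, ContMDiff 𝓘(ℝ, ℝ) (𝓡 (m + 1)) ∞ γ ∧ γ 0 = x ∧ γ 1 = y ∧
    ∀ t ∈ Icc (0 : ℝ) 1, mfderiv 𝓘(ℝ, ℝ) (𝓡 (m + 1)) γ t (1 : ℝ) ∈ C.cone (γ t)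

/-- The future domain of influence `I⁺(A)`. -/
def future (A : Set M) : Set M := {y | ∃ x ∈ A, C.Precedes x y}

/-- The past domain of influence `I⁻(A)`. -/
def past (A : Set M) : Set M := {y | ∃ x ∈ A, C.Precedes y x}

/-- The domain of influence `I(A) = I⁺(A) ∪ I⁻(A) ∪ A`. -/
def influence (A : Set M) : Set M := C.future A ∪ C.past A ∪ A

/-- `γ` is a future directed causal curve on the interval `J`: it is continuous, Lipschitz in
charts near every parameter, and its velocity at almost every parameter is a non-zero vector in the
closed cone. (This is the usual regularity class of causal curves, closed under limits. It contains
the smooth causal curves, and gives the same Cauchy surfaces when the cones vary smoothly.) -/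
def IsCausalCurveOn (γ : ℝ → M) (J : Set ℝ) : Prop :=
  ContinuousOn γ J ∧
  (∀ t ∈ J, ∃ K : ℝ≥0, ∃ u ∈ 𝓝[J] t,
    LipschitzOnWith K (fun s => extChartAt (𝓡 (m + 1)) (γ t) (γ s)) u) ∧
  ∀ᵐ t ∂(volume.restrict J), MDifferentiableAt 𝓘(ℝ, ℝ) (𝓡 (m + 1)) γ t ∧
    mfderiv 𝓘(ℝ, ℝ) (𝓡 (m + 1)) γ t (1 : ℝ) ∈ closure (C.cone (γ t)) ∧
    mfderiv 𝓘(ℝ, ℝ) (𝓡 (m + 1)) γ t (1 : ℝ) ≠ 0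

/-- `x < y`: there is a future directed causal curve from `x` to `y`. -/
def CausallyPrecedes (x y : M) : Prop :=
  ∃ γ : ℝ → M, C.IsCausalCurveOn γ (Icc 0 1) ∧ γ 0 = x ∧ γ 1 = y

/-- An inextensible causal curve: it is parametrized by the whole line and has neither a future nor
a past end point. -/
def IsInextensibleCausalCurve (γ : ℝ → M) : Prop :=
  C.IsCausalCurveOn γ univ ∧ (¬ ∃ p, Tendsto γ atTop (𝓝 p)) ∧ ¬ ∃ p, Tendsto γ atBot (𝓝 p)

/-- A Cauchy surface: a smooth embedded hypersurface which is acausal and which every inextensible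
causal curve meets exactly once. -/
structure IsCauchySurface (S : Set M) [ChartedSpace (EuclideanSpace ℝ (Fin m)) S] : Prop where
  isManifold : IsManifold (𝓡 m) ∞ S
  isSmoothEmbedding :
    Manifold.IsSmoothEmbedding (𝓡 m) (𝓡 (m + 1)) ∞ (Subtype.val : S → M)
  acausal : ∀ x ∈ S, ∀ y ∈ S, ¬ C.CausallyPrecedes x y
  meets_once : ∀ γ : ℝ → M, C.IsInextensibleCausalCurve γ → ∃! t : ℝ, γ t ∈ S

/-- A chronal cone bundle is globally hyperbolic if it has a Cauchy surface. -/
def IsGloballyHyperbolic : Prop :=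
  ∃ (S : Set M) (_ : ChartedSpace (EuclideanSpace ℝ (Fin m)) S), C.IsCauchySurface S

/-- An oriented hypersurface of an oriented manifold is future oriented (in particular spacelike) if
its oriented conormals are future oriented spacelike covectors. Here a conormal `l` is oriented when
a positive frame of the hypersurface, preceded by a vector `v` with `l v > 0`, is a positive frame
of the manifold; so the hypersurface has the boundary orientation of its past. -/
def IsFutureOriented (oM : ManifoldOrientation (m + 1) M) (S : Set M)
    [ChartedSpace (EuclideanSpace ℝ (Fin m)) S] (oS : ManifoldOrientation m S) : Prop :=
  ∀ s : S, ∃ l ∈ C.spacelikeCovectors (s : M),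
    (∀ w : TangentSpace (𝓡 m) s,
      l (mfderiv (𝓡 m) (𝓡 (m + 1)) (Subtype.val : S → M) s w) = 0) ∧
    ∀ v : TangentSpace (𝓡 (m + 1)) (s : M), 0 < l v → ∀ w : Fin m → TangentSpace (𝓡 m) s,
      (IsPositiveFrame (oS.at' s) w ↔
        IsPositiveFrame (oM.at' (s : M)) (Fin.cons v fun i =>
          mfderiv (𝓡 m) (𝓡 (m + 1)) (Subtype.val : S → M) s (w i)))

/-- A closed set is a retarded support if it lies in the closure of `I⁺(K)`, `K` compact. -/
def IsRetarded (A : Set M) : Prop := ∃ K : Set M, IsCompact K ∧ A ⊆ closure (C.future K)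

/-- A closed set is an advanced support if it lies in the closure of `I⁻(K)`, `K` compact. -/
def IsAdvanced (A : Set M) : Prop := ∃ K : Set M, IsCompact K ∧ A ⊆ closure (C.past K)

/-- A closed set is spacelike compact if it lies in the closure of `I(K)`, `K` compact. -/
def IsSpacelikeCompact (A : Set M) : Prop :=
  ∃ K : Set M, IsCompact K ∧ A ⊆ closure (C.influence K)

end ChronalConeBundle

end Causal

/-! ### Differential operators, Green functions and the Green pairing -/

section Operators

variable {m : ℕ} {M : Type*} [TopologicalSpace M]
  [ChartedSpace (EuclideanSpace ℝ (Fin (m + 1))) M] [IsManifold (𝓡 (m + 1)) ∞ M]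
  {V : Type*} [NormedAddCommGroup V] [NormedSpace ℝ V]
  {F : M → Type*} [TopologicalSpace (TotalSpace V F)] [∀ x, AddCommGroup (F x)]
  [∀ x, Module ℝ (F x)] [∀ x, TopologicalSpace (F x)] [FiberBundle V F] [VectorBundle ℝ V F]

/-- The space `Γ(F)` of smooth sections of the vector bundle `F` with typical fibre `V`. -/
abbrev Sections (m : ℕ) {M : Type*} [TopologicalSpace M]
    [ChartedSpace (EuclideanSpace ℝ (Fin (m + 1))) M]
    (V : Type*) [NormedAddCommGroup V] [NormedSpace ℝ V]
    (F : M → Type*) [TopologicalSpace (TotalSpace V F)] [∀ x, AddCommGroup (F x)]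
    [∀ x, Module ℝ (F x)] [∀ x, TopologicalSpace (F x)] [FiberBundle V F] [VectorBundle ℝ V F] :
    Type _ :=
  ContMDiffSection (𝓡 (m + 1)) V ∞ F

/-- The space `Γ(F̃*)` of smooth dual densities, i.e. smooth sections of `F* ⊗ Λⁿ T*M`, `n = m + 1`.
The fibre at `x` consists of the linear maps from `F x` to the `n`-covectors at `x`; such a family
is smooth if its contraction with every smooth section of `F` is a smooth `n`-form. -/
def DualDensities (m : ℕ) {M : Type*} [TopologicalSpace M]
    [ChartedSpace (EuclideanSpace ℝ (Fin (m + 1))) M]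
    (V : Type*) [NormedAddCommGroup V] [NormedSpace ℝ V]
    (F : M → Type*) [TopologicalSpace (TotalSpace V F)] [∀ x, AddCommGroup (F x)]
    [∀ x, Module ℝ (F x)] [∀ x, TopologicalSpace (F x)] [FiberBundle V F] [VectorBundle ℝ V F] :
    Submodule ℝ (∀ x : M, F x →ₗ[ℝ] (TangentSpace (𝓡 (m + 1)) x [⋀^Fin (m + 1)]→L[ℝ] ℝ)) where
  carrier := {α | ∀ φ : Sections m V F, (fun x => α x (φ x)) ∈ smoothForms (m + 1) M (m + 1)}
  zero_mem' := fun _ => (smoothForms (m + 1) M (m + 1)).zero_mem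
  add_mem' := fun hα hβ φ => (smoothForms (m + 1) M (m + 1)).add_mem (hα φ) (hβ φ)
  smul_mem' := fun c _ hα φ => (smoothForms (m + 1) M (m + 1)).smul_mem c (hα φ)

/-- The `n`-form `α · φ`, the pointwise pairing of a dual density with a section. -/
def contract (α : DualDensities m V F) (φ : Sections m V F) : Form (m + 1) M (m + 1) :=
  fun x => α.1 x (φ x)

/-- The `k`-jet of the section `φ` at `x` vanishes: in local coordinates all derivatives up to order
`k` vanish at `x`. -/
def JetVanishes (k : ℕ) (φ : Sections m V F) (x : M) : Prop :=
  ∀ i ≤ k, iteratedFDeriv ℝ i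
    (fun u : EuclideanSpace ℝ (Fin (m + 1)) =>
      (trivializationAt V F x (TotalSpace.mk' V ((extChartAt (𝓡 (m + 1)) x).symm u)
        (φ ((extChartAt (𝓡 (m + 1)) x).symm u)))).2)
    (extChartAt (𝓡 (m + 1)) x x) = 0

/-- A linear map from sections to dual densities is a differential operator if, for some order `k`,
its value at each point depends only on the `k`-jet there. -/
def IsDiffOp (f : Sections m V F →ₗ[ℝ] DualDensities m V F) : Prop :=
  ∃ k : ℕ, ∀ φ x, JetVanishes k φ x → (f φ).1 x = 0

/-- A bilinear map from pairs of sections to `(n-1)`-forms is a bilinear differential operator if,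
for some order `k`, its value at each point depends only on the `k`-jets there. -/
def IsBilinDiffOp
    (G : Sections m V F →ₗ[ℝ] Sections m V F →ₗ[ℝ] smoothForms (m + 1) M m) : Prop :=
  ∃ k : ℕ, ∀ φ ψ x, (JetVanishes k φ x ∨ JetVanishes k ψ x) → (G φ ψ).1 x = 0

/-- `G` is a Green form for `f` and `fs`: a bilinear differential operator with
`f[φ]·ψ - φ·fs[ψ] = dG[φ,ψ]`. If there is one, `f` and `fs` are mutually adjoint. -/
structure IsGreenForm (f fs : Sections m V F →ₗ[ℝ] DualDensities m V F)
    (G : Sections m V F →ₗ[ℝ] Sections m V F →ₗ[ℝ] smoothForms (m + 1) M m) : Prop where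
  isBilinDiffOp : IsBilinDiffOp G
  green : ∀ φ ψ, contract (f φ) ψ - contract (fs ψ) φ = Form.d (G φ ψ).1

variable (C : ChronalConeBundle m M) (f : Sections m V F →ₗ[ℝ] DualDensities m V F)

/-- `f` is Green hyperbolic with respect to the globally hyperbolic conal structure `C`: for every
source with retarded (advanced) support the inhomogeneous equation has a unique solution with
retarded (advanced) support, and this solution is supported in the closure of the future (past) of
the support of the source. -/
structure IsGreenHyperbolic : Prop where
  globallyHyperbolic : C.IsGloballyHyperbolic
  retarded : ∀ α : DualDensities m V F, C.IsRetarded (supp α.1) →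
    ∃ φ : Sections m V F, C.IsRetarded (supp φ) ∧ f φ = α ∧
      supp φ ⊆ closure (C.future (supp α.1)) ∧
      ∀ φ' : Sections m V F, C.IsRetarded (supp φ') → f φ' = α → φ' = φ
  advanced : ∀ α : DualDensities m V F, C.IsAdvanced (supp α.1) →
    ∃ φ : Sections m V F, C.IsAdvanced (supp φ) ∧ f φ = α ∧
      supp φ ⊆ closure (C.past (supp α.1)) ∧
      ∀ φ' : Sections m V F, C.IsAdvanced (supp φ') → f φ' = α → φ' = φ

open Classical in
/-- The retarded Green function `G₊`: `G₊[α]` is the solution of `f[φ] = α` with retarded support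
(and `0` if there is none, which does not occur for Green hyperbolic `f` and retarded `α`). -/
def retardedGreen (α : DualDensities m V F) : Sections m V F :=
  if h : ∃ φ : Sections m V F, C.IsRetarded (supp φ) ∧ f φ = α then h.choose else 0

open Classical in
/-- The advanced Green function `G₋`: `G₋[α]` is the solution of `f[φ] = α` with advanced support
(and `0` if there is none, which does not occur for Green hyperbolic `f` and advanced `α`). -/
def advancedGreen (α : DualDensities m V F) : Sections m V F :=
  if h : ∃ φ : Sections m V F, C.IsAdvanced (supp φ) ∧ f φ = α then h.choose else 0

/-- The causal Green function `G = G₊ - G₋`. -/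
def causalGreen (α : DualDensities m V F) : Sections m V F :=
  retardedGreen C f α - advancedGreen C f α

/-- The space of solutions of `f[φ] = 0` with spacelike compact support. -/
def solutionsSC : Set (Sections m V F) := {φ | f φ = 0 ∧ C.IsSpacelikeCompact (supp φ)}

/-- The space of smooth dual densities with compact support. -/
def compactDualDensities (m : ℕ) {M : Type*} [TopologicalSpace M]
    [ChartedSpace (EuclideanSpace ℝ (Fin (m + 1))) M]
    (V : Type*) [NormedAddCommGroup V] [NormedSpace ℝ V]
    (F : M → Type*) [TopologicalSpace (TotalSpace V F)] [∀ x, AddCommGroup (F x)]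
    [∀ x, Module ℝ (F x)] [∀ x, TopologicalSpace (F x)] [FiberBundle V F] [VectorBundle ℝ V F] :
    Set (DualDensities m V F) :=
  {α | IsCompact (supp α.1)}

/-- The integrand `ι^* G[φ,ψ]` of the Green pairing, a form of top degree on the hypersurface. -/
def greenIntegrand (G : Sections m V F →ₗ[ℝ] Sections m V F →ₗ[ℝ] smoothForms (m + 1) M m)
    (S : Set M) [ChartedSpace (EuclideanSpace ℝ (Fin m)) S] (φ ψ : Sections m V F) :
    Form m S m :=
  Form.pullback (Subtype.val : S → M) (G φ ψ).1

/-- The Green pairing `⟨φ,ψ⟩_G = ∫_S ι^* G[φ,ψ]`. -/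
def greenPairing [T2Space M] [SecondCountableTopology M]
    (G : Sections m V F →ₗ[ℝ] Sections m V F →ₗ[ℝ] smoothForms (m + 1) M m)
    (S : Set M) [ChartedSpace (EuclideanSpace ℝ (Fin m)) S] [IsManifold (𝓡 m) ∞ S]
    (oS : ManifoldOrientation m S) (φ ψ : Sections m V F) : ℝ :=
  formIntegral oS (greenIntegrand G S φ ψ)

end Operators

end Conal

end

open scoped Manifold ContDiff
open Conal

/-! Everything rests on one computation. Let `fs ξ = 0`, and let φ₊ and φ₋ be the retarded and the
advanced solution of f[φ] = α, where α has compact support. Green's identity gives dG[φ₊, ξ] =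
dG[φ₋, ξ] = α·ξ. To the past of Σ the support of φ₊ is relatively compact, so Stokes' theorem there
gives ∫_past α·ξ = ∫_Σ ι*G[φ₊, ξ]. To the future of Σ the support of φ₋ is relatively compact and Σ
bounds with the opposite orientation, so ∫_future α·ξ = -∫_Σ ι*G[φ₋, ξ]. Since Σ is a null set,
addition gives ⟨G[α], ξ⟩ = ∫_M α·ξ (`greenPairing_causalGreen`); the support of ξ plays no role. The
pair (f*, f) has the Green form (φ, ψ) ↦ -G[ψ, φ], so the same computation gives ⟨ψ, G*[β]⟩ = -∫_M
β·ψ for every solution ψ (`greenPairing_causalGreen_right`).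

Non-degeneracy does not need every solution to be of the form G[α]. A solution that pairs to zero
with all G*[β] has zero integral against every test density β, hence vanishes by the fundamental
lemma of the calculus of variations (`eq_zero_of_formIntegral_contract`).

Two ingredients carry the work. The causal one is that the closed future of a compact set meets the
past side of Σ in a relatively compact set (`exists_compact_closure_future_inter`). Otherwise some
point would start a causal chain that never converges and never gets beyond Σ; prolonged backwards,
it would yield an inextensible causal curve that does not cross Σ into its future. Limits of causal
curves are needed only inside small coordinate balls, where the causal relation is closed
(`isClosed_coneRel`). So the argument runs for an abstract relation with `HasCausalBalls`, and time
reversal is `swap`.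

The geometric one is Stokes' theorem. Around each point of Σ there is a chart in which Σ is a
coordinate hyperplane and its past and future are the two sides (`exists_isCauchyChart`). There the
theorem is the divergence theorem on half spaces; a partition of unity makes it global, and a cutoff
admits forms whose support is compact on one side only (`stokes_past`, `stokes_future`). -/

noncomputable section

namespace Conal

/-! ### Abstract causal order relations -/

section Order

variable {X : Type*} [TopologicalSpace X]

/-- A compact set `B` with an open subset `O` in which the causal relation `R` is locally closed:
`Γ` is the relation of being equal or joined by a causal curve in `B`. -/
structure CausalBall (R : X → X → Prop) (B O : Set X) (Γ : Set (X × X)) : Prop where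
  isCompact : IsCompact B
  isOpen : IsOpen O
  subset : O ⊆ B
  isClosed : IsClosed Γ
  rel : ∀ x y, (x, y) ∈ Γ → x = y ∨ R x y
  exit : ∀ x y, R x y → x ∈ O → y ∉ O → ∃ q ∈ B \ O, (x, q) ∈ Γ ∧ (q = y ∨ R q y)
  exit_back : ∀ x y, R x y → y ∈ O → x ∉ O → ∃ q ∈ B \ O, (q, y) ∈ Γ ∧ (x = q ∨ R x q)
  succ : ∀ x ∈ O, ∃ q ∈ B \ O, (x, q) ∈ Γ
  pred : ∀ x ∈ O, ∃ q ∈ B \ O, (q, x) ∈ Γ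

theorem CausalBall.swap {R : X → X → Prop} {B O : Set X} {Γ : Set (X × X)}
    (h : CausalBall R B O Γ) : CausalBall (fun x y => R y x) B O (Prod.swap ⁻¹' Γ) where
  isCompact := h.isCompact
  isOpen := h.isOpen
  subset := h.subset
  isClosed := h.isClosed.preimage continuous_swap
  rel x y hxy := (h.rel y x hxy).imp Eq.symm id
  exit x y hR hx hy := by
    obtain ⟨q, hq, h1, h2⟩ := h.exit_back y x hR hx hy
    exact ⟨q, hq, h1, h2.imp Eq.symm id⟩
  exit_back x y hR hx hy := by
    obtain ⟨q, hq, h1, h2⟩ := h.exit y x hR hx hy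
    exact ⟨q, hq, h1, h2.imp Eq.symm id⟩
  succ x hx := h.pred x hx
  pred x hx := h.succ x hx

/-- Every point has arbitrarily small causal balls. -/
def HasCausalBalls (R : X → X → Prop) : Prop :=
  ∀ x, ∀ W ∈ 𝓝 x, ∃ B O Γ, CausalBall R B O Γ ∧ B ⊆ W ∧ x ∈ O

theorem HasCausalBalls.swap {R : X → X → Prop} (h : HasCausalBalls R) :
    HasCausalBalls fun x y => R y x := fun x W hW => by
  obtain ⟨B, O, Γ, h1, h2, h3⟩ := h x W hW
  exact ⟨B, O, _, h1.swap, h2, h3⟩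

/-- A set in which every point of a small open set has a successor outside of a larger open set
contains divergent chains. -/
theorem exists_divergent_chain [SecondCountableTopology X] {R : X → X → Prop} {Y : Set X}
    (hY : ∀ x : X, ∃ V O : Set X, IsOpen V ∧ IsOpen O ∧ x ∈ V ∧ closure V ⊆ O ∧
      ∀ p ∈ Y ∩ V, ∃ q ∈ Y, R p q ∧ q ∉ O) {p : X} (hp : p ∈ Y) :
    ∃ s : ℕ → X, s 0 = p ∧ (∀ n, s n ∈ Y) ∧ (∀ n, R (s n) (s (n + 1))) ∧
      ¬ ∃ x, Tendsto s atTop (𝓝 x) := by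
  classical
  choose V O hV hO hxV hVO hstep using hY
  obtain ⟨T, hTc, hT⟩ := TopologicalSpace.countable_cover_nhds (fun x => (hV x).mem_nhds (hxV x))
  obtain ⟨c, hc⟩ := (hTc.exists_eq_range (by
    by_contra hT'
    rw [not_nonempty_iff_eq_empty] at hT'
    simp [hT'] at hT
    exact (Set.ext_iff.1 hT p).2 trivial) : ∃ c : ℕ → X, T = range c)
  have hcov : ∀ x, ∃ n, x ∈ V (c n) := fun x => by
    have : x ∈ ⋃ x ∈ T, V x := by rw [hT]; trivial
    simpa [hc] using this
  -- The successor avoids the open set attached to the least index whose `V` contains the point.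
  -- Choosing the least index keeps the indices bounded near a limit.
  have hnext : ∀ x : Y, ∃ q : Y, R x q ∧ (q : X) ∉ O (c (Nat.find (hcov x))) := fun x => by
    obtain ⟨q, hq, h1, h2⟩ := hstep (c (Nat.find (hcov x))) x ⟨x.2, Nat.find_spec (hcov x)⟩
    exact ⟨⟨q, hq⟩, h1, h2⟩
  choose next hn1 hn2 using hnext
  set s : ℕ → Y := fun n => next^[n] ⟨p, hp⟩ with hs
  have hsR : ∀ n : ℕ, R (s n : X) (s (n + 1) : X) := fun n => by
    have := hn1 (s n)
    simpa only [hs, Function.iterate_succ_apply'] using this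
  have hsO : ∀ n : ℕ, (s (n + 1) : X) ∉ O (c (Nat.find (hcov (s n)))) := fun n => by
    have := hn2 (s n)
    simpa only [hs, Function.iterate_succ_apply'] using this
  refine ⟨fun n => (s n : X), rfl, fun n => (s n).2, hsR, ?_⟩
  rintro ⟨x, hx⟩
  obtain ⟨N, hN⟩ := hcov x
  have hev : ∀ᶠ n in atTop, Nat.find (hcov (s n)) ∈ Finset.range (N + 1) := by
    filter_upwards [hx ((hV _).mem_nhds hN)] with n hn
    exact Finset.mem_range_succ_iff.2 (Nat.find_min' _ hn)
  -- By the pigeonhole principle one index recurs. It puts the limit in `closure (V (c j))`, while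
  -- the successors put it in the complement of `O (c j)`.
  obtain ⟨j, -, hj⟩ : ∃ j ∈ Finset.range (N + 1), ∃ᶠ n in atTop, Nat.find (hcov (s n)) = j := by
    by_contra! hcon
    have : ∀ᶠ n in atTop, ∀ j ∈ Finset.range (N + 1), Nat.find (hcov (s n)) ≠ j := by
      rw [Filter.eventually_all_finset]
      exact fun j hj => by simpa using hcon j hj
    obtain ⟨n, h1, h2⟩ := (this.and hev).exists
    exact h1 _ h2 rfl
  have h1 : x ∈ closure (V (c j)) :=
    mem_closure_of_frequently_of_tendsto (hj.mono fun n hn => hn ▸ Nat.find_spec (hcov (s n))) hx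
  have h2 : x ∈ (O (c j))ᶜ := by
    have hx' := hx.comp (tendsto_add_atTop_nat 1)
    refine (hO (c j)).isClosed_compl.mem_of_frequently_of_tendsto (hj.mono fun n hn => ?_) hx'
    have := hsO n
    rw [hn] at this
    exact this
  exact h2 (hVO _ h1)

/-- A second ball inside the open part of the first provides the margin `closure V ⊆ O`, because its
compact carrier is closed. -/
theorem HasCausalBalls.exists_cover [T2Space X] {R : X → X → Prop} (h : HasCausalBalls R) (x : X) :
    ∃ V B O : Set X, ∃ Γ, CausalBall R B O Γ ∧ IsOpen V ∧ x ∈ V ∧ closure V ⊆ O := by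
  obtain ⟨B, O, Γ, hB, -, hx⟩ := h x univ univ_mem
  obtain ⟨B', O', Γ', hB', hBO, hx'⟩ := h x O (hB.isOpen.mem_nhds hx)
  exact ⟨O', B, O, Γ, hB, hB'.isOpen, hx',
    (closure_minimal hB'.subset hB'.isCompact.isClosed).trans hBO⟩

theorem HasCausalBalls.exists_divergent_chain [T2Space X] [SecondCountableTopology X]
    {R : X → X → Prop} (h : HasCausalBalls R) (p : X) :
    ∃ s : ℕ → X, s 0 = p ∧ (∀ n, R (s n) (s (n + 1))) ∧ ¬ ∃ x, Tendsto s atTop (𝓝 x) := by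
  obtain ⟨s, h1, -, h2⟩ := Conal.exists_divergent_chain (R := R) (Y := univ) (fun x => by
    obtain ⟨V, B, O, Γ, hB, hV, hx, hVO⟩ := h.exists_cover x
    refine ⟨V, O, hV, hB.isOpen, hx, hVO, fun p hp => ?_⟩
    have hpO := hVO (subset_closure hp.2)
    obtain ⟨q, hq, hqΓ⟩ := hB.succ p hpO
    exact ⟨q, trivial, (hB.rel _ _ hqΓ).resolve_left (fun e => hq.2 (e ▸ hpO)), hq.2⟩)
    (mem_univ p)
  exact ⟨s, h1, h2⟩

/-- A decomposition of a space with a causal relation into the past `P`, a Cauchy surface `S` and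
the future `F`. -/
structure CausalSplitting (R : X → X → Prop) (P S F : Set X) : Prop where
  trans : ∀ x y z, R x y → R y z → R x z
  isOpen_past : IsOpen P
  isOpen_future : IsOpen F
  cover : ∀ x, x ∈ P ∨ x ∈ S ∨ x ∈ F
  disjoint_past : Disjoint P S
  disjoint_future : Disjoint F S
  disjoint : Disjoint P F
  future_mem : ∀ x y, R x y → x ∈ F ∪ S → y ∈ F
  past_mem : ∀ x y, R x y → y ∈ P ∪ S → x ∈ P
  chain : ∀ p : ℤ → X, (∀ i, R (p i) (p (i + 1))) → (¬ ∃ x, Tendsto p atTop (𝓝 x)) →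
    (¬ ∃ x, Tendsto p atBot (𝓝 x)) → (∃ i, p i ∈ P) ∧ ∃ i, p i ∈ F
  ball : HasCausalBalls R

namespace CausalSplitting

variable {R : X → X → Prop} {P S F : Set X}

theorem swap (h : CausalSplitting R P S F) : CausalSplitting (fun x y => R y x) F S P where
  trans x y z h1 h2 := h.trans _ _ _ h2 h1
  isOpen_past := h.isOpen_future
  isOpen_future := h.isOpen_past
  cover x := by rcases h.cover x with h | h | h <;> simp [h]
  disjoint_past := h.disjoint_future
  disjoint_future := h.disjoint_past
  disjoint := h.disjoint.symm
  future_mem x y := h.past_mem y x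
  past_mem x y := h.future_mem y x
  -- Time reversal reindexes a chain by `i ↦ -i`, which exchanges its two ends.
  chain p hp h1 h2 := by
    have := h.chain (fun i => p (-i)) (fun i => by
      have := hp (-(i + 1)); rwa [show -(i + 1) + 1 = -i by ring] at this)
      (fun ⟨x, hx⟩ => h2 ⟨x, by
        simpa [Function.comp_def] using hx.comp (tendsto_neg_atBot_atTop (G := ℤ))⟩)
      (fun ⟨x, hx⟩ => h1 ⟨x, by
        simpa [Function.comp_def] using hx.comp (tendsto_neg_atTop_atBot (G := ℤ))⟩)
    exact ⟨this.2.imp' Neg.neg fun _ => id, this.1.imp' Neg.neg fun _ => id⟩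
  ball := h.ball.swap

theorem isClosed_surface (h : CausalSplitting R P S F) : IsClosed S := by
  have : S = (P ∪ F)ᶜ := by
    ext x
    have h1 := h.cover x
    have h2 := fun hx hs => h.disjoint_past.le_bot (⟨hx, hs⟩ : x ∈ P ⊓ S)
    have h3 := fun hx hs => h.disjoint_future.le_bot (⟨hx, hs⟩ : x ∈ F ⊓ S)
    simp only [mem_compl_iff, mem_union]
    tauto
  rw [this]
  exact (h.isOpen_past.union h.isOpen_future).isClosed_compl

variable [T2Space X]

/-- Call a point bad (the set `Y`) if causal curves from points arbitrarily near it lead to points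
of `P ∪ S` that escape every compact set. No bad point lies in `F`, which is open and closed under
successors. A bad point in a small ball has a bad successor outside its open part, namely a limit of
exit points. So a bad `p` starts a divergent chain of bad points. Prolonged to the past, this chain
has to visit `F`, which neither half can do. -/
theorem exists_compact_of_point [SecondCountableTopology X] (h : CausalSplitting R P S F) (p : X) :
    ¬ ∃ᶠ z in 𝓝 p ×ˢ cocompact X, R z.1 z.2 ∧ z.2 ∈ P ∪ S := by
  intro hp
  set Y : Set X := {p | ∃ᶠ z in 𝓝 p ×ˢ cocompact X, R z.1 z.2 ∧ z.2 ∈ P ∪ S} with hYdef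
  have hYF : ∀ y ∈ Y, y ∉ F := by
    intro y hy hyF
    have h1 : ∀ᶠ z in 𝓝 y ×ˢ cocompact X, z.1 ∈ F :=
      tendsto_fst.eventually (h.isOpen_future.mem_nhds hyF)
    obtain ⟨z, ⟨h2, h3⟩, h4⟩ := (hy.and_eventually h1).exists
    have := h.future_mem _ _ h2 (Or.inl h4)
    rcases h3 with h3 | h3
    · exact h.disjoint.le_bot ⟨h3, this⟩
    · exact h.disjoint_future.le_bot ⟨this, h3⟩
  have hstep : ∀ (B O : Set X) (Γ : Set (X × X)), CausalBall R B O Γ → ∀ y ∈ Y, y ∈ O →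
      ∃ q ∈ Y, R y q ∧ q ∉ O := by
    intro B O Γ hB y hy hyO
    have h1 : ∀ᶠ z in 𝓝 y ×ˢ cocompact X, z.1 ∈ O ∧ z.2 ∉ B :=
      (tendsto_fst.eventually (hB.isOpen.mem_nhds hyO)).and
        (tendsto_snd.eventually hB.isCompact.compl_mem_cocompact)
    have h2 := hy.and_eventually h1
    have h3 : ∀ z : X × X, ∃ q, ((R z.1 z.2 ∧ z.2 ∈ P ∪ S) ∧ z.1 ∈ O ∧ z.2 ∉ B) →
        q ∈ B \ O ∧ (z.1, q) ∈ Γ ∧ R q z.2 := by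
      intro z
      by_cases hz : (R z.1 z.2 ∧ z.2 ∈ P ∪ S) ∧ z.1 ∈ O ∧ z.2 ∉ B
      · obtain ⟨q, hq, hq1, hq2⟩ := hB.exit _ _ hz.1.1 hz.2.1 (fun hO => hz.2.2 (hB.subset hO))
        exact ⟨q, fun _ => ⟨hq, hq1, hq2.resolve_left fun e => hz.2.2 (e ▸ hq.1)⟩⟩
      · exact ⟨y, fun hz' => absurd hz' hz⟩
    choose q hq using h3
    have : NeBot (𝓝 y ×ˢ cocompact X ⊓
      𝓟 {z | (R z.1 z.2 ∧ z.2 ∈ P ∪ S) ∧ z.1 ∈ O ∧ z.2 ∉ B}) := frequently_mem_iff_neBot.1 h2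
    -- Along an ultrafilter the exit points converge in the compact set `B \ O`, and closedness of
    -- `Γ` carries the relation to the limit.
    obtain ⟨𝒰, hle⟩ := Ultrafilter.exists_le (𝓝 y ×ˢ cocompact X ⊓
      𝓟 {z | (R z.1 z.2 ∧ z.2 ∈ P ∪ S) ∧ z.1 ∈ O ∧ z.2 ∉ B})
    have hgood : ∀ᶠ z in (𝒰 : Filter (X × X)),
        (R z.1 z.2 ∧ z.2 ∈ P ∪ S) ∧ z.1 ∈ O ∧ z.2 ∉ B :=
      hle.trans inf_le_right (mem_principal_self _)
    have hBO : IsCompact (B \ O) := hB.isCompact.diff hB.isOpen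
    obtain ⟨q0, hq0, hlim⟩ := hBO.ultrafilter_le_nhds (𝒰.map q)
      (by
        rw [le_principal_iff]
        exact (hgood.mono fun z hz => (hq z hz).1))
    have hlim' : Tendsto q 𝒰 (𝓝 q0) := hlim
    have hfst : Tendsto Prod.fst (𝒰 : Filter (X × X)) (𝓝 y) :=
      tendsto_fst.mono_left (hle.trans inf_le_left)
    have hsnd : Tendsto Prod.snd (𝒰 : Filter (X × X)) (cocompact X) :=
      tendsto_snd.mono_left (hle.trans inf_le_left)
    have hΓ : (y, q0) ∈ Γ := hB.isClosed.mem_of_tendsto (hfst.prodMk_nhds hlim')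
      (hgood.mono fun z hz => (hq z hz).2.1)
    refine ⟨q0, ?_, (hB.rel _ _ hΓ).resolve_left (fun e => hq0.2 (e ▸ hyO)), hq0.2⟩
    -- The limit is bad again: the exit points near it still lead to points going to infinity.
    exact (hlim'.prodMk hsnd).frequently
      (hgood.mono fun z hz => ⟨(hq z hz).2.2, hz.1.2⟩).frequently
  obtain ⟨s, hs0, hsY, hsR, hsl⟩ := exists_divergent_chain (R := R) (Y := Y) (fun x => by
    obtain ⟨V, B, O, Γ, hB, hV, hx, hVO⟩ := h.ball.exists_cover x
    exact ⟨V, O, hV, hB.isOpen, hx, hVO, fun p hp => hstep B O Γ hB p hp.1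
      (hVO (subset_closure hp.2))⟩) hp
  obtain ⟨t, ht0, htR, htl⟩ := h.ball.swap.exists_divergent_chain p
  -- The forward and the backward chain share the vertex `p`, at index `0`.
  let c : ℤ → X := fun i => if 0 ≤ i then s i.toNat else t (-i).toNat
  have hc : ∀ i, R (c i) (c (i + 1)) := by
    intro i
    simp only [c]
    rcases lt_trichotomy i (-1) with hi | rfl | hi
    · rw [if_neg (by omega), if_neg (by omega)]
      have := htR (-(i + 1)).toNat
      rwa [show (-(i + 1)).toNat + 1 = (-i).toNat by omega] at this
    · simp only [Left.nonneg_neg_iff, Int.reduceLE, ↓reduceIte, neg_neg, Int.toNat_one,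
        Int.reduceNeg, neg_add_cancel, le_refl, Int.toNat_zero]
      rw [hs0, ← ht0]; exact htR 0
    · rw [if_pos (by omega), if_pos (by omega)]
      have := hsR i.toNat
      rwa [show i.toNat + 1 = (i + 1).toNat by omega] at this
  obtain ⟨-, i, hi⟩ := h.chain c hc
    (fun ⟨x, hx⟩ => hsl ⟨x, by
      have := hx.comp tendsto_natCast_atTop_atTop
      refine this.congr fun n => by simp [c]⟩)
    (fun ⟨x, hx⟩ => htl ⟨x, by
      have h1 : Tendsto (fun n : ℕ => -(n : ℤ)) atTop atBot :=
        (tendsto_neg_atTop_atBot (G := ℤ)).comp tendsto_natCast_atTop_atTop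
      refine (hx.comp h1).congr fun n => ?_
      rcases Nat.eq_zero_or_pos n with rfl | hn
      · simp [c, hs0, ht0]
      · simp only [c, Function.comp]
        rw [if_neg (by omega)]; simp⟩)
  by_cases hi0 : 0 ≤ i
  · simp only [c, hi0, if_true] at hi
    exact hYF _ (hsY _) hi
  · simp only [c, hi0, if_false] at hi
    -- Since `F` is closed under successors, a point of the backward chain in `F` would put `p`
    -- itself into `F`.
    have key : ∀ n, t n ∈ F → t 0 ∈ F := by
      intro n
      induction n with
      | zero => exact id
      | succ n ih => exact fun hn => ih (h.future_mem _ _ (htR n) (Or.inl hn))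
    exact hYF p hp (ht0 ▸ key _ hi)

/-- The pointwise statement bounds the successors of a whole neighbourhood, and finitely many
neighbourhoods cover `K`. -/
theorem exists_compact_future_inter [SecondCountableTopology X] (h : CausalSplitting R P S F)
    {K : Set X} (hK : IsCompact K) :
    ∃ Q : Set X, IsCompact Q ∧ ∀ k ∈ K, ∀ y, R k y → y ∈ P ∪ S → y ∈ Q := by
  refine hK.induction_on (p := fun K => ∃ Q : Set X, IsCompact Q ∧
    ∀ k ∈ K, ∀ y, R k y → y ∈ P ∪ S → y ∈ Q) ⟨∅, isCompact_empty, by simp⟩ ?_ ?_ ?_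
  · rintro s t hst ⟨Q, h1, h2⟩
    exact ⟨Q, h1, fun k hk => h2 k (hst hk)⟩
  · rintro s t ⟨Q, h1, h2⟩ ⟨Q', h1', h2'⟩
    exact ⟨Q ∪ Q', h1.union h1', fun k hk y hy hyP =>
      hk.imp (fun hk => h2 k hk y hy hyP) (fun hk => h2' k hk y hy hyP)⟩
  · intro x _
    have := h.exists_compact_of_point x
    rw [not_frequently, eventually_prod_iff] at this
    obtain ⟨pa, ha, pb, hb, hab⟩ := this
    obtain ⟨Q, hQ, hQb⟩ := mem_cocompact.1 hb
    exact ⟨_, mem_nhdsWithin_of_mem_nhds ha, Q, hQ, fun k hk y hy hyP => by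
      by_contra hyQ
      exact hab hk (hQb hyQ) ⟨hy, hyP⟩⟩

/-- The closed future of a compact set meets the past of a Cauchy surface in a relatively compact
set. -/
theorem exists_compact_closure_future_inter [SecondCountableTopology X]
    (h : CausalSplitting R P S F) {K : Set X} (hK : IsCompact K) :
    ∃ Q : Set X, IsCompact Q ∧ closure {y | ∃ k ∈ K, R k y} ∩ (P ∪ S) ⊆ Q := by
  obtain ⟨Q, hQ, hKQ⟩ := h.exists_compact_future_inter hK
  refine ⟨Q ∪ K, hQ.union hK, ?_⟩
  rintro x ⟨hx, hxPS⟩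
  by_cases hxP : x ∈ closure ({y | ∃ k ∈ K, R k y} ∩ P)
  · left
    refine closure_minimal ?_ hQ.isClosed hxP
    rintro y ⟨⟨k, hk, hky⟩, hy⟩
    exact hKQ k hk y hky (Or.inl hy)
  -- The remaining `x` lies on `S` and is not a limit of points of `P` in the future of `K`. If `x ∉
  -- K`, curves from `K` ending near `x` enter a small ball at points outside `P`. A limit of these
  -- entry points precedes `x ∈ S`, so it lies in the open set `P`, a contradiction.
  right
  by_contra hxK
  have hxS : x ∈ S := hxPS.resolve_left fun hP => hxP (by
    rw [inter_comm]; exact h.isOpen_past.inter_closure ⟨hP, hx⟩)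
  obtain ⟨B, O, Γ, hB, hBW, hxO⟩ := h.ball x _ (inter_mem (hK.isClosed.isOpen_compl.mem_nhds hxK)
    (isClosed_closure.isOpen_compl.mem_nhds hxP))
  have h1 : ∃ᶠ y in 𝓝 x, (∃ k ∈ K, R k y) ∧ y ∈ O :=
    (mem_closure_iff_frequently.1 hx).and_eventually (hB.isOpen.mem_nhds hxO)
  have h2 : ∀ y, ∃ q, ((∃ k ∈ K, R k y) ∧ y ∈ O) → q ∈ B \ O ∧ (q, y) ∈ Γ ∧ q ∉ P := by
    intro y
    by_cases hy : (∃ k ∈ K, R k y) ∧ y ∈ O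
    · obtain ⟨⟨k, hk, hky⟩, hyO⟩ := hy
      have hkB : k ∉ B := fun hkB => (hBW hkB).1 hk
      obtain ⟨q, hq, hqΓ, hkq⟩ := hB.exit_back k y hky hyO (fun hO => hkB (hB.subset hO))
      refine ⟨q, fun _ => ⟨hq, hqΓ, fun hqP => (hBW hq.1).2 (subset_closure ⟨⟨k, hk, ?_⟩, hqP⟩)⟩⟩
      exact hkq.resolve_left fun e => hkB (e ▸ hq.1)
    · exact ⟨x, fun hy' => absurd hy' hy⟩
  choose q hq using h2
  have : NeBot (𝓝 x ⊓ 𝓟 {y | (∃ k ∈ K, R k y) ∧ y ∈ O}) := frequently_mem_iff_neBot.1 h1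
  obtain ⟨𝒰, hle⟩ := Ultrafilter.exists_le (𝓝 x ⊓ 𝓟 {y | (∃ k ∈ K, R k y) ∧ y ∈ O})
  have hgood : ∀ᶠ y in (𝒰 : Filter X), (∃ k ∈ K, R k y) ∧ y ∈ O :=
    hle.trans inf_le_right (mem_principal_self _)
  obtain ⟨q0, hq0, hlim⟩ := (hB.isCompact.diff hB.isOpen).ultrafilter_le_nhds (𝒰.map q)
    (by rw [le_principal_iff]; exact hgood.mono fun z hz => (hq z hz).1)
  have hlim' : Tendsto q 𝒰 (𝓝 q0) := hlim
  have hΓ : (q0, x) ∈ Γ := hB.isClosed.mem_of_tendsto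
    (hlim'.prodMk_nhds (tendsto_id.mono_left (hle.trans inf_le_left)))
    (hgood.mono fun z hz => (hq z hz).2.1)
  have hR := (hB.rel _ _ hΓ).resolve_left (fun e => hq0.2 (e ▸ hxO))
  have hP := h.past_mem _ _ hR (Or.inr hxS)
  obtain ⟨y, hy1, hy2⟩ := ((hlim'.eventually (h.isOpen_past.mem_nhds hP)).and hgood).exists
  exact (hq y hy2).2.2 hy1

end CausalSplitting

end Order

/-! ### Cone fields on open sets of a normed space -/

section ConeFields

variable {E : Type*} [NormedAddCommGroup E] [NormedSpace ℝ E]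

/-- An open convex salient cone at each point of the open set `T`, such that the cones form an open
set and their closures form a closed set. -/
structure ConeField (T : Set E) (K : E → Set E) : Prop where
  isOpen_base : IsOpen T
  nonempty : ∀ u ∈ T, (K u).Nonempty
  smul_mem : ∀ u ∈ T, ∀ w ∈ K u, ∀ t : ℝ, 0 < t → t • w ∈ K u
  convex : ∀ u ∈ T, Convex ℝ (K u)
  salient : ∀ u ∈ T, ∀ p v : E, (∀ t : ℝ, p + t • v ∈ K u) → v = 0
  eventually_mem : ∀ u ∈ T, ∀ w ∈ K u, ∀ᶠ q : E × E in 𝓝 (u, w), q.2 ∈ K q.1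
  eventually_notMem : ∀ u ∈ T, ∀ w ∉ closure (K u), ∀ᶠ q : E × E in 𝓝 (u, w), q.2 ∉ closure (K q.1)

namespace ConeField

variable {T : Set E} {K : E → Set E} (h : ConeField T K) {u : E}
include h

theorem isOpen_cone (hu : u ∈ T) : IsOpen (K u) := by
  rw [isOpen_iff_mem_nhds]
  intro w hw
  exact ((Continuous.prodMk_right u).tendsto w).eventually (h.eventually_mem u hu w hw)

theorem smul_mem_closure (hu : u ∈ T) {w : E} (hw : w ∈ closure (K u)) {t : ℝ} (ht : 0 ≤ t) :
    t • w ∈ closure (K u) := by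
  rcases ht.eq_or_lt with rfl | ht
  · obtain ⟨v, hv⟩ := h.nonempty u hu
    rw [zero_smul]
    have : Tendsto (fun t : ℝ => t • v) (𝓝[>] 0) (𝓝 ((0 : ℝ) • v)) :=
      ((continuous_id.smul continuous_const).tendsto 0).mono_left nhdsWithin_le_nhds
    rw [zero_smul] at this
    exact mem_closure_of_tendsto this (by
      filter_upwards [self_mem_nhdsWithin] with t ht using h.smul_mem u hu v hv t ht)
  · exact map_mem_closure (continuous_const_smul t) hw fun v hv => h.smul_mem u hu v hv t ht

theorem zero_mem_closure (hu : u ∈ T) : (0 : E) ∈ closure (K u) := by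
  obtain ⟨v, hv⟩ := h.nonempty u hu
  simpa using h.smul_mem_closure hu (subset_closure hv) le_rfl

theorem add_mem (hu : u ∈ T) {w v : E} (hw : w ∈ K u) (hv : v ∈ closure (K u)) : w + v ∈ K u := by
  have hint := (h.isOpen_cone hu).interior_eq
  have := (h.convex u hu).combo_interior_closure_mem_interior (x := w) (y := v) (by rwa [hint]) hv
    (a := 1 / 2) (b := 1 / 2) (by norm_num) (by norm_num) (by norm_num)
  rw [hint] at this
  have h2 := h.smul_mem u hu _ this 2 (by norm_num)
  rwa [smul_add, smul_smul, smul_smul, show (2 : ℝ) * (1 / 2) = 1 by norm_num, one_smul,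
    one_smul] at h2

theorem eq_zero_of_neg_mem (hu : u ∈ T) {v : E} (hv : v ∈ closure (K u))
    (hv' : -v ∈ closure (K u)) : v = 0 := by
  obtain ⟨p, hp⟩ := h.nonempty u hu
  refine h.salient u hu p v fun t => h.add_mem hu hp ?_
  rcases le_total 0 t with ht | ht
  · exact h.smul_mem_closure hu hv ht
  · simpa using h.smul_mem_closure hu hv' (neg_nonneg.2 ht)

/-- A separating functional is bounded below on the cone. A negative value could be scaled until it
violates the bound, so there is none. -/
theorem exists_separating (hu : u ∈ T) {x : E} (hx : x ∉ closure (K u)) :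
    ∃ f : E →L[ℝ] ℝ, f x < 0 ∧ ∀ w ∈ closure (K u), 0 ≤ f w := by
  obtain ⟨f, a, hfx, hf⟩ := geometric_hahn_banach_point_closed (h.convex u hu).closure
    isClosed_closure hx
  have ha : a < 0 := by simpa using hf 0 (h.zero_mem_closure hu)
  refine ⟨f, hfx.trans ha, fun w hw => ?_⟩
  by_contra! hneg
  have h1 := hf _ (h.smul_mem_closure hu hw (t := a / f w) (div_nonneg_of_nonpos ha.le hneg.le))
  rw [map_smul, smul_eq_mul, div_mul_cancel₀ _ hneg.ne] at h1
  exact lt_irrefl _ h1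

variable [FiniteDimensional ℝ E]

/-- By salience `-a` is not in the closed cone for a unit vector `a` of it, which yields a
functional that is non-negative on the cone and positive near `a`. By compactness a finite sum of
these is positive at all unit vectors of the cone. -/
theorem exists_pos (hu : u ∈ T) : ∃ l : E →L[ℝ] ℝ, ∀ w ∈ closure (K u), w ≠ 0 → 0 < l w := by
  have := FiniteDimensional.proper_real E
  have hA : IsCompact (closure (K u) ∩ Metric.sphere (0 : E) 1) :=
    (isCompact_sphere _ _).inter_left isClosed_closure
  obtain ⟨l, hl0, hl⟩ : ∃ l : E →L[ℝ] ℝ, (∀ w ∈ closure (K u), 0 ≤ l w) ∧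
      ∀ w ∈ closure (K u) ∩ Metric.sphere (0 : E) 1, 0 < l w := by
    refine hA.induction_on (p := fun A => ∃ l : E →L[ℝ] ℝ, (∀ w ∈ closure (K u), 0 ≤ l w) ∧
      ∀ w ∈ closure (K u) ∩ A, 0 < l w) ⟨0, by simp, by simp⟩ ?_ ?_ ?_ |>.imp fun l hl => ⟨hl.1, ?_⟩
    · rintro s t hst ⟨l, h1, h2⟩
      exact ⟨l, h1, fun w hw => h2 w ⟨hw.1, hst hw.2⟩⟩
    · rintro s t ⟨l, h1, h2⟩ ⟨l', h1', h2'⟩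
      refine ⟨l + l', fun w hw => add_nonneg (h1 w hw) (h1' w hw), ?_⟩
      rintro w ⟨hw, hws | hwt⟩
      · exact add_pos_of_pos_of_nonneg (h2 w ⟨hw, hws⟩) (h1' w hw)
      · exact add_pos_of_nonneg_of_pos (h1 w hw) (h2' w ⟨hw, hwt⟩)
    · rintro a ⟨ha, ha1⟩
      have hna : -a ∉ closure (K u) := fun hna => by
        have := h.eq_zero_of_neg_mem hu ha hna
        simp [this] at ha1
      obtain ⟨f, hf1, hf2⟩ := h.exists_separating hu hna
      refine ⟨{w | 0 < f w}, mem_nhdsWithin_of_mem_nhds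
        ((isOpen_lt continuous_const f.continuous).mem_nhds (by simpa using hf1)), f, hf2,
        fun w hw => hw.2⟩
    · exact fun w hw => hl.2 w ⟨hw.1, hw⟩
  refine ⟨l, fun w hw hw0 => ?_⟩
  have hn : 0 < ‖w‖ := norm_pos_iff.2 hw0
  have := hl (‖w‖⁻¹ • w) ⟨h.smul_mem_closure hu hw (by positivity), by
    simp [norm_smul, hn.ne']⟩
  rw [map_smul, smul_eq_mul] at this
  exact pos_of_mul_pos_right this (by positivity)

/-- Duality with strictly positive functionals only: a separating functional becomes strictly
positive on the cone after adding a small multiple of one from `exists_pos`, and is still negative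
at `w`. -/
theorem mem_closure_of_forall (hu : u ∈ T) {w : E}
    (hw : ∀ l : E →L[ℝ] ℝ, (∀ v ∈ closure (K u), v ≠ 0 → 0 < l v) → 0 ≤ l w) :
    w ∈ closure (K u) := by
  by_contra hwn
  obtain ⟨f, hf1, hf2⟩ := h.exists_separating hu hwn
  obtain ⟨l, hl⟩ := h.exists_pos hu
  obtain ⟨ε, hε, hε'⟩ : ∃ ε : ℝ, 0 < ε ∧ f w + ε * l w < 0 := by
    have : Tendsto (fun ε : ℝ => f w + ε * l w) (𝓝[>] 0) (𝓝 (f w + 0 * l w)) :=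
      (Continuous.tendsto (by fun_prop) 0).mono_left nhdsWithin_le_nhds
    rw [zero_mul, add_zero] at this
    obtain ⟨ε, h1, h2⟩ := ((this.eventually_lt_const hf1).and self_mem_nhdsWithin).exists
    exact ⟨ε, h2, h1⟩
  have := hw (f + ε • l) fun v hv hv0 =>
    add_pos_of_nonneg_of_pos (hf2 v hv) (mul_pos hε (hl v hv hv0))
  exact absurd this (not_le.2 (by simpa using hε'))

/-- For small `c`, the unit vectors with `l w ≤ c` form a compact set that misses the closed cone at
`u`. As the closed cones form a closed set, it also misses the closed cones at all nearby points. -/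
theorem eventually_le (hu : u ∈ T) {l : E →L[ℝ] ℝ} (hl : ∀ w ∈ closure (K u), w ≠ 0 → 0 < l w) :
    ∃ c : ℝ, 0 < c ∧ ∀ᶠ u' in 𝓝 u, ∀ w ∈ closure (K u'), c * ‖w‖ ≤ l w := by
  have := FiniteDimensional.proper_real E
  obtain ⟨c, hc, hcl⟩ : ∃ c : ℝ, 0 < c ∧
      ∀ w ∈ closure (K u) ∩ Metric.sphere (0 : E) 1, c < l w := by
    have hA : IsCompact (closure (K u) ∩ Metric.sphere (0 : E) 1) :=
      (isCompact_sphere _ _).inter_left isClosed_closure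
    rcases eq_empty_or_nonempty (closure (K u) ∩ Metric.sphere (0 : E) 1) with he | hne
    · exact ⟨1, one_pos, by simp [he]⟩
    · obtain ⟨w0, hw0, hmin⟩ := hA.exists_isMinOn hne l.continuous.continuousOn
      have h0 : 0 < l w0 := hl w0 hw0.1 (by rintro rfl; simpa using hw0.2)
      exact ⟨l w0 / 2, by positivity, fun w hw => (half_lt_self h0).trans_le (hmin hw)⟩
  refine ⟨c, hc, ?_⟩
  have hZ : IsCompact (Metric.sphere (0 : E) 1 ∩ {w | l w ≤ c}) :=
    (isCompact_sphere _ _).inter_right (isClosed_le l.continuous continuous_const)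
  have key := hZ.eventually_forall_of_forall_eventually (x₀ := u)
    (P := fun u' w => w ∉ closure (K u')) fun w hw => h.eventually_notMem u hu w
      fun hwK => (hcl w ⟨hwK, hw.1⟩).not_ge hw.2
  filter_upwards [key, h.isOpen_base.mem_nhds hu] with u' hu' hT w hw
  rcases eq_or_ne w 0 with rfl | hw0
  · simp
  have hn : 0 < ‖w‖ := norm_pos_iff.2 hw0
  by_contra! hlt
  refine hu' (‖w‖⁻¹ • w) ⟨by simp [norm_smul, hn.ne'], ?_⟩
    (h.smul_mem_closure hT hw (by positivity))
  simp only [mem_ofPred_eq, map_smul, smul_eq_mul]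
  rw [inv_mul_le_iff₀ hn, mul_comm]
  exact hlt.le

end ConeField

/-- A Lipschitz curve whose velocities are almost everywhere non-zero vectors in the closed cones. -/
structure IsConeCurve (K : E → Set E) (σ : ℝ → E) (a b : ℝ) : Prop where
  lipschitz : ∃ L, LipschitzOnWith L σ (Icc a b)
  deriv : ∀ᵐ t ∂(volume.restrict (Icc a b)), ∃ w, HasDerivAt σ w t ∧ w ∈ closure (K (σ t)) ∧ w ≠ 0

namespace IsConeCurve

variable {K : E → Set E} {σ : ℝ → E} {a b : ℝ}

theorem mono (h : IsConeCurve K σ a b) {a' b' : ℝ} (ha : a ≤ a') (hb : b' ≤ b) :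
    IsConeCurve K σ a' b' where
  lipschitz := h.lipschitz.imp fun _ hL => hL.mono (Icc_subset_Icc ha hb)
  deriv := ae_mono (Measure.restrict_mono (Icc_subset_Icc ha hb) le_rfl) h.deriv

/-- `l ∘ σ` is absolutely continuous, so a sign of its derivative almost everywhere suffices. -/
theorem le (h : IsConeCurve K σ a b) (hab : a ≤ b) {l : E →L[ℝ] ℝ}
    (hl : ∀ t ∈ Icc a b, ∀ w ∈ closure (K (σ t)), 0 ≤ l w) : l (σ a) ≤ l (σ b) := by
  obtain ⟨L, hL⟩ := h.lipschitz
  have hac : AbsolutelyContinuousOnInterval (fun t => l (σ t)) a b :=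
    LipschitzOnWith.absolutelyContinuousOnInterval (K := ‖l‖₊ * L) (by
      rw [uIcc_of_le hab]
      exact (l.lipschitz.lipschitzOnWith (s := univ)).comp hL (mapsTo_univ _ _))
  rw [← sub_nonneg, ← hac.integral_deriv_eq_sub]
  refine intervalIntegral.integral_nonneg_of_ae_restrict hab ?_
  filter_upwards [h.deriv, ae_restrict_mem measurableSet_Icc] with t ⟨w, hw, hwK, _⟩ ht
  have hd : HasDerivAt (fun t => l (σ t)) (l w) t := l.hasFDerivAt.comp_hasDerivAt t hw
  rw [hd.deriv]
  exact hl t ht w hwK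

/-- This is `le` for `l - c • f`, where `f` has norm at most one and attains the norm of `σ b - σ
a`. -/
theorem norm_le (h : IsConeCurve K σ a b) (hab : a ≤ b) {l : E →L[ℝ] ℝ} {c : ℝ} (hc : 0 < c)
    (hl : ∀ t ∈ Icc a b, ∀ w ∈ closure (K (σ t)), c * ‖w‖ ≤ l w) :
    c * ‖σ b - σ a‖ ≤ l (σ b) - l (σ a) := by
  obtain ⟨f, hf1, hf2⟩ := exists_dual_vector'' ℝ (σ b - σ a)
  have := h.le hab (l := l - c • f) fun t ht w hw => by
    have h1 := hl t ht w hw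
    have h2 : f w ≤ ‖w‖ := (le_abs_self _).trans ((f.le_opNorm w).trans
      (mul_le_of_le_one_left (norm_nonneg _) hf1))
    have := mul_le_mul_of_nonneg_left h2 hc.le
    simpa using this.trans h1
  have h3 : f (σ b) - f (σ a) = ‖σ b - σ a‖ := by rw [← map_sub]; simpa using hf2
  simp only [sub_apply, smul_apply, smul_eq_mul] at this
  rw [← h3]; linarith

/-- If `l` did not increase, `norm_le` would make the curve constant, against the non-zero velocity.
-/
theorem lt (h : IsConeCurve K σ a b) (hab : a < b) {l : E →L[ℝ] ℝ} {c : ℝ} (hc : 0 < c)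
    (hl : ∀ t ∈ Icc a b, ∀ w ∈ closure (K (σ t)), c * ‖w‖ ≤ l w) : l (σ a) < l (σ b) := by
  have hle : ∀ s ∈ Icc a b, ∀ t ∈ Icc a b, s ≤ t → c * ‖σ t - σ s‖ ≤ l (σ t) - l (σ s) :=
    fun s hs t ht hst => (h.mono hs.1 ht.2).norm_le hst hc fun r hr =>
      hl r ⟨hs.1.trans hr.1, hr.2.trans ht.2⟩
  by_contra! hcon
  have hconst : ∀ s ∈ Icc a b, σ s = σ a := fun s hs => by
    have h1 := hle a (left_mem_Icc.2 hab.le) s hs hs.1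
    have h2 := hle s hs b (right_mem_Icc.2 hab.le) hs.2
    have h3 : 0 ≤ c * ‖σ b - σ s‖ := by positivity
    have h4 : ‖σ s - σ a‖ ≤ 0 := by
      by_contra! h5
      have := mul_pos hc h5
      linarith
    exact sub_eq_zero.1 (norm_le_zero_iff.1 h4)
  have hd := ae_mono (Measure.restrict_mono Ioo_subset_Icc_self le_rfl) h.deriv
  have hne : (ae (volume.restrict (Ioo a b))).NeBot := by
    rw [ae_neBot, Ne, Measure.restrict_eq_zero]; simp [hab]
  obtain ⟨t, ⟨w, hw, -, hw0⟩, ht⟩ := ((show ∀ᵐ t ∂(volume.restrict (Ioo a b)), _ from hd).and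
    (ae_restrict_mem measurableSet_Ioo)).exists
  refine hw0 (hw.unique ((hasDerivAt_const t (σ a)).congr_of_eventuallyEq ?_))
  filter_upwards [Ioo_mem_nhds ht.1 ht.2] with s hs using hconst s (Ioo_subset_Icc_self hs)

end IsConeCurve

/-- A curve in `B` from `x` to `y` on which the linear functional `l` is affine, and which is
monotone for all linear functionals that are non-negative on the cones. -/
structure IsNormalCurve (K : E → Set E) (B : Set E) (c : ℝ) (l : E →L[ℝ] ℝ) (x y : E)
    (σ : ℝ → E) : Prop where
  zero : σ 0 = x
  one : σ 1 = y
  mapsTo : ∀ t ∈ Icc (0 : ℝ) 1, σ t ∈ B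
  apply_eq : ∀ t ∈ Icc (0 : ℝ) 1, l (σ t) = l x + t * (l y - l x)
  dist_le : ∀ s ∈ Icc (0 : ℝ) 1, ∀ t ∈ Icc (0 : ℝ) 1, s ≤ t →
    c * dist (σ t) (σ s) ≤ (t - s) * (l y - l x)
  mono : ∀ (u : E) (δ : ℝ) (k : E →L[ℝ] ℝ), (∀ u' ∈ Metric.ball u δ, ∀ w ∈ closure (K u'), 0 ≤ k w) →
    ∀ s ∈ Icc (0 : ℝ) 1, ∀ t ∈ Icc (0 : ℝ) 1, s ≤ t →
      dist (σ s) u + c⁻¹ * ((t - s) * (l y - l x)) < δ → k (σ s) ≤ k (σ t)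

/-- The relation of being equal or joined by a cone curve in `B`. -/
def coneRel (K : E → Set E) (B : Set E) : Set (E × E) :=
  {p | p.1 ∈ B ∧ p.2 ∈ B ∧ (p.1 = p.2 ∨
    ∃ σ, IsConeCurve K σ 0 1 ∧ MapsTo σ (Icc 0 1) B ∧ σ 0 = p.1 ∧ σ 1 = p.2)}

/-- On the set `B` the linear functional `l` is uniformly positive on the closed cones. -/
def IsTimeFunctional (K : E → Set E) (B : Set E) (c : ℝ) (l : E →L[ℝ] ℝ) : Prop :=
  0 < c ∧ ∀ u ∈ B, ∀ w ∈ closure (K u), c * ‖w‖ ≤ l w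

variable {T : Set E} {K : E → Set E} {B : Set E} {c : ℝ} {l : E →L[ℝ] ℝ}

/-- The values of `l` strictly increase along the curve and serve as parameter, up to an affine
change. This turns the differential condition into inequalities between values at fixed parameters,
with constants that depend only on the end points, so that they survive pointwise limits. -/
theorem IsTimeFunctional.exists_isNormalCurve (hl : IsTimeFunctional K B c l) {x y : E}
    (hxy : (x, y) ∈ coneRel K B) : ∃ σ, IsNormalCurve K B c l x y σ := by
  obtain ⟨hc, hl⟩ := hl
  obtain ⟨hx, hy, he | ⟨σ, hσ, hm, h0, h1⟩⟩ := hxy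
  · simp only at hx hy he
    subst he
    exact ⟨fun _ => x, rfl, rfl, fun _ _ => hx, by simp, by simp, by simp⟩
  simp only at hx hy h0 h1
  have hle : ∀ s ∈ Icc (0 : ℝ) 1, ∀ t ∈ Icc (0 : ℝ) 1, s ≤ t →
      c * ‖σ t - σ s‖ ≤ l (σ t) - l (σ s) :=
    fun s hs t ht hst => (hσ.mono hs.1 ht.2).norm_le hst hc fun r hr =>
      hl _ (hm ⟨hs.1.trans hr.1, hr.2.trans ht.2⟩)
  have hlt : ∀ s ∈ Icc (0 : ℝ) 1, ∀ t ∈ Icc (0 : ℝ) 1, s < t → l (σ s) < l (σ t) :=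
    fun s hs t ht hst => (hσ.mono hs.1 ht.2).lt hst hc fun r hr =>
      hl _ (hm ⟨hs.1.trans hr.1, hr.2.trans ht.2⟩)
  have h01 : (0 : ℝ) ∈ Icc (0 : ℝ) 1 := by simp
  have h11 : (1 : ℝ) ∈ Icc (0 : ℝ) 1 := by simp
  have hxy : l x < l y := by rw [← h0, ← h1]; exact hlt 0 h01 1 h11 one_pos
  have hcont : ContinuousOn (fun t => l (σ t)) (Icc 0 1) := by
    obtain ⟨L, hL⟩ := hσ.lipschitz
    exact l.continuous.comp_continuousOn hL.continuousOn
  have hex : ∀ r : ℝ, ∃ t, r ∈ Icc (0 : ℝ) 1 → t ∈ Icc (0 : ℝ) 1 ∧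
      l (σ t) = l x + r * (l y - l x) := by
    intro r
    by_cases hr : r ∈ Icc (0 : ℝ) 1
    · obtain ⟨t, ht, hrt⟩ := intermediate_value_Icc zero_le_one hcont
        (show l x + r * (l y - l x) ∈ Icc (l (σ 0)) (l (σ 1)) by
          rw [h0, h1]; constructor <;> nlinarith [hr.1, hr.2])
      exact ⟨t, fun _ => ⟨ht, hrt⟩⟩
    · exact ⟨0, fun h => absurd h hr⟩
  choose τ hτ using hex
  have hτm : ∀ s ∈ Icc (0 : ℝ) 1, ∀ t ∈ Icc (0 : ℝ) 1, s ≤ t → τ s ≤ τ t := by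
    intro s hs t ht hst
    by_contra! hcon
    have := hlt _ (hτ t ht).1 _ (hτ s hs).1 hcon
    rw [(hτ t ht).2, (hτ s hs).2] at this
    nlinarith
  have hinj : ∀ s ∈ Icc (0 : ℝ) 1, ∀ t ∈ Icc (0 : ℝ) 1, l (σ s) = l (σ t) → s = t := by
    intro s hs t ht hst
    rcases lt_trichotomy s t with h | h | h
    · exact absurd hst (hlt s hs t ht h).ne
    · exact h
    · exact absurd hst (hlt t ht s hs h).ne'
  refine ⟨fun r => σ (τ r), ?_, ?_, fun t ht => hm (hτ t ht).1, fun t ht => (hτ t ht).2, ?_, ?_⟩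
  · rw [← h0, hinj _ (hτ 0 h01).1 0 h01]
    rw [(hτ 0 h01).2, h0]; ring
  · rw [← h1, hinj _ (hτ 1 h11).1 1 h11]
    rw [(hτ 1 h11).2, h1]; ring
  · intro s hs t ht hst
    have := hle _ (hτ s hs).1 _ (hτ t ht).1 (hτm s hs t ht hst)
    rw [(hτ t ht).2, (hτ s hs).2] at this
    rw [dist_eq_norm]; linarith
  -- The bound by `δ` keeps the whole arc between the two parameters in the ball over which `k` is
  -- non-negative on the cones.
  · intro u δ k hk s hs t ht hst hd
    refine (hσ.mono (hτ s hs).1.1 (hτ t ht).1.2).le (hτm s hs t ht hst) fun r hr => hk _ ?_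
    have hr01 : r ∈ Icc (0 : ℝ) 1 := ⟨(hτ s hs).1.1.trans hr.1, hr.2.trans (hτ t ht).1.2⟩
    have e1 := hle _ (hτ s hs).1 r hr01 hr.1
    have e2 := hle r hr01 _ (hτ t ht).1 hr.2
    have e3 : 0 ≤ c * ‖σ (τ t) - σ r‖ := by positivity
    have e4 : c * ‖σ r - σ (τ s)‖ ≤ (t - s) * (l y - l x) := by
      rw [(hτ t ht).2] at e2
      rw [(hτ s hs).2] at e1
      linarith
    have e5 : ‖σ r - σ (τ s)‖ ≤ c⁻¹ * ((t - s) * (l y - l x)) := by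
      rwa [le_inv_mul_iff₀ hc]
    rw [Metric.mem_ball]
    calc dist (σ r) u ≤ dist (σ r) (σ (τ s)) + dist (σ (τ s)) u := dist_triangle _ _ _
      _ < δ := by rw [dist_eq_norm (σ r)]; linarith

variable [FiniteDimensional ℝ E]

/-- A normal curve is Lipschitz, hence differentiable almost everywhere. A functional strictly
positive on the cone at `σ t` is non-negative on all cones nearby, so `mono` makes its slopes to the
right of `t` non-negative; by duality the derivative lies in the closed cone. It is not zero because
`l ∘ σ` has the constant slope `l y - l x > 0`. -/
theorem IsNormalCurve.mem_coneRel (h : ConeField T K) (hBT : B ⊆ T)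
    (hl : IsTimeFunctional K B c l) {x y : E} {σ : ℝ → E} (hσ : IsNormalCurve K B c l x y σ) :
    (x, y) ∈ coneRel K B := by
  obtain ⟨hc, -⟩ := hl
  have h01 : (0 : ℝ) ∈ Icc (0 : ℝ) 1 := by simp
  have h11 : (1 : ℝ) ∈ Icc (0 : ℝ) 1 := by simp
  refine ⟨by simpa [hσ.zero] using hσ.mapsTo 0 h01, by simpa [hσ.one] using hσ.mapsTo 1 h11, ?_⟩
  by_cases hxy : x = y
  · exact Or.inl hxy
  right
  have hΔ : 0 < l y - l x := by
    have h1 := hσ.dist_le 0 h01 1 h11 zero_le_one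
    rw [hσ.zero, hσ.one] at h1
    have : 0 < c * dist y x := mul_pos hc (dist_pos.2 (Ne.symm hxy))
    linarith
  have hLip : LipschitzOnWith (Real.toNNReal (c⁻¹ * (l y - l x))) σ (Icc 0 1) := by
    refine LipschitzOnWith.of_dist_le_mul fun s hs t ht => ?_
    rw [Real.coe_toNNReal _ (by positivity)]
    wlog hst : s ≤ t generalizing s t
    · rw [dist_comm (σ s), dist_comm s]; exact this t ht s hs (le_of_not_ge hst)
    have := hσ.dist_le s hs t ht hst
    rw [dist_comm (σ s), dist_comm s, Real.dist_eq, abs_of_nonneg (sub_nonneg.2 hst), mul_assoc,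
      le_inv_mul_iff₀ hc]
    linarith
  refine ⟨σ, ⟨⟨_, hLip⟩, ?_⟩, fun t ht => hσ.mapsTo t ht, hσ.zero, hσ.one⟩
  rw [← Measure.restrict_congr_set (Ioo_ae_eq_Icc (μ := volume) (a := (0 : ℝ)) (b := 1)),
    ae_restrict_iff' measurableSet_Ioo]
  filter_upwards [hLip.ae_differentiableWithinAt_of_mem_real] with t ht ht01
  have ht' := Ioo_subset_Icc_self ht01
  have hdiff : DifferentiableAt ℝ σ t := (ht ht').differentiableAt (Icc_mem_nhds ht01.1 ht01.2)
  refine ⟨_, hdiff.hasDerivAt, h.mem_closure_of_forall (hBT (hσ.mapsTo t ht')) fun k hk => ?_, ?_⟩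
  · obtain ⟨c', hc', hev⟩ := h.eventually_le (hBT (hσ.mapsTo t ht')) hk
    obtain ⟨δ, hδ, hball⟩ := Metric.eventually_nhds_iff_ball.1 hev
    have hder : HasDerivAt (fun t => k (σ t)) (k (deriv σ t)) t :=
      k.hasFDerivAt.comp_hasDerivAt t hdiff.hasDerivAt
    have hsl := (hasDerivAt_iff_tendsto_slope.1 hder).mono_left
      (nhdsWithin_mono t (fun s (hs : t < s) => hs.ne') : 𝓝[>] t ≤ _)
    have hsmall : ∀ᶠ s in 𝓝[>] t, c⁻¹ * ((s - t) * (l y - l x)) < δ := by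
      have : Tendsto (fun s => c⁻¹ * ((s - t) * (l y - l x))) (𝓝[>] t)
          (𝓝 (c⁻¹ * ((t - t) * (l y - l x)))) :=
        (Continuous.tendsto (by fun_prop) t).mono_left nhdsWithin_le_nhds
      exact this.eventually_lt_const (by simpa using hδ)
    refine ge_of_tendsto hsl ?_
    filter_upwards [hsmall, self_mem_nhdsWithin, Ioo_mem_nhdsGT ht01.2] with s hs1 hs2 hs3
    have hs2' : t < s := hs2
    have := hσ.mono (σ t) δ k (fun u' hu' w hw =>
      le_trans (by positivity) (hball u' hu' w hw)) t ht' s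
      ⟨ht'.1.trans hs2'.le, hs3.2.le⟩ hs2'.le (by simpa using hs1)
    rw [slope_def_field]
    exact div_nonneg (sub_nonneg.2 this) (sub_nonneg.2 hs2'.le)
  · intro h0
    have h1 : HasDerivAt (fun t => l (σ t)) (l (deriv σ t)) t :=
      l.hasFDerivAt.comp_hasDerivAt t hdiff.hasDerivAt
    have h2 : HasDerivAt (fun t => l x + t * (l y - l x)) (1 * (l y - l x)) t :=
      ((hasDerivAt_id t).mul_const _).const_add _
    have h3 := h1.unique (h2.congr_of_eventuallyEq (by
      filter_upwards [Icc_mem_nhds ht01.1 ht01.2] with s hs using hσ.apply_eq s hs))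
    rw [h0, map_zero] at h3
    linarith

/-- The causal relation in a small compact set is closed. -/
theorem isClosed_coneRel (h : ConeField T K) (hB : IsCompact B) (hBT : B ⊆ T)
    (hl : IsTimeFunctional K B c l) : IsClosed (coneRel K B) := by
  rw [isClosed_iff_ultrafilter]
  rintro ⟨x, y⟩ 𝒰 h𝒰 hmem
  have hex : ∀ z : E × E, ∃ σ, z ∈ coneRel K B → IsNormalCurve K B c l z.1 z.2 σ := by
    intro z
    by_cases hz : z ∈ coneRel K B
    · obtain ⟨σ, hσ⟩ := hl.exists_isNormalCurve hz
      exact ⟨σ, fun _ => hσ⟩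
    · exact ⟨fun _ => 0, fun h => absurd h hz⟩
  choose σ hσ using hex
  have hσ' : ∀ᶠ z in (𝒰 : Filter (E × E)), IsNormalCurve K B c l z.1 z.2 (σ z) := by
    filter_upwards [hmem] with z hz using hσ z hz
  have h1 : Tendsto Prod.fst (𝒰 : Filter (E × E)) (𝓝 x) := (continuous_fst.tendsto (x, y)).mono_left h𝒰
  have h2 : Tendsto Prod.snd (𝒰 : Filter (E × E)) (𝓝 y) := (continuous_snd.tendsto (x, y)).mono_left h𝒰
  have hΔ : Tendsto (fun z : E × E => l z.2 - l z.1) 𝒰 (𝓝 (l y - l x)) :=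
    ((l.continuous.tendsto y).comp h2).sub ((l.continuous.tendsto x).comp h1)
  -- Pointwise limits along the ultrafilter suffice: the conditions on a normal curve are closed, or
  -- closed under an open premise, so no uniform convergence is needed.
  have hlim : ∀ t : ℝ, ∃ p, t ∈ Icc (0 : ℝ) 1 → p ∈ B ∧ Tendsto (fun z => σ z t) 𝒰 (𝓝 p) := by
    intro t
    by_cases ht : t ∈ Icc (0 : ℝ) 1
    · obtain ⟨p, hp, hlim⟩ := hB.ultrafilter_le_nhds (𝒰.map fun z => σ z t) (by
        rw [le_principal_iff]
        exact hσ'.mono fun z hz => hz.mapsTo t ht)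
      exact ⟨p, fun _ => ⟨hp, hlim⟩⟩
    · exact ⟨0, fun h => absurd h ht⟩
  choose ρ hρ using hlim
  have h01 : (0 : ℝ) ∈ Icc (0 : ℝ) 1 := by simp
  have h11 : (1 : ℝ) ∈ Icc (0 : ℝ) 1 := by simp
  have hnormal : IsNormalCurve K B c l x y ρ := by
    refine ⟨?_, ?_, fun t ht => (hρ t ht).1, fun t ht => ?_, fun s hs t ht hst => ?_,
      fun u δ k hk s hs t ht hst hd => ?_⟩
    · exact tendsto_nhds_unique ((hρ 0 h01).2.congr' (hσ'.mono fun z hz => hz.zero)) h1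
    · exact tendsto_nhds_unique ((hρ 1 h11).2.congr' (hσ'.mono fun z hz => hz.one)) h2
    · refine tendsto_nhds_unique ((l.continuous.tendsto _).comp (hρ t ht).2)
        ((((l.continuous.tendsto x).comp h1).add (hΔ.const_mul t)).congr' ?_)
      exact hσ'.mono fun z hz => (hz.apply_eq t ht).symm
    · exact le_of_tendsto_of_tendsto (((hρ t ht).2.dist (hρ s hs).2).const_mul c)
        (hΔ.const_mul (t - s)) (hσ'.mono fun z hz => hz.dist_le s hs t ht hst)
    · have hlt := (((hρ s hs).2.dist (tendsto_const_nhds (x := u))).add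
        ((hΔ.const_mul (t - s)).const_mul c⁻¹)).eventually_lt_const hd
      refine le_of_tendsto_of_tendsto ((k.continuous.tendsto _).comp (hρ s hs).2)
        ((k.continuous.tendsto _).comp (hρ t ht).2) ?_
      filter_upwards [hσ', hlt] with z hz hz' using hz.mono u δ k hk s hs t ht hst hz'
  exact hnormal.mem_coneRel h hBT hl

/-- Near each point of a cone field there are an open set of vectors in all cones and a linear
functional that is positive on all cones. -/
theorem ConeField.exists_ball (h : ConeField T K) {u : E} (hu : u ∈ T) :
    ∃ (v : E) (ε c : ℝ) (l : E →L[ℝ] ℝ) (δ : ℝ), 0 < ε ∧ 0 < δ ∧ Metric.closedBall u δ ⊆ T ∧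
      (∀ u' ∈ Metric.closedBall u δ, ∀ w ∈ Metric.ball v ε, w ∈ K u') ∧
      IsTimeFunctional K (Metric.closedBall u δ) c l := by
  obtain ⟨v, hv⟩ := h.nonempty u hu
  obtain ⟨l, hl⟩ := h.exists_pos hu
  obtain ⟨c, hc, hev⟩ := h.eventually_le hu hl
  have hv' := h.eventually_mem u hu v hv
  rw [nhds_prod_eq, (Metric.nhds_basis_closedBall.prod Metric.nhds_basis_ball).eventually_iff] at hv'
  obtain ⟨⟨δ', ε⟩, ⟨hδ', hε⟩, hball'⟩ := hv'
  obtain ⟨δ, hδ, hball⟩ := Metric.nhds_basis_closedBall.eventually_iff.1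
    (hev.and (h.isOpen_base.mem_nhds hu))
  refine ⟨v, ε, c, l, min δ δ', hε, lt_min hδ hδ', fun u' hu' => (hball ?_).2,
    fun u' hu' w hw => hball' (x := (u', w)) ⟨?_, hw⟩, hc, fun u' hu' => (hball ?_).1⟩
  · exact Metric.closedBall_subset_closedBall (min_le_left _ _) hu'
  · exact Metric.closedBall_subset_closedBall (min_le_right _ _) hu'
  · exact Metric.closedBall_subset_closedBall (min_le_left _ _) hu'

omit [FiniteDimensional ℝ E] in
-- An open cone that contains zero is the whole space, which contains lines.
theorem ConeField.zero_notMem [Nontrivial E] (h : ConeField T K) {u : E} (hu : u ∈ T) :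
    (0 : E) ∉ K u := by
  intro h0
  obtain ⟨v, hv⟩ := exists_ne (0 : E)
  refine hv (h.salient u hu 0 v fun t => ?_)
  have hev : ∀ᶠ s : ℝ in 𝓝[>] 0, s • (t • v) ∈ K u := by
    have : Tendsto (fun s : ℝ => s • (t • v)) (𝓝[>] 0) (𝓝 ((0 : ℝ) • (t • v))) :=
      (Continuous.tendsto (by fun_prop) 0).mono_left nhdsWithin_le_nhds
    rw [zero_smul] at this
    exact this.eventually ((h.isOpen_cone hu).mem_nhds h0)
  obtain ⟨s, hs, hs0⟩ := (hev.and self_mem_nhdsWithin).exists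
  have hs0' : (0 : ℝ) < s := hs0
  have := h.smul_mem u hu _ hs s⁻¹ (inv_pos.2 hs0')
  rwa [smul_smul, inv_mul_cancel₀ hs0'.ne', one_smul, ← zero_add (t • v)] at this

omit [FiniteDimensional ℝ E] in
theorem isConeCurve_lineMap [Nontrivial E] (h : ConeField T K) (hBT : B ⊆ T) (hB : Convex ℝ B)
    {x y : E} (hx : x ∈ B) (hy : y ∈ B) (hK : ∀ u ∈ B, y - x ∈ K u) :
    IsConeCurve K (AffineMap.lineMap x y : ℝ → E) 0 1 ∧
      MapsTo (AffineMap.lineMap x y : ℝ → E) (Icc 0 1) B := by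
  have hm : MapsTo (AffineMap.lineMap x y : ℝ → E) (Icc 0 1) B := fun t ht =>
    hB.segment_subset hx hy (by rw [segment_eq_image_lineMap]; exact mem_image_of_mem _ ht)
  refine ⟨⟨⟨_, (lipschitzWith_lineMap x y).lipschitzOnWith⟩, ?_⟩, hm⟩
  filter_upwards [ae_restrict_mem measurableSet_Icc] with t ht
  refine ⟨y - x, AffineMap.hasDerivAt_lineMap, subset_closure (hK _ (hm ht)), fun h0 => ?_⟩
  exact h.zero_notMem (hBT hx) (h0 ▸ hK x hx)

end ConeFields

/-! ### Smooth charts -/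

section Charts

/-- The model space of `n`-manifolds. -/
abbrev Eu (n : ℕ) : Type := EuclideanSpace ℝ (Fin n)

variable {n : ℕ} {N : Type*} [TopologicalSpace N] [ChartedSpace (Eu n) N]

/-- A chart in the maximal smooth atlas. -/
def IsSmoothChart (e : OpenPartialHomeomorph N (Eu n)) : Prop :=
  e ∈ IsManifold.maximalAtlas (𝓡 n) ∞ N

theorem isSmoothChart_chartAt [IsManifold (𝓡 n) ∞ N] (x : N) :
    IsSmoothChart (chartAt (Eu n) x) :=
  IsManifold.chart_mem_maximalAtlas x

namespace IsSmoothChart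

variable {e e' : OpenPartialHomeomorph N (Eu n)}

theorem contMDiffOn (he : IsSmoothChart e) : ContMDiffOn (𝓡 n) (𝓡 n) ∞ e e.source :=
  contMDiffOn_of_mem_maximalAtlas he

theorem contMDiffOn_symm (he : IsSmoothChart e) : ContMDiffOn (𝓡 n) (𝓡 n) ∞ e.symm e.target :=
  contMDiffOn_symm_of_mem_maximalAtlas he

theorem mdifferentiable (he : IsSmoothChart e) : e.MDifferentiable (𝓡 n) (𝓡 n) :=
  ⟨he.contMDiffOn.mdifferentiableOn (by simp), he.contMDiffOn_symm.mdifferentiableOn (by simp)⟩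

end IsSmoothChart

/-- The derivative of a chart, with values in the model space. -/
def chartD (e : OpenPartialHomeomorph N (Eu n)) (x : N) : TangentSpace (𝓡 n) x →L[ℝ] Eu n :=
  mfderiv (𝓡 n) (𝓡 n) e x

/-- The derivative of the inverse of a chart, as a map from the model space. -/
def symmD (e : OpenPartialHomeomorph N (Eu n)) (u : Eu n) :
    Eu n →L[ℝ] TangentSpace (𝓡 n) (e.symm u) :=
  mfderiv (𝓡 n) (𝓡 n) e.symm u

namespace IsSmoothChart

variable {e e' : OpenPartialHomeomorph N (Eu n)}

theorem chartD_symmD (he : IsSmoothChart e) {u : Eu n} (hu : u ∈ e.target) (v : Eu n) :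
    chartD e (e.symm u) (symmD e u v) = v :=
  DFunLike.congr_fun (he.mdifferentiable.comp_symm_deriv hu) v

theorem symmD_chartD (he : IsSmoothChart e) {u : Eu n} (hu : u ∈ e.target)
    (v : TangentSpace (𝓡 n) (e.symm u)) : symmD e u (chartD e (e.symm u) v) = v := by
  have := he.mdifferentiable.symm_comp_deriv (e.map_target hu)
  rw [e.right_inv hu] at this
  exact DFunLike.congr_fun this v

/-- The derivative of the inverse of a chart as a linear equivalence. -/
def symmDeriv (he : IsSmoothChart e) {u : Eu n} (hu : u ∈ e.target) :
    Eu n ≃L[ℝ] TangentSpace (𝓡 n) (e.symm u) :=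
  ContinuousLinearEquiv.equivOfInverse (symmD e u) (chartD e (e.symm u)) (he.chartD_symmD hu)
    (he.symmD_chartD hu)

theorem symmD_eq_zero_iff (he : IsSmoothChart e) {u : Eu n} (hu : u ∈ e.target) {v : Eu n} :
    symmD e u v = 0 ↔ v = 0 :=
  (he.symmDeriv hu).map_eq_zero_iff

theorem contDiffOn_transition (he : IsSmoothChart e) (he' : IsSmoothChart e') :
    ContDiffOn ℝ ∞ (e' ∘ e.symm) (e.target ∩ e.symm ⁻¹' e'.source) := by
  rw [← contMDiffOn_iff_contDiffOn]
  exact he'.contMDiffOn.comp (he.contMDiffOn_symm.mono inter_subset_left) fun u hu => hu.2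

omit [ChartedSpace (Eu n) N] in
theorem isOpen_transition (e e' : OpenPartialHomeomorph N (Eu n)) :
    IsOpen (e.target ∩ e.symm ⁻¹' e'.source) :=
  e.symm.isOpen_inter_preimage e'.open_source

theorem contDiffAt_transition (he : IsSmoothChart e) (he' : IsSmoothChart e') {u : Eu n}
    (hu : u ∈ e.target) (hu' : e.symm u ∈ e'.source) : ContDiffAt ℝ ∞ (e' ∘ e.symm) u :=
  (he.contDiffOn_transition he').contDiffAt ((isOpen_transition e e').mem_nhds ⟨hu, hu'⟩)

/-- The derivatives of the inverses of two charts differ by the derivative of the transition map. -/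
theorem symmD_transition (he : IsSmoothChart e) (he' : IsSmoothChart e') {u : Eu n}
    (hu : u ∈ e.target) (hu' : e.symm u ∈ e'.source) (v : Eu n) :
    (symmD e' ((e' ∘ e.symm) u) (fderiv ℝ (e' ∘ e.symm) u v) : Eu n) = symmD e u v := by
  have h1 : HasMFDerivAt (𝓡 n) (𝓡 n) (e' ∘ e.symm) u (fderiv ℝ (e' ∘ e.symm) u) :=
    ((he.contDiffAt_transition he' hu hu').differentiableAt (by simp)).hasFDerivAt.hasMFDerivAt
  have h2 : MDifferentiableAt (𝓡 n) (𝓡 n) e'.symm ((e' ∘ e.symm) u) :=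
    he'.mdifferentiable.mdifferentiableAt_symm (e'.map_source hu')
  have h3 := h2.hasMFDerivAt.comp u h1
  have h4 : e'.symm ∘ (e' ∘ e.symm) =ᶠ[𝓝 u] e.symm := by
    filter_upwards [(isOpen_transition e e').mem_nhds ⟨hu, hu'⟩] with w hw
    exact e'.left_inv hw.2
  exact DFunLike.congr_fun (h3.mfderiv.symm.trans h4.mfderiv_eq) v

end IsSmoothChart

end Charts

/-! ### Causal curves in charts -/

section CausalCharts

variable {m : ℕ} {M : Type*} [TopologicalSpace M] [ChartedSpace (Eu (m + 1)) M]
  [IsManifold (𝓡 (m + 1)) ∞ M]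

namespace ChronalConeBundle

variable (C : ChronalConeBundle m M)

/-- The cones of a chronal cone bundle in a chart. -/
def coordCone (e : OpenPartialHomeomorph M (Eu (m + 1))) (u : Eu (m + 1)) : Set (Eu (m + 1)) :=
  {w | symmD e u w ∈ C.cone (e.symm u)}

variable {C} {e : OpenPartialHomeomorph M (Eu (m + 1))}

theorem closure_coordCone (he : IsSmoothChart e) {u : Eu (m + 1)} (hu : u ∈ e.target) :
    closure (C.coordCone e u) =
      {w | symmD e u w ∈ closure (C.cone (e.symm u))} :=
  ((he.symmDeriv hu).toHomeomorph.preimage_closure (C.cone (e.symm u))).symm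

/-- Joint continuity in point and vector is what carries openness of the cones, and closedness of
the family of their closures, from the tangent bundle to coordinates. -/
theorem continuousAt_tangent (he : IsSmoothChart e) {u : Eu (m + 1)} (hu : u ∈ e.target)
    (w : Eu (m + 1)) :
    ContinuousAt (fun q : Eu (m + 1) × Eu (m + 1) =>
      (⟨e.symm q.1, symmD e q.1 q.2⟩ :
        TangentBundle (𝓡 (m + 1)) M)) (u, w) := by
  have h1 := he.contMDiffOn_symm.continuousOn_tangentMapWithin (by simp)
    e.open_target.uniqueMDiffOn
  have h2 : ContinuousAt (tangentMapWithin (𝓡 (m + 1)) (𝓡 (m + 1)) e.symm e.target)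
      (⟨u, w⟩ : TangentBundle (𝓡 (m + 1)) (Eu (m + 1))) :=
    h1.continuousAt ((e.open_target.preimage
      (FiberBundle.continuous_proj (Eu (m + 1)) (TangentSpace (𝓡 (m + 1))))).mem_nhds hu)
  have h3 : Continuous (fun q : Eu (m + 1) × Eu (m + 1) =>
      (⟨q.1, q.2⟩ : TangentBundle (𝓡 (m + 1)) (Eu (m + 1)))) :=
    (tangentBundleModelSpaceHomeomorph (𝓡 (m + 1))).symm.continuous
  have h4 := ContinuousAt.comp (x := (u, w)) (f := fun q : Eu (m + 1) × Eu (m + 1) =>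
      (⟨q.1, q.2⟩ : TangentBundle (𝓡 (m + 1)) (Eu (m + 1)))) h2 h3.continuousAt
  refine h4.congr ?_
  filter_upwards [(e.open_target.preimage continuous_fst).mem_nhds (show (u, w).1 ∈ e.target from hu)]
    with q hq
  simp only [tangentMapWithin, Function.comp]
  rw [mfderivWithin_of_isOpen e.open_target hq]
  rfl

theorem coneField (C : ChronalConeBundle m M) (he : IsSmoothChart e) :
    ConeField e.target (C.coordCone e) where
  isOpen_base := e.open_target
  nonempty u hu := by
    obtain ⟨v, hv⟩ := C.nonempty' (e.symm u)
    refine ⟨chartD e (e.symm u) v, ?_⟩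
    change symmD e u _ ∈ C.cone (e.symm u)
    rwa [he.symmD_chartD hu]
  smul_mem u hu w hw t ht := by
    change symmD e u (t • w) ∈ C.cone (e.symm u)
    rw [map_smul]
    exact C.smul_mem' _ _ hw t ht
  convex u hu := (C.convex' (e.symm u)).linear_preimage
    (symmD e u).toLinearMap
  salient u hu p v hpv := by
    have := C.salient' (e.symm u) (he.symmDeriv hu p) (he.symmDeriv hu v) fun t => by
      rw [← map_smul, ← map_add]
      exact hpv t
    exact (he.symmD_eq_zero_iff hu).1 this
  eventually_mem u hu w hw :=
    (continuousAt_tangent he hu w).eventually (C.isOpen'.mem_nhds hw)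
  eventually_notMem u hu w hw := by
    rw [closure_coordCone he hu] at hw
    filter_upwards [(continuousAt_tangent he hu w).eventually
      (C.isClosed_closure'.isOpen_compl.mem_nhds hw), (e.open_target.preimage
      continuous_fst).mem_nhds (show (u, w).1 ∈ e.target from hu)] with q hq hqt
    rw [closure_coordCone he hqt]
    exact hq

theorem _root_.Conal.lipschitzOnWith_congr {α β : Type*} [PseudoEMetricSpace α]
    [PseudoEMetricSpace β] {f g : α → β} {s : Set α} {K : ℝ≥0} (h : LipschitzOnWith K f s)
    (hfg : EqOn g f s) : LipschitzOnWith K g s := fun x hx y hy => by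
  rw [hfg hx, hfg hy]; exact h hx hy

omit [IsManifold (𝓡 (m + 1)) ∞ M] in
-- Transition maps are continuously differentiable, hence locally Lipschitz, so the choice of chart
-- does not matter.
theorem lipschitz_change {e' : OpenPartialHomeomorph M (Eu (m + 1))} (he : IsSmoothChart e)
    (he' : IsSmoothChart e') {γ : ℝ → M} {J : Set ℝ} {t : ℝ} (hγ : ContinuousWithinAt γ J t)
    (ht : γ t ∈ e.source) (ht' : γ t ∈ e'.source)
    (h : ∃ K : ℝ≥0, ∃ u ∈ 𝓝[J] t, LipschitzOnWith K (fun s => e (γ s)) u) :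
    ∃ K : ℝ≥0, ∃ u ∈ 𝓝[J] t, LipschitzOnWith K (fun s => e' (γ s)) u := by
  obtain ⟨K, u, hu, hL⟩ := h
  obtain ⟨K', v, hv, hL'⟩ := ((he.contDiffAt_transition he' (u := e (γ t)) (e.map_source ht)
    (by rwa [e.left_inv ht])).of_le (by simp)).exists_lipschitzOnWith
  have h1 : ∀ᶠ s in 𝓝[J] t, γ s ∈ e.source := hγ.eventually (e.open_source.mem_nhds ht)
  have h2 : ∀ᶠ s in 𝓝[J] t, e (γ s) ∈ v :=
    (((e.continuousAt ht).comp_continuousWithinAt hγ)).eventually hv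
  refine ⟨K' * K, u ∩ {s | γ s ∈ e.source ∧ e (γ s) ∈ v}, inter_mem hu (h1.and h2), ?_⟩
  have := hL'.comp (hL.mono inter_subset_left :
    LipschitzOnWith K _ (u ∩ {s | γ s ∈ e.source ∧ e (γ s) ∈ v})) fun s hs => hs.2.2
  refine lipschitzOnWith_congr this fun s hs => ?_
  simp [e.left_inv hs.2.1]

namespace IsCausalCurveOn

variable {γ : ℝ → M} {J : Set ℝ}

theorem isConeCurve (he : IsSmoothChart e) {a b : ℝ} (h : C.IsCausalCurveOn γ (Icc a b))
    (hm : MapsTo γ (Icc a b) e.source) : IsConeCurve (C.coordCone e) (fun t => e (γ t)) a b := by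
  obtain ⟨hc, hl, hd⟩ := h
  refine ⟨LocallyLipschitzOn.exists_lipschitzOnWith_of_compact isCompact_Icc fun t ht =>
    lipschitz_change (isSmoothChart_chartAt (γ t)) he (hc t ht) (mem_chart_source _ _) (hm ht)
      (hl t ht), ?_⟩
  filter_upwards [hd, ae_restrict_mem measurableSet_Icc] with t ⟨h1, h2, h3⟩ ht
  have hs := hm ht
  have hme := he.mdifferentiable.mdifferentiableAt hs
  have hcomp := hme.hasMFDerivAt.comp t h1.hasMFDerivAt
  have hfd := hasMFDerivAt_iff_hasFDerivAt.1 hcomp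
  set w : Eu (m + 1) := chartD e (γ t) (mfderiv 𝓘(ℝ, ℝ) (𝓡 (m + 1)) γ t (1 : ℝ)) with hw
  have hder : HasDerivAt (fun s => e (γ s)) w t := by
    have h4 : HasFDerivAt (fun s => e (γ s)) ((chartD e (γ t)).comp
      (mfderiv 𝓘(ℝ, ℝ) (𝓡 (m + 1)) γ t : ℝ →L[ℝ] TangentSpace (𝓡 (m + 1)) (γ t)) :
        ℝ →L[ℝ] Eu (m + 1)) t := hfd
    exact h4.hasDerivAt
  have hsd : symmD e (e (γ t)) w =
      mfderiv 𝓘(ℝ, ℝ) (𝓡 (m + 1)) γ t (1 : ℝ) :=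
    DFunLike.congr_fun (he.mdifferentiable.symm_comp_deriv hs) _
  refine ⟨w, hder, ?_, fun h0 => h3 ?_⟩
  · rw [closure_coordCone he (e.map_source hs)]
    change symmD e (e (γ t)) w ∈ closure (C.cone (e.symm (e (γ t))))
    rw [hsd, e.left_inv hs]
    exact h2
  · rw [← hsd, h0]
    exact map_zero (symmD e (e (γ t)))

theorem mono (h : C.IsCausalCurveOn γ J) {J' : Set ℝ} (hJ : J' ⊆ J) : C.IsCausalCurveOn γ J' := by
  obtain ⟨hc, hl, hd⟩ := h
  refine ⟨hc.mono hJ, fun t ht => ?_, ae_mono (Measure.restrict_mono hJ le_rfl) hd⟩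
  obtain ⟨K, u, hu, hL⟩ := hl t (hJ ht)
  exact ⟨K, u, nhdsWithin_mono t hJ hu, hL⟩

theorem congr {a b : ℝ} {γ' : ℝ → M} (h : C.IsCausalCurveOn γ (Icc a b))
    (heq : EqOn γ' γ (Icc a b)) : C.IsCausalCurveOn γ' (Icc a b) := by
  obtain ⟨hc, hl, hd⟩ := h
  refine ⟨hc.congr heq, fun t ht => ?_, ?_⟩
  · obtain ⟨K, u, hu, hL⟩ := hl t ht
    refine ⟨K, u ∩ Icc a b, inter_mem hu self_mem_nhdsWithin, ?_⟩
    rw [heq ht]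
    exact lipschitzOnWith_congr (hL.mono inter_subset_left) fun s hs => by simp only [heq hs.2]
  -- Derivatives at the end points depend on values outside the interval; the end points are
  -- discarded as a null set.
  · rw [← Measure.restrict_congr_set (Ioo_ae_eq_Icc (μ := volume) (a := a) (b := b))] at hd ⊢
    filter_upwards [hd, ae_restrict_mem measurableSet_Ioo] with t ⟨h1, h2, h3⟩ ht
    have hev : γ' =ᶠ[𝓝 t] γ := heq.eventuallyEq_of_mem (Icc_mem_nhds ht.1 ht.2)
    refine ⟨h1.congr_of_eventuallyEq hev, ?_, ?_⟩
    · rw [hev.mfderiv_eq, hev.eq_of_nhds]; exact h2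
    · rw [hev.mfderiv_eq]; exact h3

theorem comp_affine {a b : ℝ} (h : C.IsCausalCurveOn γ (Icc a b)) {r q a' b' : ℝ} (hr : 0 < r)
    (ha : r * a' + q = a) (hb : r * b' + q = b) :
    C.IsCausalCurveOn (fun s => γ (r * s + q)) (Icc a' b') := by
  obtain ⟨hc, hl, hd⟩ := h
  have hmaps : MapsTo (fun s => r * s + q) (Icc a' b') (Icc a b) := fun s hs => by
    subst ha hb
    exact ⟨by nlinarith [hs.1], by nlinarith [hs.2]⟩
  have hcont : Continuous (fun s => r * s + q) := by fun_prop
  refine ⟨hc.comp hcont.continuousOn hmaps, fun t ht => ?_, ?_⟩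
  · obtain ⟨K, u, hu, hL⟩ := hl _ (hmaps ht)
    refine ⟨K * Real.toNNReal r, _,
      (hcont.continuousWithinAt.tendsto_nhdsWithin hmaps) hu, ?_⟩
    have h1 : LipschitzOnWith (Real.toNNReal r) (fun s => r * s + q)
        ((fun s => r * s + q) ⁻¹' u) := LipschitzOnWith.of_dist_le_mul fun s _ t _ => by
      rw [Real.coe_toNNReal _ hr.le, Real.dist_eq, Real.dist_eq, ← abs_of_pos hr, ← abs_mul,
        abs_of_pos hr]
      exact le_of_eq (by ring_nf)
    exact hL.comp h1 (mapsTo_preimage _ _)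
  · rw [ae_restrict_iff' measurableSet_Icc] at hd ⊢
    have key : ∀ᵐ s : ℝ, (r * s + q ∈ Icc a b →
        MDifferentiableAt 𝓘(ℝ, ℝ) (𝓡 (m + 1)) γ (r * s + q) ∧
        mfderiv 𝓘(ℝ, ℝ) (𝓡 (m + 1)) γ (r * s + q) (1 : ℝ) ∈ closure (C.cone (γ (r * s + q))) ∧
        mfderiv 𝓘(ℝ, ℝ) (𝓡 (m + 1)) γ (r * s + q) (1 : ℝ) ≠ 0) := by
      -- The exceptional parameters are the image of a null set under the inverse affine map.
      rw [ae_iff] at hd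
      have := addHaar_image_eq_zero_of_differentiableOn_of_addHaar_eq_zero (μ := volume)
        (f := fun t : ℝ => (t - q) / r) (by fun_prop) hd
      rw [ae_iff]
      refine measure_mono_null ?_ this
      intro s hs
      exact ⟨r * s + q, hs, by field_simp; ring⟩
    filter_upwards [key] with s hs hsI
    obtain ⟨h1, h2, h3⟩ := hs (hmaps hsI)
    have hd : HasMFDerivAt 𝓘(ℝ, ℝ) 𝓘(ℝ, ℝ) (fun s => r * s + q) s
        (ContinuousLinearMap.toSpanSingleton ℝ r) := by
      have : HasDerivAt (fun s => r * s + q) r s := by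
        simpa using ((hasDerivAt_id s).const_mul r).add_const q
      exact this.hasFDerivAt.hasMFDerivAt
    have hcomp := h1.hasMFDerivAt.comp s hd
    have hval : mfderiv 𝓘(ℝ, ℝ) (𝓡 (m + 1)) (fun s => γ (r * s + q)) s (1 : ℝ) =
        r • mfderiv 𝓘(ℝ, ℝ) (𝓡 (m + 1)) γ (r * s + q) (1 : ℝ) := by
      set L : ℝ →L[ℝ] TangentSpace (𝓡 (m + 1)) (γ (r * s + q)) :=
        mfderiv 𝓘(ℝ, ℝ) (𝓡 (m + 1)) γ (r * s + q) with hL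
      have h4 : mfderiv 𝓘(ℝ, ℝ) (𝓡 (m + 1)) (fun s => γ (r * s + q)) s (1 : ℝ) = L ((1 : ℝ) • r) :=
        DFunLike.congr_fun hcomp.mfderiv (1 : ℝ)
      rw [h4, one_smul]
      change L r = r • L 1
      rw [← map_smul, smul_eq_mul, mul_one]
    refine ⟨hcomp.mdifferentiableAt, ?_, ?_⟩
    · rw [hval]
      exact map_mem_closure (continuous_const_smul r) h2 fun v hv => C.smul_mem' _ v hv r hr
    · rw [hval]
      exact smul_ne_zero hr.ne' h3

theorem union {a b c : ℝ} (hab : a ≤ b) (hbc : b ≤ c) (h : C.IsCausalCurveOn γ (Icc a b))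
    (h' : C.IsCausalCurveOn γ (Icc b c)) : C.IsCausalCurveOn γ (Icc a c) := by
  obtain ⟨hc, hl, hd⟩ := h
  obtain ⟨hc', hl', hd'⟩ := h'
  have hU : Icc a c = Icc a b ∪ Icc b c := (Icc_union_Icc_eq_Icc hab hbc).symm
  rw [hU]
  refine ⟨hc.union_of_isClosed hc' isClosed_Icc isClosed_Icc, fun t ht => ?_, ?_⟩
  · rcases lt_trichotomy t b with htb | rfl | htb
    · have htI : t ∈ Icc a b := ht.resolve_right fun h => absurd h.1 (not_le.2 htb)
      obtain ⟨K, u, hu, hL⟩ := hl t htI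
      refine ⟨K, u ∩ Iio b, ?_, hL.mono inter_subset_left⟩
      rw [nhdsWithin_union]
      refine ⟨inter_mem hu (mem_nhdsWithin_of_mem_nhds (Iio_mem_nhds htb)), ?_⟩
      rw [notMem_closure_iff_nhdsWithin_eq_bot.1 (by
        rw [isClosed_Icc.closure_eq]; exact fun h => absurd h.1 (not_le.2 htb))]
      exact mem_bot
    · obtain ⟨K, u, hu, hL⟩ := hl t (right_mem_Icc.2 hab)
      obtain ⟨K', u', hu', hL'⟩ := hl' t (left_mem_Icc.2 hbc)
      -- Across the junction the distance is split at `t`, so the sum of both constants works on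
      -- either side and across.
      refine ⟨K + K', (u ∩ Icc a t) ∪ (u' ∩ Icc t c), ?_, ?_⟩
      · rw [nhdsWithin_union]
        exact ⟨mem_of_superset (inter_mem hu self_mem_nhdsWithin) subset_union_left,
          mem_of_superset (inter_mem hu' self_mem_nhdsWithin) subset_union_right⟩
      · have htu := mem_of_mem_nhdsWithin (right_mem_Icc.2 hab) hu
        have htu' := mem_of_mem_nhdsWithin (left_mem_Icc.2 hbc) hu'
        refine LipschitzOnWith.of_dist_le_mul fun s hs s' hs' => ?_
        wlog hss : s ≤ s' generalizing s s'
        · rw [dist_comm, dist_comm s]; exact this s' hs' s hs (le_of_not_ge hss)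
        rw [Real.dist_eq, abs_sub_comm, abs_of_nonneg (sub_nonneg.2 hss), NNReal.coe_add]
        have hK := K.2
        have hK' := K'.2
        have e1 : ∀ s ∈ u ∩ Icc a t, ∀ s' ∈ u ∩ Icc a t, s ≤ s' →
            dist (extChartAt (𝓡 (m + 1)) (γ t) (γ s)) (extChartAt (𝓡 (m + 1)) (γ t) (γ s')) ≤
              K * (s' - s) := fun s hs s' hs' hss => by
          have := hL.dist_le_mul s hs.1 s' hs'.1
          rwa [Real.dist_eq, abs_sub_comm, abs_of_nonneg (sub_nonneg.2 hss)] at this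
        have e2 : ∀ s ∈ u' ∩ Icc t c, ∀ s' ∈ u' ∩ Icc t c, s ≤ s' →
            dist (extChartAt (𝓡 (m + 1)) (γ t) (γ s)) (extChartAt (𝓡 (m + 1)) (γ t) (γ s')) ≤
              K' * (s' - s) := fun s hs s' hs' hss => by
          have := hL'.dist_le_mul s hs.1 s' hs'.1
          rwa [Real.dist_eq, abs_sub_comm, abs_of_nonneg (sub_nonneg.2 hss)] at this
        have hsub := sub_nonneg.2 hss
        rcases hs with hs | hs <;> rcases hs' with hs' | hs'
        · refine (e1 s hs s' hs' hss).trans ?_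
          have := mul_nonneg hK' hsub
          simp only [NNReal.val_eq_coe] at this
          linarith
        · refine (dist_triangle _ (extChartAt (𝓡 (m + 1)) (γ t) (γ t)) _).trans ?_
          have f1 := e1 s hs t ⟨htu, right_mem_Icc.2 hab⟩ hs.2.2
          have f2 := e2 t ⟨htu', left_mem_Icc.2 hbc⟩ s' hs' hs'.2.1
          have f3 := mul_nonneg hK (sub_nonneg.2 hs'.2.1)
          have f4 := mul_nonneg hK' (sub_nonneg.2 hs.2.2)
          simp only [NNReal.val_eq_coe] at f3 f4
          linarith
        · have : s = s' := le_antisymm hss (hs'.2.2.trans hs.2.1)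
          subst this
          simp
        · refine (e2 s hs s' hs' hss).trans ?_
          have := mul_nonneg hK hsub
          simp only [NNReal.val_eq_coe] at this
          linarith
    · have htI : t ∈ Icc b c := ht.resolve_left fun h => absurd h.2 (not_le.2 htb)
      obtain ⟨K, u, hu, hL⟩ := hl' t htI
      refine ⟨K, u ∩ Ioi b, ?_, hL.mono inter_subset_left⟩
      rw [nhdsWithin_union]
      refine ⟨?_, inter_mem hu (mem_nhdsWithin_of_mem_nhds (Ioi_mem_nhds htb))⟩
      rw [notMem_closure_iff_nhdsWithin_eq_bot.1 (by
        rw [isClosed_Icc.closure_eq]; exact fun h => absurd h.2 (not_le.2 htb))]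
      exact mem_bot
  · exact (ae_restrict_union_iff _ _ _).2 ⟨hd, hd'⟩

/-- Unit intervals are not neighbourhoods of their end points. Every parameter is interior to an
interval of length two, glued from two adjacent ones. -/
theorem of_int (h : ∀ i : ℤ, C.IsCausalCurveOn γ (Icc (i : ℝ) (i + 1))) :
    C.IsCausalCurveOn γ univ := by
  have h2 : ∀ i : ℤ, C.IsCausalCurveOn γ (Icc (i : ℝ) (i + 2)) := fun i =>
    (h i).union (by simp) (by linarith) (by
      have := h (i + 1)
      push_cast at this
      rwa [add_assoc, one_add_one_eq_two] at this)
  have hmem : ∀ t : ℝ, ∃ i : ℤ, Icc (i : ℝ) (i + 2) ∈ 𝓝 t := fun t => by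
    refine ⟨⌊t⌋ - 1, Icc_mem_nhds ?_ ?_⟩
    · push_cast; linarith [Int.floor_le t]
    · push_cast; linarith [Int.lt_floor_add_one t]
  refine ⟨continuousOn_univ.2 (continuous_iff_continuousAt.2 fun t => ?_), fun t _ => ?_, ?_⟩
  · obtain ⟨i, hi⟩ := hmem t
    exact (h2 i).1.continuousAt hi
  · obtain ⟨i, hi⟩ := hmem t
    obtain ⟨K, u, hu, hL⟩ := (h2 i).2.1 t (mem_of_mem_nhds hi)
    rw [nhdsWithin_eq_nhds.2 hi] at hu
    exact ⟨K, u, by rwa [nhdsWithin_univ], hL⟩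
  · have : (univ : Set ℝ) = ⋃ i : ℤ, Icc (i : ℝ) (i + 1) := by
      symm
      rw [eq_univ_iff_forall]
      exact fun t => mem_iUnion.2 ⟨⌊t⌋, Int.floor_le t, (Int.lt_floor_add_one t).le⟩
    rw [this, ae_restrict_iUnion_iff]
    exact fun i => (h i).2.2

theorem causallyPrecedes {a b : ℝ} (hab : a < b) (h : C.IsCausalCurveOn γ (Icc a b)) :
    C.CausallyPrecedes (γ a) (γ b) :=
  ⟨_, h.comp_affine (sub_pos.2 hab) (by ring : (b - a) * 0 + a = a)
    (by ring : (b - a) * 1 + a = b), by simp, by simp⟩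

end IsCausalCurveOn

theorem _root_.Conal.IsConeCurve.isCausalCurveOn (he : IsSmoothChart e) {σ : ℝ → Eu (m + 1)}
    {a b : ℝ} (h : IsConeCurve (C.coordCone e) σ a b) (hm : MapsTo σ (Icc a b) e.target) :
    C.IsCausalCurveOn (fun t => e.symm (σ t)) (Icc a b) := by
  obtain ⟨⟨L, hL⟩, hd⟩ := h
  have hc : ContinuousOn (fun t => e.symm (σ t)) (Icc a b) :=
    e.continuousOn_symm.comp hL.continuousOn hm
  refine ⟨hc, fun t ht => ?_, ?_⟩
  · refine lipschitz_change he (isSmoothChart_chartAt (e.symm (σ t))) (hc t ht)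
      (e.map_target (hm ht)) (mem_chart_source _ _) 
      ⟨L, _, self_mem_nhdsWithin, lipschitzOnWith_congr hL ?_⟩
    exact fun s hs => e.right_inv (hm hs)
  · filter_upwards [hd, ae_restrict_mem measurableSet_Icc] with t ⟨w, hw, hwK, hw0⟩ ht
    have hs := hm ht
    have h1 : HasMFDerivAt 𝓘(ℝ, ℝ) (𝓡 (m + 1)) σ t (ContinuousLinearMap.toSpanSingleton ℝ w) :=
      hw.hasFDerivAt.hasMFDerivAt
    have h2 := (he.mdifferentiable.mdifferentiableAt_symm hs).hasMFDerivAt.comp t h1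
    have hval : mfderiv 𝓘(ℝ, ℝ) (𝓡 (m + 1)) (fun t => e.symm (σ t)) t (1 : ℝ) =
        symmD e (σ t) w := by
      rw [show mfderiv 𝓘(ℝ, ℝ) (𝓡 (m + 1)) (fun t => e.symm (σ t)) t = _ from h2.mfderiv]
      change symmD e (σ t) ((1 : ℝ) • w) = _
      rw [one_smul]
    refine ⟨h2.mdifferentiableAt, ?_, ?_⟩
    · rw [hval]
      rw [closure_coordCone he hs] at hwK
      exact hwK
    · rw [hval]
      exact fun h0 => hw0 ((he.symmD_eq_zero_iff hs).1 h0)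

theorem CausallyPrecedes.trans {x y z : M} (h : C.CausallyPrecedes x y)
    (h' : C.CausallyPrecedes y z) : C.CausallyPrecedes x z := by
  obtain ⟨γ, hγ, rfl, rfl⟩ := h
  obtain ⟨γ', hγ', h0, rfl⟩ := h'
  let δ : ℝ → M := fun t => if t ≤ 1 then γ t else γ' (1 * t + -1)
  have h1 : C.IsCausalCurveOn δ (Icc 0 1) := hγ.congr fun t ht => if_pos ht.2
  have h2 : C.IsCausalCurveOn δ (Icc 1 2) := by
    refine (hγ'.comp_affine (r := 1) (q := -1) one_pos (a' := 1) (b' := 2) (by norm_num)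
      (by norm_num)).congr fun t ht => ?_
    rcases ht.1.eq_or_lt with rfl | ht1
    · simp [δ, h0]
    · exact if_neg (not_le.2 ht1)
  have := (h1.union zero_le_one one_le_two h2).causallyPrecedes two_pos
  simpa [δ, show ¬ (2 : ℝ) ≤ 1 by norm_num, show (2 : ℝ) + -1 = 1 by norm_num] using this

theorem zero_notMem_cone (C : ChronalConeBundle m M) (x : M) :
    (0 : TangentSpace (𝓡 (m + 1)) x) ∉ C.cone x := by
  intro h0
  have he : IsSmoothChart (chartAt (Eu (m + 1)) x) := isSmoothChart_chartAt x
  refine (coneField C he).zero_notMem (mem_chart_target (Eu (m + 1)) x) ?_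
  change symmD (chartAt (Eu (m + 1)) x) (chartAt (Eu (m + 1)) x x) 0 ∈ C.cone _
  rw [map_zero]
  have hl := (chartAt (Eu (m + 1)) x).left_inv (mem_chart_source (Eu (m + 1)) x)
  have : ∀ y, y = x → (0 : TangentSpace (𝓡 (m + 1)) y) ∈ C.cone y := by rintro y rfl; exact h0
  exact this _ hl

theorem Precedes.causallyPrecedes {x y : M} (h : C.Precedes x y) : C.CausallyPrecedes x y := by
  obtain ⟨γ, hγ, h0, h1, hd⟩ := h
  refine ⟨γ, ⟨hγ.continuous.continuousOn, fun t ht => ?_, ?_⟩, h0, h1⟩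
  · have h2 : ContDiffAt ℝ 1 (fun s => extChartAt (𝓡 (m + 1)) (γ t) (γ s)) t := by
      rw [← contMDiffAt_iff_contDiffAt]
      exact ((contMDiffAt_extChartAt (n := 1)).comp t (hγ.contMDiffAt.of_le (by simp)))
    obtain ⟨K, u, hu, hL⟩ := h2.exists_lipschitzOnWith
    exact ⟨K, u, mem_nhdsWithin_of_mem_nhds hu, hL⟩
  · filter_upwards [ae_restrict_mem measurableSet_Icc] with t ht
    refine ⟨hγ.mdifferentiable (by simp) t, subset_closure (hd t ht), fun hz => ?_⟩
    have := C.zero_notMem_cone (γ t)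
    exact this (hz ▸ hd t ht)

end ChronalConeBundle

end CausalCharts

/-! ### The causal splitting defined by a Cauchy surface -/

section Splitting

variable {m : ℕ} {M : Type*} [TopologicalSpace M] [ChartedSpace (Eu (m + 1)) M]
  [IsManifold (𝓡 (m + 1)) ∞ M]

namespace ChronalConeBundle

variable {C : ChronalConeBundle m M} {e : OpenPartialHomeomorph M (Eu (m + 1))}

theorem isCausalCurveOn_segment (he : IsSmoothChart e) {B : Set (Eu (m + 1))} (hBT : B ⊆ e.target)
    (hB : Convex ℝ B) {x y : Eu (m + 1)} (hx : x ∈ B) (hy : y ∈ B)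
    (hK : ∀ u ∈ B, y - x ∈ C.coordCone e u) :
    C.IsCausalCurveOn (fun t => e.symm (AffineMap.lineMap x y t)) (Icc 0 1) := by
  obtain ⟨h1, h2⟩ := isConeCurve_lineMap (coneField C he) hBT hB hx hy hK
  exact h1.isCausalCurveOn he (h2.mono_right hBT)

theorem precedes_segment (he : IsSmoothChart e) {B : Set (Eu (m + 1))} (hBT : B ⊆ e.target)
    (hB : Convex ℝ B) {x y : Eu (m + 1)} (hx : x ∈ B) (hy : y ∈ B)
    (hK : ∀ u ∈ B, y - x ∈ C.coordCone e u) : C.CausallyPrecedes (e.symm x) (e.symm y) := by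
  simpa using (isCausalCurveOn_segment he hBT hB hx hy hK).causallyPrecedes one_pos

theorem mem_image_coneRel (he : IsSmoothChart e) {B : Set (Eu (m + 1))} (hBT : B ⊆ e.target)
    {γ : ℝ → M} {a b : ℝ} (hab : a ≤ b) (hγ : C.IsCausalCurveOn γ (Icc a b))
    (hm : MapsTo γ (Icc a b) (e.symm '' B)) :
    (γ a, γ b) ∈ Prod.map e.symm e.symm '' coneRel (C.coordCone e) B := by
  have hmem : ∀ t ∈ Icc a b, γ t ∈ e.source ∧ e (γ t) ∈ B := fun t ht => by
    obtain ⟨u, hu, hut⟩ := hm ht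
    rw [← hut, e.right_inv (hBT hu)]
    exact ⟨e.map_target (hBT hu), hu⟩
  have ha := hmem a (left_mem_Icc.2 hab)
  have hb := hmem b (right_mem_Icc.2 hab)
  refine ⟨(e (γ a), e (γ b)), ⟨ha.2, hb.2, ?_⟩, by simp [e.left_inv ha.1, e.left_inv hb.1]⟩
  rcases hab.eq_or_lt with rfl | hab
  · exact Or.inl rfl
  right
  have hmaps : MapsTo (fun s => (b - a) * s + a) (Icc 0 1) (Icc a b) := fun s hs =>
    ⟨by nlinarith [hs.1], by nlinarith [hs.2]⟩
  refine ⟨_, (hγ.comp_affine (r := b - a) (q := a) (a' := 0) (b' := 1) (sub_pos.2 hab) (by ring)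
    (by ring)).isConeCurve he fun s hs => (hmem _ (hmaps hs)).1,
    fun s hs => (hmem _ (hmaps hs)).2, by simp, by simp⟩

/-- A small closed coordinate ball admits one functional that is uniformly positive on all its
cones, so the relation inside it is closed. A curve leaving or entering the open ball is cut at its
first or last parameter outside it. Successors and predecessors on the sphere are reached along
straight lines in a direction `v` common to all cones. -/
theorem hasCausalBalls [T2Space M] (C : ChronalConeBundle m M) :
    HasCausalBalls C.CausallyPrecedes := by
  intro x W hW
  set e := chartAt (Eu (m + 1)) x with he_def
  have he : IsSmoothChart e := isSmoothChart_chartAt x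
  have hx : x ∈ e.source := mem_chart_source _ x
  obtain ⟨v, ε, c, l, δ, hε, hδ, hT, hv, hl⟩ := (coneField C he).exists_ball (e.map_source hx)
  have hW' : ∀ᶠ u in 𝓝 (e x), e.symm u ∈ W :=
    (e.continuousAt_symm (e.map_source hx)).eventually (by rwa [e.left_inv hx])
  obtain ⟨r', hr', hrW⟩ := Metric.nhds_basis_closedBall.eventually_iff.1 hW'
  set r := min δ r' with hr_def
  have hr : 0 < r := lt_min hδ hr'
  have hrδ : Metric.closedBall (e x) r ⊆ Metric.closedBall (e x) δ :=
    Metric.closedBall_subset_closedBall (min_le_left _ _)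
  have hrT := hrδ.trans hT
  have hbT : Metric.ball (e x) r ⊆ e.target := Metric.ball_subset_closedBall.trans hrT
  have hl' : IsTimeFunctional (C.coordCone e) (Metric.closedBall (e x) r) c l :=
    ⟨hl.1, fun u hu => hl.2 u (hrδ hu)⟩
  have hcompact : IsCompact (e.symm '' Metric.closedBall (e x) r) :=
    (isCompact_closedBall _ _).image_of_continuousOn (e.continuousOn_symm.mono hrT)
  have hopen : IsOpen (e.symm '' Metric.ball (e x) r) :=
    e.symm.isOpen_image_of_subset_source Metric.isOpen_ball hbT
  have hmemO : ∀ u ∈ e.target, e.symm u ∈ e.symm '' Metric.ball (e x) r →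
      u ∈ Metric.ball (e x) r := by
    rintro u hu ⟨u', hu', h⟩
    rwa [← e.symm.injOn (hbT hu') hu h]
  have hv0 : v ≠ 0 := fun h0 => (coneField C he).zero_notMem (e.map_source hx)
    (h0 ▸ hv (e x) (Metric.mem_closedBall_self hδ.le) v (Metric.mem_ball_self hε))
  have hK : ∀ t : ℝ, 0 < t → ∀ u ∈ Metric.closedBall (e x) r, t • v ∈ C.coordCone e u :=
    fun t ht u hu => (coneField C he).smul_mem u (hrT hu) v
      (hv u (hrδ hu) v (Metric.mem_ball_self hε)) t ht
  have hexit : ∀ w : Eu (m + 1), w ≠ 0 → ∀ u ∈ Metric.ball (e x) r,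
      ∃ t : ℝ, 0 < t ∧ dist (u + t • w) (e x) = r := by
    intro w hw0 u hu
    have hw : 0 < ‖w‖ := norm_pos_iff.2 hw0
    have hcont : Continuous fun t : ℝ => dist (u + t • w) (e x) := by fun_prop
    have hu' : dist u (e x) < r := hu
    -- A displacement of length `2 * r` leaves the ball, so the intermediate value theorem finds a
    -- point of the sphere on the way.
    obtain ⟨t, ht, htr⟩ := intermediate_value_Icc (show (0 : ℝ) ≤ 2 * r / ‖w‖ by positivity)
      hcont.continuousOn (show r ∈ Icc (dist (u + (0 : ℝ) • w) (e x)) _ by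
        refine ⟨by simpa using hu'.le, ?_⟩
        have h1 : dist (u + (2 * r / ‖w‖) • w) u = 2 * r := by
          rw [dist_eq_norm, add_sub_cancel_left, norm_smul, Real.norm_of_nonneg (by positivity)]
          field_simp
        have h2 := dist_triangle (u + (2 * r / ‖w‖) • w) (e x) u
        rw [h1, dist_comm (e x)] at h2
        linarith)
    refine ⟨t, lt_of_le_of_ne ht.1 ?_, htr⟩
    rintro rfl
    simp only [zero_smul, add_zero] at htr
    exact hu'.ne htr
  refine ⟨e.symm '' Metric.closedBall (e x) r, e.symm '' Metric.ball (e x) r,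
    Prod.map e.symm e.symm '' coneRel (C.coordCone e) (Metric.closedBall (e x) r), ⟨hcompact, hopen,
    image_mono Metric.ball_subset_closedBall, ?_, ?_, ?_, ?_, ?_, ?_⟩, ?_,
    ⟨e x, Metric.mem_ball_self hr, e.left_inv hx⟩⟩
  · have h1 := isClosed_coneRel (coneField C he) (isCompact_closedBall _ _) hrT hl'
    have h2 : coneRel (C.coordCone e) (Metric.closedBall (e x) r) ⊆
      Metric.closedBall (e x) r ×ˢ Metric.closedBall (e x) r := fun p hp => ⟨hp.1, hp.2.1⟩
    refine ((((isCompact_closedBall _ _).prod (isCompact_closedBall _ _)).of_isClosed_subset h1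
      h2).image_of_continuousOn ?_).isClosed
    exact (e.continuousOn_symm.prodMap e.continuousOn_symm).mono
      (h2.trans (prod_mono hrT hrT))
  · rintro _ _ ⟨⟨a, b⟩, ⟨ha, hb, hab⟩, heq⟩
    simp only [Prod.map_apply, Prod.mk.injEq] at heq
    obtain ⟨rfl, rfl⟩ := heq
    rcases hab with hab | ⟨σ, hσ, hm, h0, h1⟩
    · left; simp only at hab; rw [hab]
    · right
      have := (hσ.isCausalCurveOn he (hm.mono_right hrT)).causallyPrecedes one_pos
      rwa [h0, h1] at this
  · rintro y z ⟨γ, hγ, rfl, rfl⟩ hy hz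
    have hZ : IsCompact (Icc 0 1 ∩ γ ⁻¹' (e.symm '' Metric.ball (e x) r)ᶜ) :=
      isCompact_Icc.of_isClosed_subset (hγ.1.preimage_isClosed_of_isClosed isClosed_Icc
        hopen.isClosed_compl) inter_subset_left
    obtain ⟨t, ⟨ht, htO⟩, htmin⟩ := hZ.exists_isLeast ⟨1, by simp, hz⟩
    have h0t : 0 < t := lt_of_le_of_ne ht.1 fun h => htO (h ▸ hy)
    have hmO : MapsTo γ (Ico 0 t) (e.symm '' Metric.ball (e x) r) := fun s hs => by
      by_contra hsO
      exact (htmin ⟨⟨hs.1, hs.2.le.trans ht.2⟩, hsO⟩).not_gt hs.2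
    have hmB : MapsTo γ (Icc 0 t) (e.symm '' Metric.closedBall (e x) r) := by
      have := hmO.closure_of_continuousOn (by
        rw [closure_Ico h0t.ne]; exact hγ.1.mono (Icc_subset_Icc_right ht.2))
      rw [closure_Ico h0t.ne] at this
      exact this.mono_right (closure_minimal (image_mono Metric.ball_subset_closedBall)
        hcompact.isClosed)
    refine ⟨γ t, ⟨hmB (right_mem_Icc.2 h0t.le), htO⟩, mem_image_coneRel he hrT h0t.le
      (hγ.mono (Icc_subset_Icc_right ht.2)) hmB, ?_⟩
    rcases ht.2.eq_or_lt with rfl | ht1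
    · exact Or.inl rfl
    · exact Or.inr ((hγ.mono (Icc_subset_Icc_left ht.1)).causallyPrecedes ht1)
  · rintro y z ⟨γ, hγ, rfl, rfl⟩ hz hy
    have hZ : IsCompact (Icc 0 1 ∩ γ ⁻¹' (e.symm '' Metric.ball (e x) r)ᶜ) :=
      isCompact_Icc.of_isClosed_subset (hγ.1.preimage_isClosed_of_isClosed isClosed_Icc
        hopen.isClosed_compl) inter_subset_left
    obtain ⟨t, ⟨ht, htO⟩, htmax⟩ := hZ.exists_isGreatest ⟨0, by simp, hy⟩
    have h0t : t < 1 := lt_of_le_of_ne ht.2 fun h => htO (h ▸ hz)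
    have hmO : MapsTo γ (Ioc t 1) (e.symm '' Metric.ball (e x) r) := fun s hs => by
      by_contra hsO
      exact (htmax ⟨⟨ht.1.trans hs.1.le, hs.2⟩, hsO⟩).not_gt hs.1
    have hmB : MapsTo γ (Icc t 1) (e.symm '' Metric.closedBall (e x) r) := by
      have := hmO.closure_of_continuousOn (by
        rw [closure_Ioc h0t.ne]; exact hγ.1.mono (Icc_subset_Icc_left ht.1))
      rw [closure_Ioc h0t.ne] at this
      exact this.mono_right (closure_minimal (image_mono Metric.ball_subset_closedBall)
        hcompact.isClosed)
    refine ⟨γ t, ⟨hmB (left_mem_Icc.2 h0t.le), htO⟩, mem_image_coneRel he hrT h0t.le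
      (hγ.mono (Icc_subset_Icc_left ht.1)) hmB, ?_⟩
    rcases ht.1.eq_or_lt with rfl | ht1
    · exact Or.inl rfl
    · exact Or.inr ((hγ.mono (Icc_subset_Icc_right ht.2)).causallyPrecedes ht1)
  · rintro _ ⟨u, hu, rfl⟩
    obtain ⟨t, ht, htr⟩ := hexit v hv0 u hu
    have hq : u + t • v ∈ Metric.closedBall (e x) r := htr.le
    refine ⟨e.symm (u + t • v), ⟨⟨_, hq, rfl⟩, fun h => (hmemO _ (hrT hq) h).ne htr⟩,
      (u, u + t • v), ⟨Metric.ball_subset_closedBall hu, hq, Or.inr ?_⟩, rfl⟩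
    obtain ⟨h1, h2⟩ := isConeCurve_lineMap (coneField C he) hrT (convex_closedBall _ _)
      (Metric.ball_subset_closedBall hu) hq (by simpa using hK t ht)
    exact ⟨_, h1, h2, by simp, by simp⟩
  · rintro _ ⟨u, hu, rfl⟩
    obtain ⟨t, ht, htr⟩ := hexit (-v) (neg_ne_zero.2 hv0) u hu
    have hq : u + t • -v ∈ Metric.closedBall (e x) r := htr.le
    refine ⟨e.symm (u + t • -v), ⟨⟨_, hq, rfl⟩, fun h => (hmemO _ (hrT hq) h).ne htr⟩,
      (u + t • -v, u), ⟨hq, Metric.ball_subset_closedBall hu, Or.inr ?_⟩, rfl⟩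
    obtain ⟨h1, h2⟩ := isConeCurve_lineMap (coneField C he) hrT (convex_closedBall _ _) hq
      (Metric.ball_subset_closedBall hu) (by simpa using hK t ht)
    exact ⟨_, h1, h2, by simp, by simp⟩
  · rintro _ ⟨u, hu, rfl⟩
    exact hrW (Metric.closedBall_subset_closedBall (min_le_right _ _) hu)

/-- Points from which a causal curve leads to `S`. -/
def strictPast (C : ChronalConeBundle m M) (S : Set M) : Set M :=
  {x | ∃ s ∈ S, C.CausallyPrecedes x s}

/-- Points to which a causal curve leads from `S`. -/
def strictFuture (C : ChronalConeBundle m M) (S : Set M) : Set M :=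
  {x | ∃ s ∈ S, C.CausallyPrecedes s x}

variable {S : Set M} [ChartedSpace (Eu m) S]

namespace IsCauchySurface

/-- The concatenated arcs form a causal curve on the line. A limit at either end would be a limit of
the vertices, so the curve is inextensible and meets `S`. -/
theorem meets_of_chain (hS : C.IsCauchySurface S) (γ : ℤ → ℝ → M)
    (hγ : ∀ i, C.IsCausalCurveOn (γ i) (Icc 0 1)) (hjoin : ∀ i, γ i 1 = γ (i + 1) 0)
    (htop : ¬ ∃ x, Tendsto (fun i => γ i 0) atTop (𝓝 x))
    (hbot : ¬ ∃ x, Tendsto (fun i => γ i 0) atBot (𝓝 x)) :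
    ∃ i, ∃ t ∈ Ico (0 : ℝ) 1, γ i t ∈ S := by
  set δ : ℝ → M := fun t => γ ⌊t⌋ (Int.fract t) with hδ
  have hcurve : C.IsCausalCurveOn δ univ := by
    refine IsCausalCurveOn.of_int fun i => ?_
    refine ((hγ i).comp_affine (r := 1) (q := -i) one_pos (a' := i) (b' := i + 1) (by ring)
      (by ring)).congr fun t ht => ?_
    rcases ht.2.eq_or_lt with rfl | hlt
    · have h1 : ⌊(i : ℝ) + 1⌋ = i + 1 := by
        rw [show (i : ℝ) + 1 = ((i + 1 : ℤ) : ℝ) by push_cast; ring, Int.floor_intCast]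
      have h2 : Int.fract ((i : ℝ) + 1) = 0 := by
        rw [show (i : ℝ) + 1 = ((i + 1 : ℤ) : ℝ) by push_cast; ring, Int.fract_intCast]
      simp only [hδ, h1, h2]
      rw [← hjoin]
      congr 1; ring
    · have h1 : ⌊t⌋ = i := Int.floor_eq_iff.2 ⟨ht.1, hlt⟩
      simp only [hδ, h1, Int.fract]
      congr 1; ring
  have hint : ∀ i : ℤ, δ i = γ i 0 := fun i => by simp [hδ]
  obtain ⟨t, ht, -⟩ := hS.meets_once δ ⟨hcurve, fun ⟨x, hx⟩ => htop ⟨x, by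
    have := hx.comp (tendsto_intCast_atTop_atTop (R := ℝ))
    exact this.congr hint⟩, fun ⟨x, hx⟩ => hbot ⟨x, by
    have := hx.comp (tendsto_intCast_atBot_iff (R := ℝ).2 tendsto_id)
    exact this.congr hint⟩⟩
  exact ⟨⌊t⌋, Int.fract t, ⟨Int.fract_nonneg t, Int.fract_lt_one t⟩, ht⟩

variable [T2Space M] [SecondCountableTopology M]

/-- A causal curve, extended to an inextensible one, meets a Cauchy surface. -/
theorem meets_through (hS : C.IsCauchySurface S) {γ : ℝ → M} (hγ : C.IsCausalCurveOn γ (Icc 0 1)) :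
    (∃ t ∈ Icc (0 : ℝ) 1, γ t ∈ S) ∨ γ 1 ∈ C.strictPast S ∨ γ 0 ∈ C.strictFuture S := by
  obtain ⟨s, hs0, hsR, hsl⟩ := C.hasCausalBalls.exists_divergent_chain (γ 1)
  obtain ⟨p, hp0, hpR, hpl⟩ := C.hasCausalBalls.swap.exists_divergent_chain (γ 0)
  choose σ hσ hσ0 hσ1 using hsR
  choose τ hτ hτ0 hτ1 using hpR
  -- The given curve has index `0`; a divergent chain of arcs starts at its end, and another one
  -- leads to its start.
  let δ : ℤ → ℝ → M := fun i =>
    if i = 0 then γ else if 0 < i then σ (i - 1).toNat else τ (-i - 1).toNat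
  have hδ0 : δ 0 = γ := by simp [δ]
  have hδp : ∀ n : ℕ, δ (n + 1) = σ n := fun n => by
    simp [δ, show (n : ℤ) + 1 ≠ 0 by omega, show (0 : ℤ) < n + 1 by omega]
  have hδn : ∀ n : ℕ, δ (-n - 1) = τ n := fun n => by
    have h1 : (-(-(n : ℤ) - 1) - 1).toNat = n := by omega
    change (if -(n : ℤ) - 1 = 0 then γ else if 0 < -(n : ℤ) - 1 then _ else _) = _
    rw [if_neg (by omega), if_neg (by omega), h1]
  have hcases : ∀ i : ℤ, i = 0 ∨ (∃ n : ℕ, i = n + 1) ∨ ∃ n : ℕ, i = -n - 1 := fun i => by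
    rcases lt_trichotomy i 0 with h | h | h
    · exact Or.inr (Or.inr ⟨(-i - 1).toNat, by omega⟩)
    · exact Or.inl h
    · exact Or.inr (Or.inl ⟨(i - 1).toNat, by omega⟩)
  obtain ⟨i, t, ht, hit⟩ := hS.meets_of_chain δ (fun i => by
      rcases hcases i with rfl | ⟨n, rfl⟩ | ⟨n, rfl⟩
      · rwa [hδ0]
      · rw [hδp]; exact hσ n
      · rw [hδn]; exact hτ n)
    (fun i => by
      rcases hcases i with rfl | ⟨n, rfl⟩ | ⟨n, rfl⟩
      · have := hδp 0
        simp only [Nat.cast_zero, zero_add] at this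
        rw [hδ0, zero_add, this, hσ0, hs0]
      · have := hδp (n + 1)
        push_cast at this
        rw [hδp, this, hσ0, hσ1]
      · rw [hδn, hτ1]
        rcases n with _ | n
        · simp [hδ0, hp0]
        · have := hδn n
          rw [show -((n + 1 : ℕ) : ℤ) - 1 + 1 = -n - 1 by push_cast; ring, this, hτ0])
    (fun ⟨x, hx⟩ => hsl ⟨x, by
      have h1 : Tendsto (fun n : ℕ => (n : ℤ) + 1) atTop atTop :=
        tendsto_atTop_add_const_right _ _ tendsto_natCast_atTop_atTop
      exact (hx.comp h1).congr fun n => by simp only [Function.comp]; rw [hδp, hσ0]⟩)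
    (fun ⟨x, hx⟩ => hpl ⟨x, by
      have h1 : Tendsto (fun n : ℕ => -(n : ℤ) - 1) atTop atBot :=
        tendsto_atBot_add_const_right _ _
          ((tendsto_neg_atTop_atBot (G := ℤ)).comp tendsto_natCast_atTop_atTop)
      have := (hx.comp h1).congr fun n => by simp only [Function.comp]; rw [hδn, hτ0]
      exact (tendsto_add_atTop_iff_nat 1).1 this⟩)
  rcases hcases i with rfl | ⟨n, rfl⟩ | ⟨n, rfl⟩
  · rw [hδ0] at hit
    exact Or.inl ⟨t, Ico_subset_Icc_self ht, hit⟩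
  · rw [hδp] at hit
    have key : ∀ n : ℕ, s 0 = s n ∨ C.CausallyPrecedes (s 0) (s n) := by
      intro n
      induction n with
      | zero => exact Or.inl rfl
      | succ n ih =>
        have hn : C.CausallyPrecedes (s n) (s (n + 1)) := ⟨σ n, hσ n, hσ0 n, hσ1 n⟩
        exact Or.inr (ih.elim (fun h => h ▸ hn) fun h => h.trans hn)
    have h2 : s n = σ n t ∨ C.CausallyPrecedes (s n) (σ n t) := by
      rcases ht.1.eq_or_lt with rfl | h0
      · exact Or.inl (hσ0 n).symm
      · have := ((hσ n).mono (Icc_subset_Icc_right ht.2.le)).causallyPrecedes h0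
        rw [hσ0] at this
        exact Or.inr this
    rcases key n with h1 | h1 <;> rcases h2 with h2 | h2
    · exact Or.inl ⟨1, by simp, by rw [← hs0, h1, h2]; exact hit⟩
    · exact Or.inr (Or.inl ⟨_, hit, by rw [← hs0, h1]; exact h2⟩)
    · exact Or.inr (Or.inl ⟨_, hit, by rw [← hs0, ← h2]; exact h1⟩)
    · exact Or.inr (Or.inl ⟨_, hit, by rw [← hs0]; exact h1.trans h2⟩)
  · rw [hδn] at hit
    have key : ∀ n : ℕ, p n = p 0 ∨ C.CausallyPrecedes (p n) (p 0) := by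
      intro n
      induction n with
      | zero => exact Or.inl rfl
      | succ n ih =>
        have hn : C.CausallyPrecedes (p (n + 1)) (p n) := ⟨τ n, hτ n, hτ0 n, hτ1 n⟩
        exact Or.inr (ih.elim (fun h => h ▸ hn) fun h => hn.trans h)
    have h2 : C.CausallyPrecedes (τ n t) (p n) := by
      have := ((hτ n).mono (Icc_subset_Icc_left ht.1)).causallyPrecedes ht.2
      rwa [hτ1] at this
    refine Or.inr (Or.inr ⟨_, hit, ?_⟩)
    rw [← hp0]
    exact (key n).elim (fun h => h ▸ h2) fun h => h2.trans h

end IsCauchySurface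

end ChronalConeBundle

end Splitting

/-! ### Supports and Cauchy surfaces -/

section Supports

variable {m : ℕ} {M : Type*} [TopologicalSpace M] [ChartedSpace (Eu (m + 1)) M]
  [IsManifold (𝓡 (m + 1)) ∞ M]

namespace ChronalConeBundle

variable {C : ChronalConeBundle m M} {e : OpenPartialHomeomorph M (Eu (m + 1))}

/-- Near a point of a chart the cones contain a common open ball of vectors. -/
theorem exists_ball_coordCone (C : ChronalConeBundle m M) (he : IsSmoothChart e)
    {u : Eu (m + 1)} (hu : u ∈ e.target) :
    ∃ v : Eu (m + 1), ∃ ε > 0, ∃ δ > 0, ‖v‖ ≤ δ ∧ Metric.closedBall u δ ⊆ e.target ∧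
      ∀ u' ∈ Metric.closedBall u δ, ∀ w ∈ Metric.ball v ε, w ∈ C.coordCone e u' := by
  obtain ⟨v, ε, c, l, δ, hε, hδ, hB, hK, -⟩ := (coneField C he).exists_ball hu
  -- Rescaling the timelike vector by `r` makes displacements by it stay in the ball of radius `δ`.
  obtain ⟨r, hr, hrv⟩ : ∃ r : ℝ, 0 < r ∧ r * ‖v‖ ≤ δ :=
    ⟨δ / (‖v‖ + 1), by positivity, by
      rw [div_mul_eq_mul_div, div_le_iff₀ (by positivity)]
      nlinarith [norm_nonneg v]⟩
  refine ⟨r • v, r * ε, by positivity, δ, hδ, by rwa [norm_smul, Real.norm_of_nonneg hr.le], hB,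
    fun u' hu' w hw => ?_⟩
  have h1 : r⁻¹ • w ∈ Metric.ball v ε := by
    rw [mem_ball_iff_norm] at hw ⊢
    have : r⁻¹ • w - v = r⁻¹ • (w - r • v) := by
      rw [smul_sub, smul_smul, inv_mul_cancel₀ hr.ne', one_smul]
    rw [this, norm_smul, Real.norm_of_nonneg (inv_nonneg.2 hr.le), inv_mul_lt_iff₀ hr]
    exact hw
  have := (coneField C he).smul_mem _ (hB hu') _ (hK u' hu' _ h1) _ hr
  rwa [smul_smul, mul_inv_cancel₀ hr.ne', one_smul] at this

/-- The curve is a coordinate line in a direction `v` interior to all cones nearby. So each later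
point of it is preceded by a whole neighbourhood of `x`, and each earlier point precedes one. This
is the source of the openness of the past and the future of a Cauchy surface. -/
theorem exists_curve (C : ChronalConeBundle m M) (x : M) :
    ∃ γ : ℝ → M, γ 0 = x ∧ C.IsCausalCurveOn γ (Icc 0 1) ∧ C.IsCausalCurveOn γ (Icc (-1) 0) ∧
      (∀ t ∈ Ioc (0 : ℝ) 1, ∀ᶠ x' in 𝓝 x, C.CausallyPrecedes x' (γ t)) ∧
      ∀ t ∈ Ico (-1 : ℝ) 0, ∀ᶠ x' in 𝓝 x, C.CausallyPrecedes (γ t) x' := by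
  set e := chartAt (Eu (m + 1)) x with he_def
  have he : IsSmoothChart e := isSmoothChart_chartAt x
  have hx : x ∈ e.source := mem_chart_source _ x
  obtain ⟨v, ε, hε, δ, hδ, hvδ, hB, hK⟩ := C.exists_ball_coordCone he (e.map_source hx)
  have hmem : ∀ t : ℝ, |t| ≤ 1 → e x + t • v ∈ Metric.closedBall (e x) δ := fun t ht => by
    rw [mem_closedBall_iff_norm, add_sub_cancel_left, norm_smul, Real.norm_eq_abs]
    exact (mul_le_of_le_one_left (norm_nonneg v) ht).trans hvδ
  have hv : v ∈ Metric.ball v ε := Metric.mem_ball_self hε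
  have hnear : ∀ t : ℝ, 0 < t → ∀ᶠ x' in 𝓝 x, x' ∈ e.source ∧
      e x' ∈ Metric.closedBall (e x) δ ∧
      (∀ u' ∈ Metric.closedBall (e x) δ, e x + t • v - e x' ∈ C.coordCone e u') ∧
      ∀ u' ∈ Metric.closedBall (e x) δ, e x' - (e x - t • v) ∈ C.coordCone e u' := by
    intro t ht
    have hc := (e.continuousAt hx)
    -- The displacement is compared with `v` after division by `t`, which turns an error below `t *
    -- ε` into one below `ε`.
    have h1 : ∀ᶠ x' in 𝓝 x, e x' ∈ Metric.ball (e x) (min δ (t * ε)) :=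
      hc.eventually_mem (Metric.ball_mem_nhds _ (by positivity))
    filter_upwards [h1, e.open_source.mem_nhds hx] with x' h2 h3
    rw [mem_ball_iff_norm, lt_min_iff] at h2
    refine ⟨h3, by rw [mem_closedBall_iff_norm]; exact h2.1.le, fun u' hu' => ?_, fun u' hu' => ?_⟩
    · have : t⁻¹ • (e x + t • v - e x') ∈ Metric.ball v ε := by
        rw [mem_ball_iff_norm]
        have : t⁻¹ • (e x + t • v - e x') - v = -(t⁻¹ • (e x' - e x)) := by
          rw [smul_sub, smul_add, smul_smul, inv_mul_cancel₀ ht.ne', one_smul, smul_sub]; abel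
        rw [this, norm_neg, norm_smul, Real.norm_of_nonneg (inv_nonneg.2 ht.le),
          inv_mul_lt_iff₀ ht]
        exact h2.2
      have := (coneField C he).smul_mem _ (hB hu') _ (hK u' hu' _ this) _ ht
      rwa [smul_smul, mul_inv_cancel₀ ht.ne', one_smul] at this
    · have : t⁻¹ • (e x' - (e x - t • v)) ∈ Metric.ball v ε := by
        rw [mem_ball_iff_norm]
        have : t⁻¹ • (e x' - (e x - t • v)) - v = t⁻¹ • (e x' - e x) := by
          rw [smul_sub, smul_sub, smul_smul, inv_mul_cancel₀ ht.ne', one_smul, smul_sub]; abel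
        rw [this, norm_smul, Real.norm_of_nonneg (inv_nonneg.2 ht.le),
          inv_mul_lt_iff₀ ht]
        exact h2.2
      have := (coneField C he).smul_mem _ (hB hu') _ (hK u' hu' _ this) _ ht
      rwa [smul_smul, mul_inv_cancel₀ ht.ne', one_smul] at this
  have hseg : ∀ a b : ℝ, |a| ≤ 1 → |b| ≤ 1 → b - a = 1 →
      C.IsCausalCurveOn (fun t => e.symm (e x + t • v)) (Icc a b) := by
    intro a b ha hb hab
    have h1 := isCausalCurveOn_segment (C := C) he hB (convex_closedBall (e x) δ) (hmem a ha)
      (hmem b hb) fun u hu => by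
        rw [add_sub_add_left_eq_sub, ← sub_smul, hab, one_smul]
        exact hK u hu v hv
    refine (h1.comp_affine one_pos (by ring : (1 : ℝ) * a + -a = 0)
      (by linarith : (1 : ℝ) * b + -a = 1)).congr fun t ht => ?_
    simp only [AffineMap.lineMap_apply_module]
    congr 1
    have hb' : b = 1 + a := by linarith
    subst hb'
    module
  refine ⟨fun t => e.symm (e x + t • v), by simp [e.left_inv hx],
    hseg 0 1 (by simp) (by simp) (by simp), hseg (-1) 0 (by simp) (by simp) (by simp),
    fun t ht => ?_, fun t ht => ?_⟩
  · filter_upwards [hnear t ht.1] with x' ⟨h1, h2, h3, h4⟩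
    have := precedes_segment he hB (convex_closedBall (e x) δ) h2
      (hmem t (by rw [abs_of_pos ht.1]; exact ht.2)) h3
    rwa [e.left_inv h1] at this
  · filter_upwards [hnear (-t) (neg_pos.2 ht.2)] with x' ⟨h1, h2, h3, h4⟩
    have := precedes_segment he hB (convex_closedBall (e x) δ)
      (hmem t (by rw [abs_of_neg ht.2]; linarith [ht.1])) h2
      (fun u' hu' => by have := h4 u' hu'; rwa [neg_smul, sub_neg_eq_add] at this)
    rwa [e.left_inv h1] at this

/-- A smooth timelike curve through a point, parametrized by an arbitrary base time. -/
theorem precedes_sin (he : IsSmoothChart e) {u v : Eu (m + 1)} {δ : ℝ} (hvδ : ‖v‖ ≤ δ)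
    (hB : Metric.closedBall u δ ⊆ e.target)
    (hK : ∀ u' ∈ Metric.closedBall u δ, v ∈ C.coordCone e u') {a τ : ℝ} (ha : a ∈ Icc (0 : ℝ) 1)
    (hτ : 0 < τ) (hτ1 : τ ≤ 1) :
    C.Precedes (e.symm (u + (τ * Real.sin (0 - a)) • v))
      (e.symm (u + (τ * Real.sin (1 - a)) • v)) := by
  -- The curve has to be smooth on the whole line and to stay in the chart. The sine is bounded by
  -- one, and it increases for `|t - a| ≤ 1 < π / 2`.
  set σ : ℝ → Eu (m + 1) := fun t => u + (τ * Real.sin (t - a)) • v with hσ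
  have hmem : ∀ t, σ t ∈ Metric.closedBall u δ := fun t => by
    rw [mem_closedBall_iff_norm, add_sub_cancel_left, norm_smul, Real.norm_eq_abs, abs_mul,
      abs_of_pos hτ]
    exact (mul_le_of_le_one_left (norm_nonneg v)
      (mul_le_one₀ hτ1 (abs_nonneg _) (Real.abs_sin_le_one _))).trans hvδ
  have hd : ∀ t, HasDerivAt σ ((τ * Real.cos (t - a)) • v) t := fun t => by
    have := ((((Real.hasDerivAt_sin (t - a)).comp t ((hasDerivAt_id t).sub_const a)).const_mul
      τ).smul_const v).const_add u
    rw [mul_one] at this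
    exact this
  have hs : ContDiff ℝ ∞ σ := by
    have h1 : ContDiff ℝ ∞ fun t : ℝ => Real.sin (t - a) :=
      Real.contDiff_sin.comp (contDiff_id.sub contDiff_const)
    exact contDiff_const.add ((contDiff_const.mul h1).smul contDiff_const)
  refine ⟨fun t => e.symm (σ t), ?_, rfl, rfl, fun t ht => ?_⟩
  · rw [← contMDiffOn_univ]
    exact he.contMDiffOn_symm.comp hs.contMDiff.contMDiffOn fun t _ => hB (hmem t)
  · have h1 : MDifferentiableAt (𝓡 (m + 1)) (𝓡 (m + 1)) e.symm (σ t) :=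
      he.mdifferentiable.mdifferentiableAt_symm (hB (hmem t))
    have h2 : HasMFDerivAt 𝓘(ℝ, ℝ) (𝓡 (m + 1)) σ t
        (ContinuousLinearMap.toSpanSingleton ℝ ((τ * Real.cos (t - a)) • v)) :=
      (hd t).hasFDerivAt.hasMFDerivAt
    have h3 := (h1.hasMFDerivAt.comp t h2).mfderiv
    have h4 : mfderiv 𝓘(ℝ, ℝ) (𝓡 (m + 1)) (fun t => e.symm (σ t)) t (1 : ℝ) =
        symmD e (σ t) ((τ * Real.cos (t - a)) • v) := by
      refine (DFunLike.congr_fun h3 (1 : ℝ)).trans ?_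
      change symmD e (σ t) ((1 : ℝ) • ((τ * Real.cos (t - a)) • v)) = _
      rw [one_smul]
    have h5 : 0 < τ * Real.cos (t - a) := mul_pos hτ (Real.cos_pos_of_mem_Ioo
      ⟨by linarith [ht.1, ha.2, Real.pi_gt_three], by linarith [ht.2, ha.1, Real.pi_gt_three]⟩)
    have h6 := (coneField C he).smul_mem _ (hB (hmem t)) _ (hK _ (hmem t)) _ h5
    change mfderiv 𝓘(ℝ, ℝ) (𝓡 (m + 1)) (fun t => e.symm (σ t)) t (1 : ℝ) ∈ C.cone (e.symm (σ t))
    rw [h4]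
    exact h6

/-- A point need not lie in its own chronological future, but short timelike curves from it end
arbitrarily close to it. This makes compact supports both retarded and advanced. -/
theorem mem_closure_influence_self (C : ChronalConeBundle m M) (x : M) :
    x ∈ closure (C.future {x}) ∧ x ∈ closure (C.past {x}) := by
  set e := chartAt (Eu (m + 1)) x with he_def
  have he : IsSmoothChart e := isSmoothChart_chartAt x
  have hx : x ∈ e.source := mem_chart_source _ x
  obtain ⟨v, ε, hε, δ, hδ, hvδ, hB, hK⟩ := C.exists_ball_coordCone he (e.map_source hx)
  have hv : ∀ u' ∈ Metric.closedBall (e x) δ, v ∈ C.coordCone e u' := fun u' hu' =>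
    hK u' hu' v (Metric.mem_ball_self hε)
  have hlim : ∀ c : ℝ, Tendsto (fun τ : ℝ => e.symm (e x + (τ * c) • v)) (𝓝[>] 0) (𝓝 x) := by
    intro c
    have h1 : ContinuousAt (fun τ : ℝ => e x + (τ * c) • v) 0 := by fun_prop
    have h2 : ContinuousAt e.symm (e x + ((0 : ℝ) * c) • v) := by
      rw [zero_mul, zero_smul, add_zero]; exact e.continuousAt_symm (e.map_source hx)
    have h3 : Tendsto (fun τ : ℝ => e.symm (e x + (τ * c) • v)) (𝓝 0)
      (𝓝 (e.symm (e x + ((0 : ℝ) * c) • v))) := ContinuousAt.comp (f := fun τ : ℝ => e x + (τ * c) • v) h2 h1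
    rw [zero_mul, zero_smul, add_zero, e.left_inv hx] at h3
    exact h3.mono_left nhdsWithin_le_nhds
  have hev : ∀ᶠ τ : ℝ in 𝓝[>] 0, 0 < τ ∧ τ ≤ 1 :=
    (eventually_mem_nhdsWithin (s := Ioi (0:ℝ))).and (nhdsWithin_le_nhds (Iic_mem_nhds one_pos))
  constructor
  · refine mem_closure_of_tendsto (hlim (Real.sin (1 - 0))) (hev.mono fun τ hτ => ⟨x, rfl, ?_⟩)
    have := precedes_sin he hvδ hB hv (a := 0) (by simp) hτ.1 hτ.2
    rwa [sub_zero, Real.sin_zero, mul_zero, zero_smul, add_zero, e.left_inv hx] at this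
  · refine mem_closure_of_tendsto (hlim (Real.sin (0 - 1))) (hev.mono fun τ hτ => ⟨x, rfl, ?_⟩)
    have := precedes_sin he hvδ hB hv (a := 1) (by simp) hτ.1 hτ.2
    rwa [sub_self, Real.sin_zero, mul_zero, zero_smul, add_zero, e.left_inv hx] at this

theorem subset_closure_future (C : ChronalConeBundle m M) (K : Set M) :
    K ⊆ closure (C.future K) := fun x hx =>
  closure_mono (by rintro y ⟨_, rfl, h⟩; exact ⟨_, hx, h⟩) (C.mem_closure_influence_self x).1

theorem subset_closure_past (C : ChronalConeBundle m M) (K : Set M) :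
    K ⊆ closure (C.past K) := fun x hx =>
  closure_mono (by rintro y ⟨_, rfl, h⟩; exact ⟨_, hx, h⟩) (C.mem_closure_influence_self x).2

theorem _root_.IsCompact.isRetarded {A : Set M} (hA : IsCompact A) : C.IsRetarded A :=
  ⟨A, hA, C.subset_closure_future A⟩

theorem _root_.IsCompact.isAdvanced {A : Set M} (hA : IsCompact A) : C.IsAdvanced A :=
  ⟨A, hA, C.subset_closure_past A⟩

variable {S : Set M}

variable [ChartedSpace (Eu m) S]

namespace IsCauchySurface

theorem disjoint_strictPast (hS : C.IsCauchySurface S) : Disjoint (C.strictPast S) S :=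
  disjoint_left.2 fun x ⟨s, hs, h⟩ hx => hS.acausal x hx s hs h

theorem disjoint_strictFuture (hS : C.IsCauchySurface S) : Disjoint (C.strictFuture S) S :=
  disjoint_left.2 fun x ⟨s, hs, h⟩ hx => hS.acausal s hs x hx h

theorem disjoint_strictPast_strictFuture (hS : C.IsCauchySurface S) :
    Disjoint (C.strictPast S) (C.strictFuture S) :=
  disjoint_left.2 fun _ ⟨s, hs, h⟩ ⟨s', hs', h'⟩ => hS.acausal s' hs' s hs (h'.trans h)

variable [T2Space M] [SecondCountableTopology M]

/-- A timelike curve from `p`, made inextensible, meets `S`, but neither at `p` nor before it. So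
some later `γ t` is still in `S` or in its past, and a whole neighbourhood of `p` precedes `γ t`. -/
theorem isOpen_strictPast (hS : C.IsCauchySurface S) : IsOpen (C.strictPast S) := by
  rw [isOpen_iff_mem_nhds]
  intro p hp
  obtain ⟨γ, h0, h1, -, h2, -⟩ := C.exists_curve p
  have key : ∃ t ∈ Ioc (0 : ℝ) 1, γ t ∈ S ∪ C.strictPast S := by
    rcases hS.meets_through h1 with ⟨t, ht, hts⟩ | h | h
    · refine ⟨t, ⟨ht.1.lt_of_ne ?_, ht.2⟩, Or.inl hts⟩
      rintro rfl
      exact hS.disjoint_strictPast.le_bot ⟨hp, by rwa [h0] at hts⟩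
    · exact ⟨1, by simp, Or.inr h⟩
    · rw [h0] at h
      exact (hS.disjoint_strictPast_strictFuture.le_bot ⟨hp, h⟩).elim
  obtain ⟨t, ht, hq⟩ := key
  filter_upwards [h2 t ht] with x' hx'
  rcases hq with hq | ⟨s, hs, hq⟩
  · exact ⟨_, hq, hx'⟩
  · exact ⟨s, hs, hx'.trans hq⟩

theorem isOpen_strictFuture (hS : C.IsCauchySurface S) : IsOpen (C.strictFuture S) := by
  rw [isOpen_iff_mem_nhds]
  intro p hp
  obtain ⟨γ, h0, -, h1, -, h2⟩ := C.exists_curve p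
  have h1' := h1.comp_affine one_pos (by norm_num : (1 : ℝ) * 0 + -1 = -1)
    (by norm_num : (1 : ℝ) * 1 + -1 = 0)
  have key : ∃ t ∈ Ico (-1 : ℝ) 0, γ t ∈ S ∪ C.strictFuture S := by
    rcases hS.meets_through h1' with ⟨t, ht, hts⟩ | h | h
    · refine ⟨1 * t + -1, ⟨by linarith [ht.1], lt_of_le_of_ne (by linarith [ht.2]) ?_⟩, Or.inl hts⟩
      intro hz
      exact hS.disjoint_strictFuture.le_bot ⟨hp, by rwa [hz, h0] at hts⟩
    · rw [show (1 : ℝ) * 1 + -1 = 0 by norm_num, h0] at h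
      exact (hS.disjoint_strictPast_strictFuture.le_bot ⟨h, hp⟩).elim
    · exact ⟨-1, by simp, Or.inr (by simpa using h)⟩
  obtain ⟨t, ht, hq⟩ := key
  filter_upwards [h2 t ht] with x' hx'
  rcases hq with hq | ⟨s, hs, hq⟩
  · exact ⟨_, hq, hx'⟩
  · exact ⟨s, hs, hq.trans hx'⟩

/-- Acausality makes the three pieces disjoint, `meets_through` shows that they cover, and
`meets_of_chain` makes divergent chains cross `S`. -/
theorem causalSplitting (hS : C.IsCauchySurface S) :
    CausalSplitting C.CausallyPrecedes (C.strictPast S) S (C.strictFuture S) where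
  trans _ _ _ := CausallyPrecedes.trans
  isOpen_past := hS.isOpen_strictPast
  isOpen_future := hS.isOpen_strictFuture
  cover x := by
    obtain ⟨γ, h0, h1, h1', -, -⟩ := C.exists_curve x
    rcases hS.meets_through h1 with ⟨t, ht, hts⟩ | ⟨s, hs, h⟩ | h
    · rcases ht.1.eq_or_lt with rfl | h
      · rw [h0] at hts; exact Or.inr (Or.inl hts)
      · have := (h1.mono (Icc_subset_Icc_right ht.2)).causallyPrecedes h
        rw [h0] at this
        exact Or.inl ⟨_, hts, this⟩
    · have := h1.causallyPrecedes one_pos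
      rw [h0] at this
      exact Or.inl ⟨s, hs, this.trans h⟩
    · rw [h0] at h; exact Or.inr (Or.inr h)
  disjoint_past := hS.disjoint_strictPast
  disjoint_future := hS.disjoint_strictFuture
  disjoint := hS.disjoint_strictPast_strictFuture
  future_mem x y hxy hx := by
    rcases hx with ⟨s, hs, h⟩ | hx
    · exact ⟨s, hs, h.trans hxy⟩
    · exact ⟨x, hx, hxy⟩
  past_mem x y hxy hy := by
    rcases hy with ⟨s, hs, h⟩ | hy
    · exact ⟨s, hs, hxy.trans h⟩
    · exact ⟨y, hy, hxy⟩
  chain p hp htop hbot := by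
    choose γ hγ hγ0 hγ1 using hp
    obtain ⟨i, t, ht, hit⟩ := hS.meets_of_chain γ hγ (fun i => by rw [hγ1, hγ0])
      (by simpa only [hγ0] using htop) (by simpa only [hγ0] using hbot)
    constructor
    -- The meeting point may be the vertex `p i` itself; one step back the chain is strictly to the
    -- past of it.
    · refine ⟨i - 1, γ i t, hit, ?_⟩
      have h1 : C.CausallyPrecedes (p (i - 1)) (p i) :=
        ⟨γ (i - 1), hγ _, hγ0 _, by rw [hγ1]; simp⟩
      rcases ht.1.eq_or_lt with rfl | h
      · rwa [hγ0]
      · have := ((hγ i).mono (Icc_subset_Icc_right ht.2.le)).causallyPrecedes h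
        rw [hγ0] at this
        exact h1.trans this
    · refine ⟨i + 1, γ i t, hit, ?_⟩
      have := ((hγ i).mono (Icc_subset_Icc_left ht.1)).causallyPrecedes ht.2
      rwa [hγ1] at this
  ball := C.hasCausalBalls

theorem isClosed (hS : C.IsCauchySurface S) : IsClosed S :=
  hS.causalSplitting.isClosed_surface

theorem exists_compact_retarded (hS : C.IsCauchySurface S) {A : Set M} (hA : C.IsRetarded A) :
    ∃ Q, IsCompact Q ∧ A ∩ (C.strictPast S ∪ S) ⊆ Q := by
  obtain ⟨K, hK, hKA⟩ := hA
  obtain ⟨Q, hQ, h⟩ := hS.causalSplitting.exists_compact_closure_future_inter hK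
  refine ⟨Q, hQ, fun x hx => h ⟨closure_mono ?_ (hKA hx.1), hx.2⟩⟩
  rintro y ⟨k, hk, hky⟩
  exact ⟨k, hk, hky.causallyPrecedes⟩

theorem exists_compact_advanced (hS : C.IsCauchySurface S) {A : Set M} (hA : C.IsAdvanced A) :
    ∃ Q, IsCompact Q ∧ A ∩ (C.strictFuture S ∪ S) ⊆ Q := by
  obtain ⟨K, hK, hKA⟩ := hA
  obtain ⟨Q, hQ, h⟩ := hS.causalSplitting.swap.exists_compact_closure_future_inter hK
  refine ⟨Q, hQ, fun x hx => h ⟨closure_mono ?_ (hKA hx.1), hx.2⟩⟩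
  rintro y ⟨k, hk, hky⟩
  exact ⟨k, hk, hky.causallyPrecedes⟩

/-- The future part is compact on the past side of `S` and the past part on its future side; `S`
belongs to both. -/
theorem exists_compact_spacelikeCompact (hS : C.IsCauchySurface S) {A : Set M}
    (hA : C.IsSpacelikeCompact A) : ∃ Q, IsCompact Q ∧ A ∩ S ⊆ Q := by
  obtain ⟨K, hK, hKA⟩ := hA
  obtain ⟨Q, hQ, h⟩ := hS.exists_compact_retarded (A := closure (C.future K)) ⟨K, hK, le_rfl⟩
  obtain ⟨Q', hQ', h'⟩ := hS.exists_compact_advanced (A := closure (C.past K)) ⟨K, hK, le_rfl⟩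
  refine ⟨Q ∪ Q' ∪ K, (hQ.union hQ').union hK, fun x hx => ?_⟩
  have := hKA hx.1
  rw [influence, closure_union, closure_union, hK.isClosed.closure_eq] at this
  rcases this with (h1 | h1) | h1
  · exact Or.inl (Or.inl (h ⟨h1, Or.inr hx.2⟩))
  · exact Or.inl (Or.inr (h' ⟨h1, Or.inr hx.2⟩))
  · exact Or.inr h1

end IsCauchySurface

end ChronalConeBundle

end Supports

/-! ### Forms in charts -/

section AlternatingCalculus

variable {E E' : Type*} [NormedAddCommGroup E] [NormedSpace ℝ E] [NormedAddCommGroup E']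
  [NormedSpace ℝ E'] {n k : ℕ}

/-- Evaluation on all tuples of basis vectors is an injective linear map into a finite-dimensional
space, so it has a linear left inverse. -/
theorem contDiffAt_alternating {r : WithTop ℕ∞} {f : E → Eu n [⋀^Fin k]→L[ℝ] ℝ} {x : E}
    (h : ∀ v, ContDiffAt ℝ r (fun u => f u v) x) : ContDiffAt ℝ r f x := by
  let b := (EuclideanSpace.basisFun (Fin n) ℝ).toBasis
  let Φ : (Eu n [⋀^Fin k]→L[ℝ] ℝ) →ₗ[ℝ] ((Fin k → Fin n) → ℝ) :=
    { toFun := fun η i => η fun j => b (i j)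
      map_add' := fun _ _ => rfl
      map_smul' := fun _ _ => rfl }
  have hΦ : LinearMap.ker Φ = ⊥ := by
    rw [LinearMap.ker_eq_bot]
    intro η θ hηθ
    apply ContinuousAlternatingMap.toAlternatingMap_injective
    exact AlternatingMap.coe_multilinearMap_injective (Module.Basis.ext_multilinear (fun _ => b) fun i => congrFun hηθ i)
  obtain ⟨g, hg⟩ := Φ.exists_leftInverse_of_injective hΦ
  have h1 : f = fun u => LinearMap.toContinuousLinearMap g (Φ (f u)) := by
    funext u
    exact (LinearMap.congr_fun hg (f u)).symm
  rw [h1]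
  exact (LinearMap.toContinuousLinearMap g).contDiff.contDiffAt.comp x
    (contDiffAt_pi.2 fun i => h _)

/-- Expanding the vectors in the standard basis gives a polynomial in their coordinates whose
coefficients are values of `f u` on fixed vectors. -/
theorem contDiffAt_alternating_apply {r : WithTop ℕ∞} {f : E → Eu n [⋀^Fin k]→L[ℝ] ℝ}
    {v : E → Fin k → Eu n} {x : E} (hf : ContDiffAt ℝ r f x)
    (hv : ∀ i, ContDiffAt ℝ r (fun u => v u i) x) : ContDiffAt ℝ r (fun u => f u (v u)) x := by
  let b := (EuclideanSpace.basisFun (Fin n) ℝ)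
  have h1 : (fun u => f u (v u)) = fun u => ∑ j : Fin k → Fin n,
      (∏ i, v u i (j i)) * f u fun i => b (j i) := by
    funext u
    have h2 : v u = fun i => ∑ j, v u i j • b j := by
      funext i
      simpa [b] using (b.sum_repr (v u i)).symm
    conv_lhs => rw [h2]
    have := (f u).toMultilinearMap.map_sum (fun i j => v u i j • b j)
    refine this.trans (Finset.sum_congr rfl fun j _ => ?_)
    exact ((f u).toMultilinearMap.map_smul_univ (fun i => v u i (j i)) fun i => b (j i))
  rw [h1]
  refine ContDiffAt.sum fun j _ => ContDiffAt.mul (contDiffAt_prod fun i _ => ?_) ?_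
  · exact (EuclideanSpace.proj (j i) : Eu n →L[ℝ] ℝ).contDiff.contDiffAt.comp x (hv i)
  · exact ((ContinuousAlternatingMap.apply ℝ (Eu n) ℝ fun i => b (j i))).contDiff.contDiffAt.comp x hf

theorem contDiffAt_pullback {l : ℕ} {η : Eu n → Eu n [⋀^Fin k]→L[ℝ] ℝ} {τ : Eu l → Eu n} {x : Eu l}
    (hη : ContDiffAt ℝ ∞ η (τ x)) (hτ : ContDiffAt ℝ ∞ τ x) :
    ContDiffAt ℝ ∞ (fun u => (η (τ u)).compContinuousLinearMap (fderiv ℝ τ u)) x := by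
  refine contDiffAt_alternating fun v => ?_
  have h1 : ContDiffAt ℝ ∞ (fun u => η (τ u)) x := hη.comp x hτ
  have h2 : ContDiffAt ℝ ∞ (fun u => fderiv ℝ τ u) x := hτ.fderiv_right (m := ∞) (by simp)
  exact contDiffAt_alternating_apply (v := fun u i => fderiv ℝ τ u (v i)) h1 fun i =>
    h2.clm_apply contDiffAt_const

end AlternatingCalculus

/-! ### Coordinate expressions of forms under change of chart -/

section FormCharts

variable {n : ℕ} {N : Type*} [TopologicalSpace N] [ChartedSpace (Eu n) N]
  {n' : ℕ} {N' : Type*} [TopologicalSpace N'] [ChartedSpace (Eu n') N']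
  {e e' : OpenPartialHomeomorph N (Eu n)} {ψ : OpenPartialHomeomorph N' (Eu n')} {k : ℕ}

/-- The coordinate expression of a form in a chart. -/
def Form.coord (θ : Form n N k) (e : OpenPartialHomeomorph N (Eu n)) (u : Eu n) :
    Eu n [⋀^Fin k]→L[ℝ] ℝ :=
  (θ (e.symm u)).compContinuousLinearMap (symmD e u)

/-- All tangent spaces are the model space by definition, so values of a form at propositionally
equal points can be compared on vectors of the model space. -/
theorem Form.apply_congr (θ : Form n N k) {x y : N} (h : x = y) {v w : Fin k → Eu n} (hvw : v = w) :
    (θ x : (Fin k → Eu n) → ℝ) v = (θ y : (Fin k → Eu n) → ℝ) w := by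
  subst h hvw; rfl

/-- The derivative of a map in charts. -/
theorem IsSmoothChart.symmD_map (hψ : IsSmoothChart ψ) (he : IsSmoothChart e) {F : N' → N}
    {u : Eu n'} (hu : u ∈ ψ.target) (hF : MDifferentiableAt (𝓡 n') (𝓡 n) F (ψ.symm u))
    (hu' : F (ψ.symm u) ∈ e.source) (v : Eu n') :
    (symmD e ((e ∘ F ∘ ψ.symm) u) (fderiv ℝ (e ∘ F ∘ ψ.symm) u v) : Eu n) =
      mfderiv (𝓡 n') (𝓡 n) F (ψ.symm u) (symmD ψ u v) := by
  have h0 : MDifferentiableAt (𝓡 n') (𝓡 n') ψ.symm u :=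
    hψ.mdifferentiable.mdifferentiableAt_symm hu
  have h1 : MDifferentiableAt (𝓡 n') (𝓡 n) (F ∘ ψ.symm) u := hF.comp u h0
  have h2 : MDifferentiableAt (𝓡 n) (𝓡 n) e (F (ψ.symm u)) :=
    he.mdifferentiable.mdifferentiableAt hu'
  have h3 : MDifferentiableAt (𝓡 n') (𝓡 n) (e ∘ F ∘ ψ.symm) u := h2.comp u h1
  have h4 : MDifferentiableAt (𝓡 n) (𝓡 n) e.symm ((e ∘ F ∘ ψ.symm) u) :=
    he.mdifferentiable.mdifferentiableAt_symm (e.map_source hu')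
  have h5 : (e.symm ∘ e ∘ F ∘ ψ.symm) =ᶠ[𝓝 u] F ∘ ψ.symm := by
    filter_upwards [h1.continuousAt.preimage_mem_nhds (e.open_source.mem_nhds hu')] with w hw
    exact e.left_inv hw
  have h6 := (h4.hasMFDerivAt.comp u h3.hasMFDerivAt).congr_of_eventuallyEq h5.symm
  have h7 := hasMFDerivAt_unique h6 (hF.hasMFDerivAt.comp u h0.hasMFDerivAt)
  have h8 := DFunLike.congr_fun h7 v
  rw [mfderiv_eq_fderiv] at h8
  exact h8

theorem Form.coord_pullback (hψ : IsSmoothChart ψ) (he : IsSmoothChart e) {F : N' → N}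
    (θ : Form n N k) {u : Eu n'} (hu : u ∈ ψ.target)
    (hF : MDifferentiableAt (𝓡 n') (𝓡 n) F (ψ.symm u)) (hu' : F (ψ.symm u) ∈ e.source) :
    (Form.pullback F θ).coord ψ u =
      (θ.coord e ((e ∘ F ∘ ψ.symm) u)).compContinuousLinearMap (fderiv ℝ (e ∘ F ∘ ψ.symm) u) := by
  ext v
  refine (θ.apply_congr (e.left_inv hu').symm (funext fun i => ?_))
  exact (hψ.symmD_map he hu hF hu' (v i)).symm

theorem Form.coord_transition (he : IsSmoothChart e) (he' : IsSmoothChart e') (θ : Form n N k)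
    {u : Eu n} (hu : u ∈ e.target) (hu' : e.symm u ∈ e'.source) :
    θ.coord e u =
      (θ.coord e' ((e' ∘ e.symm) u)).compContinuousLinearMap (fderiv ℝ (e' ∘ e.symm) u) := by
  ext v
  refine (θ.apply_congr (e'.left_inv hu').symm (funext fun i => ?_))
  exact (he.symmD_transition he' hu hu' (v i)).symm

omit [ChartedSpace (Eu n) N] in
theorem eventually_transition {u : Eu n} (hu : u ∈ e.target) (hu' : e.symm u ∈ e'.source) :
    ∀ᶠ w in 𝓝 u, w ∈ e.target ∧ e.symm w ∈ e'.source :=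
  (IsSmoothChart.isOpen_transition e e').mem_nhds ⟨hu, hu'⟩

theorem Form.contDiffAt_coord_of (he : IsSmoothChart e) (he' : IsSmoothChart e') {θ : Form n N k}
    {u : Eu n} (hu : u ∈ e.target) (hu' : e.symm u ∈ e'.source)
    (h : ContDiffAt ℝ ∞ (θ.coord e') (e' (e.symm u))) : ContDiffAt ℝ ∞ (θ.coord e) u :=
  (contDiffAt_pullback (τ := e' ∘ e.symm) h (he.contDiffAt_transition he' hu hu')).congr_of_eventuallyEq
    ((eventually_transition hu hu').mono fun _ hw => θ.coord_transition he he' hw.1 hw.2)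

variable [IsManifold (𝓡 n) ∞ N]

/-- Smoothness at `u` follows from smoothness at the centre of the preferred chart of the point with
coordinates `u`. -/
theorem Form.isSmooth_iff {θ : Form n N k} : θ.IsSmooth ↔
    ∀ x : N, ContDiffAt ℝ ∞ (θ.coord (chartAt (Eu n) x)) (chartAt (Eu n) x x) := by
  constructor
  · intro h x
    have h1 := h x
    rw [show (extChartAt (𝓡 n) x).target = (chartAt (Eu n) x).target by simp] at h1
    exact h1.contDiffAt ((chartAt (Eu n) x).open_target.mem_nhds (mem_chart_target _ _))
  · intro h x u hu
    rw [show (extChartAt (𝓡 n) x).target = (chartAt (Eu n) x).target by simp] at hu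
    exact (Form.contDiffAt_coord_of (isSmoothChart_chartAt x) (isSmoothChart_chartAt _) hu
      (mem_chart_source _ _) (h _)).contDiffWithinAt

theorem Form.IsSmooth.contDiffAt_coord {θ : Form n N k} (hθ : θ.IsSmooth) (he : IsSmoothChart e)
    {u : Eu n} (hu : u ∈ e.target) : ContDiffAt ℝ ∞ (θ.coord e) u :=
  Form.contDiffAt_coord_of he (isSmoothChart_chartAt _) hu (mem_chart_source _ _)
    (Form.isSmooth_iff.1 hθ _)

theorem Form.isSmooth_of_charts {θ : Form n N k} (h : ∀ x : N, ∃ e : OpenPartialHomeomorph N (Eu n),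
    IsSmoothChart e ∧ x ∈ e.source ∧ ContDiffAt ℝ ∞ (θ.coord e) (e x)) : θ.IsSmooth := by
  rw [Form.isSmooth_iff]
  intro x
  obtain ⟨e, he, hx, h1⟩ := h x
  refine Form.contDiffAt_coord_of (isSmoothChart_chartAt x) he (mem_chart_target _ _) ?_ ?_ <;>
  rwa [(chartAt (Eu n) x).left_inv (mem_chart_source _ _)]

/-- The exterior derivative in an arbitrary chart. -/
theorem Form.coord_d {θ : Form n N k} (hθ : θ.IsSmooth) (he : IsSmoothChart e)
    {u : Eu n} (hu : u ∈ e.target) : (Form.d θ).coord e u = extDeriv (θ.coord e) u := by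
  set x := e.symm u with hx
  set c := chartAt (Eu n) x with hc
  have hcs : IsSmoothChart c := isSmoothChart_chartAt x
  have hxc : x ∈ c.source := mem_chart_source _ _
  have h1 : θ.coord e =ᶠ[𝓝 u] fun w =>
      (θ.coord c ((c ∘ e.symm) w)).compContinuousLinearMap (fderiv ℝ (c ∘ e.symm) w) :=
    (eventually_transition hu hxc).mono fun _ hw => θ.coord_transition he hcs hw.1 hw.2
  have h2 : DifferentiableAt ℝ (θ.coord c) ((c ∘ e.symm) u) :=
    (hθ.contDiffAt_coord hcs (c.map_source hxc)).differentiableAt (by simp)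
  have h4 : MDifferentiableAt (𝓡 n) (𝓡 n) c (e.symm u) := hcs.mdifferentiable.mdifferentiableAt hxc
  have h5 : MDifferentiableAt (𝓡 n) (𝓡 n) e.symm u := he.mdifferentiable.mdifferentiableAt_symm hu
  have h6 : ∀ v, chartD c (e.symm u) (symmD e u v) = fderiv ℝ (c ∘ e.symm) u v := fun v => by
    have := DFunLike.congr_fun (mfderiv_comp u h4 h5) v
    rw [mfderiv_eq_fderiv] at this
    exact this.symm
  -- `Form.d` is computed in the preferred chart at `x`; naturality of `extDeriv` under the
  -- transition map moves it to `e`.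
  rw [h1.extDeriv_eq, extDeriv_pullback h2 (he.contDiffAt_transition hcs hu hxc)
    (by rw [minSmoothness_of_isRCLikeNormedField]; exact WithTop.coe_le_coe.2 le_top)]
  ext v
  change (extDeriv (θ.coord c) (c (e.symm u))) (fun i => chartD c (e.symm u) (symmD e u (v i))) = _
  simp only [h6]
  rfl

end FormCharts

/-! ### Signs of charts and integration of forms in charts -/

section FrameAlgebra

variable {T : Type*} [AddCommGroup T] [Module ℝ T] {k : ℕ}

theorem isPositiveFrame_iff {o : Orientation ℝ T (Fin k)} {θ : T [⋀^Fin k]→ₗ[ℝ] ℝ} (hθ : θ ≠ 0)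
    (h : rayOfNeZero ℝ θ hθ = o) (v : Fin k → T) : IsPositiveFrame o v ↔ 0 < θ v := by
  constructor
  · rintro ⟨η, hη, h1, h2⟩
    rw [← h, ray_eq_iff] at h1
    obtain ⟨r, hr, h3⟩ := h1.exists_pos_left hη hθ
    rw [← h3]
    exact mul_pos hr h2
  · exact fun h1 => ⟨θ, hθ, h, h1⟩

theorem exists_representative (o : Orientation ℝ T (Fin k)) :
    ∃ (θ : T [⋀^Fin k]→ₗ[ℝ] ℝ) (hθ : θ ≠ 0), rayOfNeZero ℝ θ hθ = o := by
  induction o using Module.Ray.ind with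
  | h v hv => exact ⟨v, hv, rfl⟩

theorem alternating_apply_comp (b : Module.Basis (Fin k) ℝ T) (η : T [⋀^Fin k]→ₗ[ℝ] ℝ)
    (A : T →ₗ[ℝ] T) : η (fun i => A (b i)) = LinearMap.det A * η b := by
  rw [η.eq_smul_basis_det b]
  have := b.det_comp A b
  rw [b.det_self, mul_one] at this
  simp only [AlternatingMap.smul_apply, smul_eq_mul, b.det_self, mul_one]
  rw [mul_comm, ← this]
  rfl

/-- On the frame transformed by `A` a representative of the orientation takes `det A` times its
value on the original frame. -/
theorem isPositiveFrame_comp (o : Orientation ℝ T (Fin k)) (b : Module.Basis (Fin k) ℝ T)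
    (B A : T →ₗ[ℝ] T) (hB : LinearMap.det B ≠ 0) (hA : LinearMap.det A ≠ 0) :
    IsPositiveFrame o (fun i => B (A (b i))) ↔
      (0 < LinearMap.det A ↔ IsPositiveFrame o fun i => B (b i)) := by
  obtain ⟨θ, hθ, h⟩ := exists_representative o
  rw [isPositiveFrame_iff hθ h, isPositiveFrame_iff hθ h]
  have h1 := alternating_apply_comp b (θ.compLinearMap B) A
  have h2 := alternating_apply_comp b θ B
  have h3 : θ b ≠ 0 := (AlternatingMap.map_basis_ne_zero_iff b θ).2 hθ
  simp only [AlternatingMap.compLinearMap_apply] at h1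
  rw [h1]
  have h4 : θ (fun i => B (b i)) ≠ 0 := by rw [h2]; exact mul_ne_zero hB h3
  rcases lt_or_gt_of_ne hA with h5 | h5 <;> rcases lt_or_gt_of_ne h4 with h6 | h6
  · simp [h5.not_gt, h6.not_gt, mul_pos_of_neg_of_neg h5 h6]
  · simp [h5.not_gt, h6, (mul_neg_of_neg_of_pos h5 h6).not_gt]
  · simp [h5, h6.not_gt, (mul_neg_of_pos_of_neg h5 h6).not_gt]
  · simp [h5, h6]

end FrameAlgebra

/-! ### Signs of charts and coefficients of forms of top degree -/

section Density

variable {n : ℕ} {N : Type*} [TopologicalSpace N] [ChartedSpace (Eu n) N]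
  {e e' : OpenPartialHomeomorph N (Eu n)} {k : ℕ}

/-- The coordinate frame of a chart. -/
def chartFrame (e : OpenPartialHomeomorph N (Eu n)) (u : Eu n) :
    Fin n → TangentSpace (𝓡 n) (e.symm u) := fun i => symmD e u (EuclideanSpace.single i (1 : ℝ))

/-- The standard basis of the model space. -/
def stdBasis (n : ℕ) : Module.Basis (Fin n) ℝ (Eu n) := (EuclideanSpace.basisFun (Fin n) ℝ).toBasis

theorem stdBasis_apply (n : ℕ) (i : Fin n) : stdBasis n i = EuclideanSpace.single i (1 : ℝ) := by
  simp [stdBasis]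

theorem IsSmoothChart.symmD_injective (he : IsSmoothChart e) {u : Eu n} (hu : u ∈ e.target) :
    Function.Injective (symmD e u) := (he.symmDeriv hu).injective

theorem det_ne_zero_of_injective (A : Eu n →L[ℝ] Eu n) (hA : Function.Injective A) :
    A.det ≠ 0 := by
  intro h
  have := LinearMap.bot_lt_ker_of_det_eq_zero h
  rw [LinearMap.ker_eq_bot.2 (by exact hA)] at this
  exact lt_irrefl _ this

theorem IsSmoothChart.det_transition_ne_zero (he : IsSmoothChart e) (he' : IsSmoothChart e')
    {u : Eu n} (hu : u ∈ e.target) (hu' : e.symm u ∈ e'.source) :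
    (fderiv ℝ (e' ∘ e.symm) u).det ≠ 0 := by
  refine det_ne_zero_of_injective _ fun v w hvw => he.symmD_injective hu ?_
  have h1 := he.symmD_transition he' hu hu' v
  have h2 := he.symmD_transition he' hu hu' w
  rw [hvw] at h1
  exact h1.symm.trans h2

open Classical in
/-- The sign of a chart of an oriented manifold. -/
def ManifoldOrientation.sgn (o : ManifoldOrientation n N) (e : OpenPartialHomeomorph N (Eu n))
    (u : Eu n) : ℝ :=
  if IsPositiveFrame (o.at' (e.symm u)) (chartFrame e u) then 1 else -1

theorem ManifoldOrientation.at_congr (o : ManifoldOrientation n N) {x y : N} (h : x = y) :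
    (o.at' x : Orientation ℝ (Eu n) (Fin n)) = o.at' y := by subst h; rfl

theorem IsSmoothChart.isPositiveFrame_transition (he : IsSmoothChart e) (he' : IsSmoothChart e')
    (o : ManifoldOrientation n N) {u : Eu n} (hu : u ∈ e.target) (hu' : e.symm u ∈ e'.source) :
    IsPositiveFrame (o.at' (e.symm u)) (chartFrame e u) ↔
      (0 < (fderiv ℝ (e' ∘ e.symm) u).det ↔
        IsPositiveFrame (o.at' (e'.symm ((e' ∘ e.symm) u))) (chartFrame e' ((e' ∘ e.symm) u))) := by
  set A := fderiv ℝ (e' ∘ e.symm) u with hA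
  let B : Eu n →L[ℝ] Eu n := symmD e' ((e' ∘ e.symm) u)
  have h1 := isPositiveFrame_comp (o.at' (e.symm u) : Orientation ℝ (Eu n) (Fin n)) (stdBasis n)
    (B : Eu n →ₗ[ℝ] Eu n) (A : Eu n →ₗ[ℝ] Eu n)
    (det_ne_zero_of_injective B (he'.symmD_injective (e'.map_source hu')))
    (he.det_transition_ne_zero he' hu hu')
  have h2 : (chartFrame e u : Fin n → Eu n) = fun i => B (A (stdBasis n i)) := by
    funext i
    rw [stdBasis_apply]
    exact (he.symmD_transition he' hu hu' _).symm
  have h3 : (chartFrame e' ((e' ∘ e.symm) u) : Fin n → Eu n) = fun i => B (stdBasis n i) := by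
    funext i
    rw [stdBasis_apply]
    rfl
  have h4 : (o.at' (e'.symm ((e' ∘ e.symm) u)) : Orientation ℝ (Eu n) (Fin n)) = o.at' (e.symm u) :=
    o.at_congr (e'.left_inv hu')
  change @IsPositiveFrame (Eu n) _ _ _ _ (chartFrame e u : Fin n → Eu n) ↔
    (_ ↔ @IsPositiveFrame (Eu n) _ _ _ (o.at' (e'.symm ((e' ∘ e.symm) u)))
      (chartFrame e' ((e' ∘ e.symm) u) : Fin n → Eu n))
  rw [h2, h3, h4]
  exact h1

theorem ManifoldOrientation.sgn_of_pos (o : ManifoldOrientation n N) {u : Eu n}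
    (h : IsPositiveFrame (o.at' (e.symm u)) (chartFrame e u)) : o.sgn e u = 1 := if_pos h

theorem ManifoldOrientation.sgn_of_not (o : ManifoldOrientation n N) {u : Eu n}
    (h : ¬ IsPositiveFrame (o.at' (e.symm u)) (chartFrame e u)) : o.sgn e u = -1 := if_neg h

theorem ManifoldOrientation.sgn_congr (o : ManifoldOrientation n N) {u w : Eu n}
    (h : IsPositiveFrame (o.at' (e.symm u)) (chartFrame e u) ↔
      IsPositiveFrame (o.at' (e'.symm w)) (chartFrame e' w)) : o.sgn e u = o.sgn e' w := by
  by_cases h2 : IsPositiveFrame (o.at' (e'.symm w)) (chartFrame e' w)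
  · rw [o.sgn_of_pos h2, o.sgn_of_pos (h.2 h2)]
  · rw [o.sgn_of_not h2, o.sgn_of_not fun h3 => h2 (h.1 h3)]

theorem ManifoldOrientation.sgn_eq_one_or (o : ManifoldOrientation n N)
    (e : OpenPartialHomeomorph N (Eu n)) (u : Eu n) : o.sgn e u = 1 ∨ o.sgn e u = -1 := by
  unfold ManifoldOrientation.sgn; split_ifs <;> simp

theorem IsSmoothChart.sgn_transition (he : IsSmoothChart e) (he' : IsSmoothChart e')
    (o : ManifoldOrientation n N) {u : Eu n} (hu : u ∈ e.target) (hu' : e.symm u ∈ e'.source) :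
    (0 < (fderiv ℝ (e' ∘ e.symm) u).det ∧ o.sgn e u = o.sgn e' ((e' ∘ e.symm) u)) ∨
      ((fderiv ℝ (e' ∘ e.symm) u).det < 0 ∧ o.sgn e u = -o.sgn e' ((e' ∘ e.symm) u)) := by
  have h1 := he.isPositiveFrame_transition he' o hu hu'
  rcases lt_or_gt_of_ne (he.det_transition_ne_zero he' hu hu') with h | h
  · refine Or.inr ⟨h, ?_⟩
    by_cases h2 : IsPositiveFrame (o.at' (e'.symm ((e' ∘ e.symm) u)))
      (chartFrame e' ((e' ∘ e.symm) u))
    · rw [o.sgn_of_pos h2, o.sgn_of_not (fun h3 => h.not_gt ((h1.1 h3).2 h2))]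
    · rw [o.sgn_of_not h2, neg_neg]
      exact o.sgn_of_pos (h1.2 ⟨fun h3 => absurd h3 h.not_gt, fun h3 => absurd h3 h2⟩)
  · refine Or.inl ⟨h, o.sgn_congr (h1.trans ⟨fun h3 => h3.1 h, fun h3 => ⟨fun _ => h3, fun _ => h⟩⟩)⟩

/-- The coefficient of a form of top degree in the coordinates of a chart. -/
def Form.coeff (θ : Form n N n) (e : OpenPartialHomeomorph N (Eu n)) (u : Eu n) : ℝ :=
  θ (e.symm u) (chartFrame e u)

theorem Form.coeff_eq (θ : Form n N n) (e : OpenPartialHomeomorph N (Eu n)) (u : Eu n) :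
    θ.coeff e u = θ.coord e u fun i => stdBasis n i := by
  simp only [stdBasis_apply]
  rfl

theorem Form.coeff_transition (he : IsSmoothChart e) (he' : IsSmoothChart e') (θ : Form n N n)
    {u : Eu n} (hu : u ∈ e.target) (hu' : e.symm u ∈ e'.source) :
    θ.coeff e u = (fderiv ℝ (e' ∘ e.symm) u).det * θ.coeff e' ((e' ∘ e.symm) u) := by
  rw [θ.coeff_eq, θ.coeff_eq, θ.coord_transition he he' hu hu']
  exact alternating_apply_comp (stdBasis n) (θ.coord e' ((e' ∘ e.symm) u)).toAlternatingMap _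

/-- The signed coefficient of a form of top degree in the coordinates of a chart. -/
def Form.density (o : ManifoldOrientation n N) (θ : Form n N n)
    (e : OpenPartialHomeomorph N (Eu n)) (u : Eu n) : ℝ := o.sgn e u * θ.coeff e u

/-- The coefficient acquires the determinant and the chart sign acquires its sign. The product
acquires the absolute value, as the change of variables formula demands. -/
theorem Form.density_transition (he : IsSmoothChart e) (he' : IsSmoothChart e')
    (o : ManifoldOrientation n N) (θ : Form n N n)
    {u : Eu n} (hu : u ∈ e.target) (hu' : e.symm u ∈ e'.source) :
    θ.density o e u = |(fderiv ℝ (e' ∘ e.symm) u).det| * θ.density o e' ((e' ∘ e.symm) u) := by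
  rw [Form.density, Form.density, θ.coeff_transition he he' hu hu']
  rcases he.sgn_transition he' o hu hu' with ⟨h1, h2⟩ | ⟨h1, h2⟩
  · rw [h2, abs_of_pos h1]; ring
  · rw [h2, abs_of_neg h1]; ring

theorem Form.density_zero_of {o : ManifoldOrientation n N} {θ : Form n N n} {u : Eu n}
    (h : θ (e.symm u) = 0) : θ.density o e u = 0 := by
  rw [Form.density, Form.coeff, h]
  exact mul_zero _

variable [IsManifold (𝓡 n) ∞ N]

/-- An orientation is assumed continuous only at the centres of the preferred charts. The sign of
the transition determinant is locally constant, which extends this to every chart. -/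
theorem IsSmoothChart.eventually_sgn (he : IsSmoothChart e) (o : ManifoldOrientation n N) {u : Eu n}
    (hu : u ∈ e.target) : ∀ᶠ w in 𝓝 u, o.sgn e w = o.sgn e u := by
  set x := e.symm u with hx
  set c := chartAt (Eu n) x with hc
  have hcs : IsSmoothChart c := isSmoothChart_chartAt x
  have hxc : x ∈ c.source := mem_chart_source _ _
  have hτ := he.contDiffAt_transition hcs hu hxc
  have h1 : ∀ᶠ w in 𝓝 u, o.sgn c ((c ∘ e.symm) w) = o.sgn c ((c ∘ e.symm) u) := by
    refine (hτ.continuousAt.eventually (p := fun w => o.sgn c w = o.sgn c ((c ∘ e.symm) u)) ?_)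
    refine (o.continuous' x).mono fun w hw => ?_
    exact o.sgn_congr hw
  have hdet : ContinuousAt (fun w => (fderiv ℝ (c ∘ e.symm) w).det) u :=
    ContinuousLinearMap.continuous_det.continuousAt.comp (hτ.continuousAt_fderiv (by simp))
  have hev := eventually_transition (e := e) (e' := c) hu hxc
  rcases he.sgn_transition hcs o hu hxc with ⟨h2, h3⟩ | ⟨h2, h3⟩
  · filter_upwards [h1, hev, hdet.eventually (lt_mem_nhds h2)] with w hw1 hw2 hw3
    rcases he.sgn_transition hcs o hw2.1 hw2.2 with ⟨h4, h5⟩ | ⟨h4, h5⟩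
    · rw [h3, h5, hw1]
    · exact absurd h4 (not_lt.2 (le_of_lt hw3))
  · filter_upwards [h1, hev, hdet.eventually (gt_mem_nhds h2)] with w hw1 hw2 hw3
    rcases he.sgn_transition hcs o hw2.1 hw2.2 with ⟨h4, h5⟩ | ⟨h4, h5⟩
    · exact absurd h4 (not_lt.2 (le_of_lt hw3))
    · rw [h3, h5, hw1]

/-- A continuous function with values `1` and `-1` on a connected set would also take the value
zero. -/
theorem IsSmoothChart.sgn_eq_of_isPreconnected (he : IsSmoothChart e) (o : ManifoldOrientation n N)
    {B : Set (Eu n)} (hB : IsPreconnected B) (hBT : B ⊆ e.target) {u w : Eu n} (hu : u ∈ B)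
    (hw : w ∈ B) : o.sgn e u = o.sgn e w := by
  have h1 : ContinuousOn (o.sgn e) B := fun v hv =>
    (continuousAt_const.congr ((he.eventually_sgn o (hBT hv)).mono
      fun _ h => h.symm)).continuousWithinAt
  by_contra hne
  have h2 : (0 : ℝ) ∈ o.sgn e '' B := by
    have h3 : (o.sgn e '' B).OrdConnected := (hB.image _ h1).ordConnected
    rcases o.sgn_eq_one_or e u with h | h <;> rcases o.sgn_eq_one_or e w with h' | h'
    · exact absurd (h.trans h'.symm) hne
    · exact h3.out ⟨w, hw, h'⟩ ⟨u, hu, h⟩ ⟨by norm_num, by norm_num⟩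
    · exact h3.out ⟨u, hu, h⟩ ⟨w, hw, h'⟩ ⟨by norm_num, by norm_num⟩
    · exact absurd (h.trans h'.symm) hne
  obtain ⟨v, -, hv⟩ := h2
  rcases o.sgn_eq_one_or e v with h | h <;> rw [h] at hv <;> norm_num at hv

theorem Form.IsSmooth.contDiffAt_coeff {θ : Form n N n} (hθ : θ.IsSmooth) (he : IsSmoothChart e)
    {u : Eu n} (hu : u ∈ e.target) : ContDiffAt ℝ ∞ (θ.coeff e) u := by
  have h1 : θ.coeff e = fun u => θ.coord e u fun i => stdBasis n i := funext fun u => θ.coeff_eq e u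
  rw [h1]
  exact contDiffAt_alternating_apply (hθ.contDiffAt_coord he hu) fun i => contDiffAt_const

theorem Form.IsSmooth.continuousOn_density {θ : Form n N n} (hθ : θ.IsSmooth)
    (he : IsSmoothChart e) (o : ManifoldOrientation n N) :
    ContinuousOn (θ.density o e) e.target := fun _ hv =>
  ContinuousAt.continuousWithinAt (ContinuousAt.mul (continuousAt_const.congr
    ((he.eventually_sgn o hv).mono fun _ h => h.symm)) (hθ.contDiffAt_coeff he hv).continuousAt)

end Density

/-! ### The integral of forms of top degree -/

section Integration

variable {n : ℕ} {N : Type*} [TopologicalSpace N] [ChartedSpace (Eu n) N]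
  {e e' : OpenPartialHomeomorph N (Eu n)}

/-- A form of top degree is locally integrable if its coefficients are integrable on compact subsets
of chart domains. -/
def Form.LocallyIntegrable (o : ManifoldOrientation n N) (θ : Form n N n) : Prop :=
  ∀ e : OpenPartialHomeomorph N (Eu n), IsSmoothChart e → ∀ K : Set N, IsCompact K → K ⊆ e.source →
    IntegrableOn (θ.density o e) (e '' K)

open Classical in
/-- The form which agrees with `θ` on `A` and vanishes elsewhere. -/
def Form.restrict {k : ℕ} (A : Set N) (θ : Form n N k) : Form n N k :=
  fun x => if x ∈ A then θ x else 0

theorem Form.restrict_of_mem {k : ℕ} {A : Set N} {θ : Form n N k} {x : N} (hx : x ∈ A) :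
    Form.restrict A θ x = θ x := if_pos hx

theorem Form.restrict_of_notMem {k : ℕ} {A : Set N} {θ : Form n N k} {x : N} (hx : x ∉ A) :
    Form.restrict A θ x = 0 := if_neg hx

theorem Form.density_restrict (o : ManifoldOrientation n N) (A : Set N) (θ : Form n N n) :
    (Form.restrict A θ).density o e = indicator (e.symm ⁻¹' A) (θ.density o e) := by
  funext u
  by_cases hu : e.symm u ∈ A
  · rw [indicator_of_mem (show u ∈ e.symm ⁻¹' A from hu)]
    simp only [Form.density, Form.coeff, Form.restrict_of_mem hu]
  · rw [indicator_of_notMem (show u ∉ e.symm ⁻¹' A from hu)]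
    exact Form.density_zero_of (Form.restrict_of_notMem hu)

theorem Form.density_add (o : ManifoldOrientation n N) (θ η : Form n N n) (u : Eu n) :
    (θ + η).density o e u = θ.density o e u + η.density o e u := mul_add _ _ _

theorem Form.density_neg (o : ManifoldOrientation n N) (θ : Form n N n) (u : Eu n) :
    (-θ).density o e u = -θ.density o e u := mul_neg _ _

omit [ChartedSpace (Eu n) N] in
theorem isCompact_image_chart {K : Set N} (hK : IsCompact K) (hKe : K ⊆ e.source) :
    IsCompact (e '' K) := hK.image_of_continuousOn (e.continuousOn.mono hKe)

omit [ChartedSpace (Eu n) N] in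
theorem image_chart_subset {K : Set N} (hKe : K ⊆ e.source) : e '' K ⊆ e.target := by
  rintro _ ⟨x, hx, rfl⟩
  exact e.map_source (hKe hx)

omit [ChartedSpace (Eu n) N] in
theorem notMem_of_notMem_image {K : Set N} {u : Eu n} (hu : u ∈ e.target)
    (h : u ∉ e '' K) : e.symm u ∉ K := fun hK => h ⟨_, hK, e.right_inv hu⟩

variable [IsManifold (𝓡 n) ∞ N]

/-- Stokes' theorem on one side of a surface integrates forms cut off at an open set, which are no
longer continuous; this is why integrals are developed for locally integrable forms. -/
theorem Form.IsSmooth.locallyIntegrable_restrict {o : ManifoldOrientation n N} {θ : Form n N n}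
    (hθ : θ.IsSmooth) {A : Set N} (hA : IsOpen A) : (Form.restrict A θ).LocallyIntegrable o := by
  intro e he K hK hKe
  rw [Form.density_restrict]
  have hc := isCompact_image_chart hK hKe
  have h1 : IntegrableOn (θ.density o e) (e '' K) :=
    ((hθ.continuousOn_density he o).mono (image_chart_subset hKe)).integrableOn_compact hc
  have h2 : IsOpen (e.target ∩ e.symm ⁻¹' A) := e.symm.isOpen_inter_preimage hA
  refine (h1.indicator h2.measurableSet).congr_fun (fun u hu => ?_) hc.measurableSet
  have hu' := image_chart_subset hKe hu
  by_cases h : e.symm u ∈ A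
  · rw [indicator_of_mem (show u ∈ e.target ∩ e.symm ⁻¹' A from ⟨hu', h⟩),
      indicator_of_mem (show u ∈ e.symm ⁻¹' A from h)]
  · rw [indicator_of_notMem (fun h3 : u ∈ e.target ∩ e.symm ⁻¹' A => h h3.2),
      indicator_of_notMem (show u ∉ e.symm ⁻¹' A from h)]

omit [IsManifold (𝓡 n) ∞ N] in
theorem Form.restrict_univ {k : ℕ} (θ : Form n N k) : Form.restrict univ θ = θ :=
  funext fun x => Form.restrict_of_mem (mem_univ x)

theorem Form.IsSmooth.locallyIntegrable {o : ManifoldOrientation n N} {θ : Form n N n}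
    (hθ : θ.IsSmooth) : θ.LocallyIntegrable o := by
  rw [← θ.restrict_univ]
  exact hθ.locallyIntegrable_restrict isOpen_univ

omit [IsManifold (𝓡 n) ∞ N] in
theorem IsSmoothChart.integrableOn_mul_density {o : ManifoldOrientation n N} {θ : Form n N n}
    (he : IsSmoothChart e) (hθ : θ.LocallyIntegrable o) {K : Set N} (hK : IsCompact K)
    (hθK : ∀ x, x ∉ K → θ x = 0) {ρ : N → ℝ} (hρ : Continuous ρ) (hρe : tsupport ρ ⊆ e.source) :
    IntegrableOn (fun u => ρ (e.symm u) * θ.density o e u) e.target := by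
  have hK' : IsCompact (K ∩ tsupport ρ) := hK.inter_right (isClosed_tsupport ρ)
  have hKe : K ∩ tsupport ρ ⊆ e.source := inter_subset_right.trans hρe
  have h1 : IntegrableOn (fun u => ρ (e.symm u) * θ.density o e u) (e '' (K ∩ tsupport ρ)) :=
    IntegrableOn.continuousOn_mul (hρ.comp_continuousOn
      (e.continuousOn_symm.mono (image_chart_subset hKe))) (hθ e he _ hK' hKe)
      (isCompact_image_chart hK' hKe)
  refine h1.of_forall_sdiff_eq_zero e.open_target.measurableSet fun u hu => ?_
  by_cases h : e.symm u ∈ K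
  · have h2 : e.symm u ∉ tsupport ρ := fun h3 =>
      notMem_of_notMem_image hu.1 hu.2 ⟨h, h3⟩
    rw [image_eq_zero_of_notMem_tsupport h2, zero_mul]
  · rw [Form.density_zero_of (hθK _ h), mul_zero]

variable [T2Space N] [SecondCountableTopology N]

/-- The chosen partition of unity subordinate to the preferred charts. -/
def chartPartition (n : ℕ) (N : Type*) [TopologicalSpace N] [ChartedSpace (Eu n) N]
    [IsManifold (𝓡 n) ∞ N] [T2Space N] [SecondCountableTopology N] :
    SmoothPartitionOfUnity N (𝓡 n) N univ := (exists_chartPartition n N).choose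

theorem chartPartition_continuous (x : N) : Continuous (chartPartition n N x) :=
  (chartPartition n N x).contMDiff.continuous

theorem chartPartition_tsupport (x : N) :
    tsupport (chartPartition n N x) ⊆ (chartAt (Eu n) x).source :=
  (exists_chartPartition n N).choose_spec x

theorem formIntegral_eq (o : ManifoldOrientation n N) (θ : Form n N n) :
    formIntegral o θ = ∑ᶠ x : N, ∫ u in (chartAt (Eu n) x).target,
      chartPartition n N x ((chartAt (Eu n) x).symm u) * θ.density o (chartAt (Eu n) x) u := by
  refine finsum_congr fun x => ?_
  rw [show (extChartAt (𝓡 n) x).target = (chartAt (Eu n) x).target by simp]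
  rfl

theorem finite_chartPartition {K : Set N} (hK : IsCompact K) :
    {x | (Function.support (chartPartition n N x) ∩ K).Nonempty}.Finite :=
  (chartPartition n N).locallyFinite.finite_nonempty_inter_compact hK

theorem chartPartition_mul_eq_zero {o : ManifoldOrientation n N} {θ : Form n N n}
    {K : Set N} (hθK : ∀ x, x ∉ K → θ x = 0) {x : N}
    (hx : x ∉ {x | (Function.support (chartPartition n N x) ∩ K).Nonempty}) (u : Eu n) :
    chartPartition n N x (e.symm u) * θ.density o e u = 0 := by
  by_cases h : e.symm u ∈ K
  · have h2 : chartPartition n N x (e.symm u) = 0 := by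
      by_contra h3
      exact hx ⟨_, h3, h⟩
    rw [h2, zero_mul]
  · rw [Form.density_zero_of (hθK _ h), mul_zero]

theorem support_formIntegral_subset {o : ManifoldOrientation n N} {θ : Form n N n}
    {K : Set N} (hθK : ∀ x, x ∉ K → θ x = 0) :
    (Function.support fun x : N => ∫ u in (chartAt (Eu n) x).target,
      chartPartition n N x ((chartAt (Eu n) x).symm u) * θ.density o (chartAt (Eu n) x) u) ⊆
      {x | (Function.support (chartPartition n N x) ∩ K).Nonempty} := by
  intro x hx
  by_contra h
  refine hx ?_
  simp only [chartPartition_mul_eq_zero hθK h, integral_zero]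

theorem formIntegral_add {o : ManifoldOrientation n N} {θ η : Form n N n}
    (hθ : θ.LocallyIntegrable o) (hη : η.LocallyIntegrable o) {K : Set N} (hK : IsCompact K)
    (hθK : ∀ x, x ∉ K → θ x = 0) (hηK : ∀ x, x ∉ K → η x = 0) :
    formIntegral o (θ + η) = formIntegral o θ + formIntegral o η := by
  simp only [formIntegral_eq]
  rw [← finsum_add_distrib ((finite_chartPartition hK).subset (support_formIntegral_subset hθK))
    ((finite_chartPartition hK).subset (support_formIntegral_subset hηK))]
  refine finsum_congr fun x => ?_
  have he : IsSmoothChart (chartAt (Eu n) x) := isSmoothChart_chartAt x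
  rw [← integral_add (he.integrableOn_mul_density hθ hK hθK (chartPartition_continuous x)
    (chartPartition_tsupport x)) (he.integrableOn_mul_density hη hK hηK
      (chartPartition_continuous x) (chartPartition_tsupport x))]
  congr 1
  funext u
  rw [Form.density_add, mul_add]

theorem formIntegral_neg (o : ManifoldOrientation n N) (θ : Form n N n) :
    formIntegral o (-θ) = -formIntegral o θ := by
  simp only [formIntegral_eq]
  rw [← finsum_neg_distrib]
  refine finsum_congr fun x => ?_
  rw [← integral_neg]
  congr 1
  funext u
  rw [Form.density_neg, mul_neg]

theorem formIntegral_zero (o : ManifoldOrientation n N) : formIntegral o (0 : Form n N n) = 0 := by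
  have := formIntegral_neg o (0 : Form n N n)
  rw [neg_zero] at this
  linarith

/-- The integral of a form supported in a chart is the Lebesgue integral of its coefficient. -/
theorem IsSmoothChart.formIntegral_eq {o : ManifoldOrientation n N} {θ : Form n N n}
    (he : IsSmoothChart e) (hθ : θ.LocallyIntegrable o) {K : Set N} (hK : IsCompact K)
    (hKe : K ⊆ e.source) (hθK : ∀ x, x ∉ K → θ x = 0) :
    formIntegral o θ = ∫ u in e.target, θ.density o e u := by
  have hfin := finite_chartPartition (n := n) hK
  -- Each partition function confines the integrand to the overlap of `e` with a preferred chart,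
  -- where the change of variables formula moves the integral to `e`. There the partition functions
  -- add up to one.
  have h1 : ∀ x : N, ∫ u in (chartAt (Eu n) x).target,
      chartPartition n N x ((chartAt (Eu n) x).symm u) * θ.density o (chartAt (Eu n) x) u =
      ∫ u in e.target, chartPartition n N x (e.symm u) * θ.density o e u := by
    intro x
    set c := chartAt (Eu n) x with hc
    have hcs : IsSmoothChart c := isSmoothChart_chartAt x
    set W := e.target ∩ e.symm ⁻¹' c.source with hW
    have hWo : IsOpen W := IsSmoothChart.isOpen_transition e c
    have h2 : ∫ u in e.target, chartPartition n N x (e.symm u) * θ.density o e u =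
        ∫ u in W, chartPartition n N x (e.symm u) * θ.density o e u := by
      refine (setIntegral_eq_of_subset_of_forall_sdiff_eq_zero e.open_target.measurableSet
        inter_subset_left fun u hu => ?_)
      have h3 : e.symm u ∉ tsupport (chartPartition n N x) := fun h3 =>
        hu.2 ⟨hu.1, chartPartition_tsupport x h3⟩
      rw [image_eq_zero_of_notMem_tsupport h3, zero_mul]
    have himg : (c ∘ e.symm) '' W = c.target ∩ c.symm ⁻¹' e.source := by
      ext w
      constructor
      · rintro ⟨u, hu, rfl⟩
        refine ⟨c.map_source hu.2, ?_⟩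
        change c.symm (c (e.symm u)) ∈ e.source
        rw [c.left_inv hu.2]
        exact e.map_target hu.1
      · rintro ⟨hw, hw'⟩
        refine ⟨e (c.symm w), ⟨e.map_source hw', ?_⟩, ?_⟩
        · change e.symm (e (c.symm w)) ∈ c.source
          rw [e.left_inv hw']
          exact c.map_target hw
        · change c (e.symm (e (c.symm w))) = w
          rw [e.left_inv hw', c.right_inv hw]
    have h4 : ∫ u in c.target, chartPartition n N x (c.symm u) * θ.density o c u =
        ∫ u in (c ∘ e.symm) '' W, chartPartition n N x (c.symm u) * θ.density o c u := by
      rw [himg]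
      refine (setIntegral_eq_of_subset_of_forall_sdiff_eq_zero c.open_target.measurableSet
        inter_subset_left fun u hu => ?_)
      have h3 : c.symm u ∉ K := fun h3 => hu.2 ⟨hu.1, hKe h3⟩
      rw [Form.density_zero_of (hθK _ h3), mul_zero]
    have hinj : InjOn (c ∘ e.symm) W := by
      intro u hu w hw huw
      have h5 := c.injOn hu.2 hw.2 huw
      exact e.symm.injOn hu.1 hw.1 h5
    rw [h2, h4, integral_image_eq_integral_abs_det_fderiv_smul volume hWo.measurableSet
      (fun u hu => ((he.contDiffAt_transition hcs hu.1 hu.2).differentiableAt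
        (by simp)).hasFDerivAt.hasFDerivWithinAt) hinj]
    refine setIntegral_congr_fun hWo.measurableSet fun u hu => ?_
    have h6 : c.symm ((c ∘ e.symm) u) = e.symm u := c.left_inv hu.2
    simp only [smul_eq_mul]
    rw [θ.density_transition he hcs o hu.1 hu.2, h6]
    ring
  rw [Conal.formIntegral_eq]
  simp only [h1]
  rw [finsum_eq_sum_of_support_subset (s := hfin.toFinset)]
  swap
  · intro x hx
    rw [Finite.coe_toFinset]
    by_contra h
    exact hx (by simp only [chartPartition_mul_eq_zero hθK h, integral_zero])
  have hKc := isCompact_image_chart hK hKe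
  have hint : ∀ x : N,
      IntegrableOn (fun u => chartPartition n N x (e.symm u) * θ.density o e u) e.target := by
    intro x
    have h1 : IntegrableOn (fun u => chartPartition n N x (e.symm u) * θ.density o e u)
        (e '' K) := IntegrableOn.continuousOn_mul
      ((chartPartition_continuous x).comp_continuousOn
        (e.continuousOn_symm.mono (image_chart_subset hKe))) (hθ e he K hK hKe) hKc
    refine h1.of_forall_sdiff_eq_zero e.open_target.measurableSet fun u hu => ?_
    rw [Form.density_zero_of (hθK _ (notMem_of_notMem_image hu.1 hu.2)), mul_zero]
  rw [← integral_finsetSum _ fun x _ => hint x]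
  refine setIntegral_congr_fun e.open_target.measurableSet fun u hu => ?_
  rw [← Finset.sum_mul]
  by_cases h : e.symm u ∈ K
  · have h7 : ∑ x ∈ hfin.toFinset, chartPartition n N x (e.symm u) = 1 := by
      rw [← (chartPartition n N).sum_eq_one (mem_univ (e.symm u)),
        finsum_eq_sum_of_support_subset (s := hfin.toFinset)]
      intro x hx
      rw [Finite.coe_toFinset]
      exact ⟨_, hx, h⟩
    rw [h7, one_mul]
  · rw [Form.density_zero_of (hθK _ h), mul_zero]

end Integration

/-! ### Stokes' theorem on half spaces -/

section HalfSpace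

variable {m : ℕ}

/-- The fields vanish outside a cube, so the slab may be cut down to a box. Of its faces only those
at `x 0 = a₀` and `x 0 = b₀` contribute to the divergence theorem. -/
theorem integral_divergence_slab {F : Fin (m + 1) → (Fin (m + 1) → ℝ) → ℝ}
    (hF : ∀ i, ContDiff ℝ 1 (F i)) {R : ℝ}
    (hR : ∀ i x, (∃ j, R ≤ |x j|) → F i =ᶠ[𝓝 x] 0) {a₀ b₀ : ℝ} (hab : a₀ ≤ b₀) :
    ∫ x in {x : Fin (m + 1) → ℝ | x 0 ∈ Ioo a₀ b₀}, ∑ i, fderiv ℝ (F i) x (Pi.single i 1) =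
      (∫ w : Fin m → ℝ, F 0 (Fin.cons b₀ w)) - ∫ w : Fin m → ℝ, F 0 (Fin.cons a₀ w) := by
  -- For `R ≤ 0` the fields vanish identically, and any positive bound will do.
  wlog hR0 : 0 < R generalizing R
  · exact this (R := 1) (fun i x ⟨j, hj⟩ => hR i x ⟨j, by linarith [not_lt.1 hR0]⟩) one_pos
  set D : (Fin (m + 1) → ℝ) → ℝ := fun x => ∑ i, fderiv ℝ (F i) x (Pi.single i 1) with hD
  have hD0 : ∀ x, (∃ j, R ≤ |x j|) → D x = 0 := fun x hx => Finset.sum_eq_zero fun i _ => by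
    rw [(hR i x hx).fderiv_eq]; simp
  have hF0 : ∀ i x, (∃ j, R ≤ |x j|) → F i x = 0 := fun i x hx => (hR i x hx).self_of_nhds
  set a : Fin (m + 1) → ℝ := Fin.cons a₀ fun _ => -R with ha
  set b : Fin (m + 1) → ℝ := Fin.cons b₀ fun _ => R with hb
  have hle : a ≤ b := fun i => by
    refine Fin.cases ?_ (fun j => ?_) i
    · simpa [ha, hb] using hab
    · simp only [ha, hb, Fin.cons_succ]; linarith
  have h1 : ∫ x in {x : Fin (m + 1) → ℝ | x 0 ∈ Ioo a₀ b₀}, D x = ∫ x in Icc a b, D x := by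
    rw [volume_pi, ← setIntegral_congr_set (Measure.univ_pi_Ioo_ae_eq_Icc (f := a) (g := b)),
      ← volume_pi]
    refine setIntegral_eq_of_subset_of_forall_sdiff_eq_zero
      (measurableSet_Ioo.preimage (measurable_pi_apply 0)) (fun x hx => ?_) fun x hx => hD0 x ?_
    · simpa [ha, hb] using hx 0 (mem_univ 0)
    · by_contra! h
      refine hx.2 fun i _ => ?_
      refine Fin.cases ?_ (fun j => ?_) i
      · simpa [ha, hb] using hx.1
      · simpa [ha, hb] using abs_lt.1 (h j.succ)
  rw [h1, integral_divergence_of_hasFDerivAt_off_countable' a b hle F (fun i => fderiv ℝ (F i)) ∅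
    countable_empty (fun i => (hF i).continuous.continuousOn)
    (fun x _ i => ((hF i).differentiable one_ne_zero x).hasFDerivAt)
    (Continuous.integrableOn_Icc (continuous_finsetSum _ fun i _ =>
      ((hF i).continuous_fderiv one_ne_zero).clm_apply continuous_const))]
  rw [Fin.sum_univ_succ, Finset.sum_eq_zero, add_zero]
  · have h2 : ∀ t : ℝ, ∫ x in Icc (a ∘ Fin.succAbove 0) (b ∘ Fin.succAbove 0),
        F 0 (Fin.insertNth (α := fun _ => ℝ) 0 t x) = ∫ w : Fin m → ℝ, F 0 (Fin.cons t w) := by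
      intro t
      simp only [Fin.insertNth_zero']
      refine setIntegral_eq_integral_of_forall_compl_eq_zero fun x hx => hF0 _ _ ?_
      by_contra! h
      refine hx (mem_Icc.2 ⟨fun j => ?_, fun j => ?_⟩) <;>
      have := abs_lt.1 (h j.succ) <;> simp [ha, hb] at this ⊢ <;> linarith
    exact congrArg₂ _ (h2 _) (h2 _)
  · intro i _
    rw [sub_eq_zero]
    trans (0 : ℝ)
    · refine setIntegral_eq_zero_of_forall_eq_zero fun x _ => hF0 _ _ ⟨i.succ, ?_⟩
      simp [hb, abs_of_pos hR0]
    · refine (setIntegral_eq_zero_of_forall_eq_zero fun x _ => hF0 _ _ ⟨i.succ, ?_⟩).symm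
      simp [ha, abs_of_pos hR0]

/-- The point of `ℝ^(m+1)` with first coordinate `t` and remaining coordinates `w`. -/
def consE (t : ℝ) (w : Eu m) : Eu (m + 1) := WithLp.toLp 2 (Fin.cons t fun i => w i)

@[simp] theorem consE_zero (t : ℝ) (w : Eu m) : consE t w 0 = t := rfl

@[simp] theorem consE_succ (t : ℝ) (w : Eu m) (i : Fin m) : consE t w i.succ = w i := rfl

variable {η : Eu (m + 1) → Eu (m + 1) [⋀^Fin m]→L[ℝ] ℝ}

/-- Stokes' theorem for compactly supported forms on the half spaces bounded by a coordinate
hyperplane. -/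
theorem integral_extDeriv_halfSpace (hη : ContDiff ℝ 1 η) (hc : HasCompactSupport η) :
    (∫ u in {u : Eu (m + 1) | u 0 < 0}, extDeriv η u fun i => stdBasis (m + 1) i) =
        (∫ w : Eu m, η (consE 0 w) fun i => stdBasis (m + 1) i.succ) ∧
      (∫ u in {u : Eu (m + 1) | 0 < u 0}, extDeriv η u fun i => stdBasis (m + 1) i) =
        -(∫ w : Eu m, η (consE 0 w) fun i => stdBasis (m + 1) i.succ) ∧
      ∫ u, (extDeriv η u fun i => stdBasis (m + 1) i) = 0 := by
  let L : (Fin (m + 1) → ℝ) →L[ℝ] Eu (m + 1) :=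
    ((EuclideanSpace.equiv (Fin (m + 1)) ℝ).symm : (Fin (m + 1) → ℝ) →L[ℝ] Eu (m + 1))
  have hL : ∀ x, L x = WithLp.toLp 2 x := fun x => rfl
  have hLs : ∀ i, L (Pi.single i 1) = stdBasis (m + 1) i := fun i => by
    rw [stdBasis_apply]; rfl
  obtain ⟨R, hR⟩ := hc.isCompact.isBounded.subset_closedBall 0
  -- With these signs the divergence of `F` is the coefficient of `extDeriv η`, and `F 0` is the
  -- coefficient of `η` along the hyperplane.
  set F : Fin (m + 1) → (Fin (m + 1) → ℝ) → ℝ := fun i x =>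
    (-1) ^ (i : ℕ) * η (L x) (i.removeNth fun j => stdBasis (m + 1) j) with hFdef
  have hF : ∀ i, ContDiff ℝ 1 (F i) := fun i => contDiff_const.mul
    ((ContinuousAlternatingMap.apply ℝ (Eu (m + 1)) ℝ
      (i.removeNth fun j => stdBasis (m + 1) j)).contDiff.comp (hη.comp L.contDiff))
  have hz : ∀ x : Fin (m + 1) → ℝ, (∃ j, R + 1 ≤ |x j|) → η =ᶠ[𝓝 (L x)] 0 := fun x ⟨j, hj⟩ => by
    rw [← notMem_tsupport_iff_eventuallyEq]
    intro h
    have h1 := hR h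
    rw [mem_closedBall_zero_iff] at h1
    have h2 : |x j| ≤ ‖L x‖ := by
      have := PiLp.norm_apply_le (p := 2) (L x) j
      rwa [Real.norm_eq_abs] at this
    linarith
  have hF0 : ∀ i x, (∃ j, R + 1 ≤ |x j|) → F i =ᶠ[𝓝 x] 0 := fun i x hx => by
    filter_upwards [L.continuous.continuousAt.eventually (hz x hx)] with y hy
    simp only [hFdef, hy]
    exact mul_zero _
  have hD : ∀ x, ∑ i, fderiv ℝ (F i) x (Pi.single i 1) =
      extDeriv η (L x) fun i => stdBasis (m + 1) i := fun x => by
    have hd : DifferentiableAt ℝ η (L x) := hη.differentiable one_ne_zero _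
    rw [extDeriv_apply hd]
    refine Finset.sum_congr rfl fun i _ => ?_
    have h1 : DifferentiableAt ℝ (fun u => η u (i.removeNth fun j => stdBasis (m + 1) j)) (L x) :=
      (ContinuousAlternatingMap.apply ℝ (Eu (m + 1)) ℝ
        (i.removeNth fun j => stdBasis (m + 1) j)).differentiableAt.comp _ hd
    have h2 : fderiv ℝ (F i) x = _ :=
      ((h1.hasFDerivAt.comp x L.hasFDerivAt).const_mul ((-1 : ℝ) ^ (i : ℕ))).fderiv
    have h3 := DFunLike.congr_fun h2 (Pi.single i (1 : ℝ))
    refine h3.trans ?_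
    change (-1 : ℝ) ^ (i : ℕ) • (fderiv ℝ
      (fun u => η u (i.removeNth fun j => stdBasis (m + 1) j)) (L x) (L (Pi.single i (1 : ℝ)))) = _
    rw [hLs, ← Int.cast_smul_eq_zsmul ℝ]
    push_cast
    rfl
  have hmp := PiLp.volume_preserving_toLp (Fin (m + 1))
  have hme : MeasurableEmbedding (WithLp.toLp 2 : (Fin (m + 1) → ℝ) → Eu (m + 1)) :=
    (MeasurableEquiv.toLp 2 (Fin (m + 1) → ℝ)).measurableEmbedding
  have hside : ∀ t : ℝ, ∫ w : Fin m → ℝ, F 0 (Fin.cons t w) =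
      ∫ w : Eu m, η (consE t w) fun i => stdBasis (m + 1) i.succ := fun t => by
    rw [← (PiLp.volume_preserving_toLp (Fin m)).integral_comp
      (MeasurableEquiv.toLp 2 (Fin m → ℝ)).measurableEmbedding]
    refine integral_congr_ae (ae_of_all _ fun w => ?_)
    simp only [hFdef, Fin.val_zero, pow_zero, one_mul]
    rfl
  have hfar : ∀ t : ℝ, R + 1 ≤ |t| → ∫ w : Fin m → ℝ, F 0 (Fin.cons t w) = 0 := fun t ht => by
    have : ∀ w : Fin m → ℝ, F 0 (Fin.cons t w) = 0 := fun w =>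
      (hF0 0 _ ⟨0, by simpa using ht⟩).self_of_nhds
    simp only [this, integral_zero]
  -- Where the first coordinate is at least `Q` in absolute value everything vanishes. So a half
  -- space may be replaced by a slab with one face on the hyperplane and the other one free of
  -- contributions.
  set Q : ℝ := |R| + 1 with hQ
  have hQ0 : 0 < Q := by positivity
  have hRQ : R + 1 ≤ Q := by simpa [hQ] using le_abs_self R
  have hslab : ∀ A : Set ℝ, MeasurableSet A → ∀ a₀ b₀ : ℝ, a₀ ≤ b₀ → Ioo a₀ b₀ ⊆ A →
      (∀ t ∈ A, t ∉ Ioo a₀ b₀ → Q ≤ |t|) →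
      (∫ u in {u : Eu (m + 1) | u 0 ∈ A}, extDeriv η u fun i => stdBasis (m + 1) i) =
        (∫ w : Fin m → ℝ, F 0 (Fin.cons b₀ w)) - ∫ w : Fin m → ℝ, F 0 (Fin.cons a₀ w) := by
    intro A hAm a₀ b₀ hab hA hA'
    rw [← integral_divergence_slab hF hF0 hab, ← hmp.setIntegral_preimage_emb hme]
    simp only [hD]
    refine setIntegral_eq_of_subset_of_forall_sdiff_eq_zero
      (hAm.preimage (measurable_pi_apply 0)) (fun x hx => hA hx) fun x hx => ?_
    have := (hz x ⟨0, hRQ.trans (hA' _ hx.1 hx.2)⟩).extDeriv_eq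
    have h0 : extDeriv η (L x) = 0 := this.trans (by
      rw [extDeriv, show (0 : Eu (m + 1) → Eu (m + 1) [⋀^Fin m]→L[ℝ] ℝ) = fun _ => 0 from rfl,
        fderiv_const_apply]
      exact (ContinuousAlternatingMap.alternatizeUncurryFinCLM ℝ (Eu (m + 1)) ℝ).map_zero)
    exact DFunLike.congr_fun h0 _
  refine ⟨?_, ?_, ?_⟩
  · refine (hslab (Iio 0) measurableSet_Iio (-Q) 0 (by linarith) Ioo_subset_Iio_self ?_).trans ?_
    · intro t ht ht'
      have h1 : t < 0 := ht
      rw [abs_of_neg h1]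
      by_contra h
      exact ht' ⟨by linarith, h1⟩
    · rw [hfar (-Q) (by rwa [abs_neg, abs_of_pos hQ0]), sub_zero, hside]
  · refine (hslab (Ioi 0) measurableSet_Ioi 0 Q hQ0.le Ioo_subset_Ioi_self ?_).trans ?_
    · intro t ht ht'
      have h1 : 0 < t := ht
      rw [abs_of_pos h1]
      by_contra h
      exact ht' ⟨h1, by linarith⟩
    · rw [hfar Q (by rwa [abs_of_pos hQ0]), zero_sub, hside]
  · have h1 := hslab univ MeasurableSet.univ (-Q) Q (by linarith) (subset_univ _) (by
      intro t _ ht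
      by_contra! h
      exact ht (abs_lt.1 h))
    simp only [mem_univ, ofPred_true, setIntegral_univ] at h1
    rw [h1, hfar Q (by rwa [abs_of_pos hQ0]), hfar (-Q) (by rwa [abs_neg, abs_of_pos hQ0]), sub_zero]

end HalfSpace

/-! ### Slice charts of hypersurfaces -/

section LinearCharts

variable {n : ℕ} {N : Type*} [TopologicalSpace N] [ChartedSpace (Eu n) N]
  {e : OpenPartialHomeomorph N (Eu n)}

theorem mem_contDiffGroupoid_of_linear (Λ : Eu n ≃L[ℝ] Eu n) :
    Λ.toHomeomorph.toOpenPartialHomeomorph ∈ contDiffGroupoid ∞ (𝓡 n) := by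
  rw [contDiffGroupoid, mem_groupoid_of_pregroupoid]
  refine ⟨?_, ?_⟩
  · exact Λ.contDiff.contDiffOn
  · exact Λ.symm.contDiff.contDiffOn

/-- A chart composed with a linear isomorphism of the model space. -/
theorem IsSmoothChart.trans_linear (he : IsSmoothChart e) (Λ : Eu n ≃L[ℝ] Eu n) :
    IsSmoothChart (e.trans Λ.toHomeomorph.toOpenPartialHomeomorph) := by
  unfold IsSmoothChart at he ⊢
  rw [IsManifold.mem_maximalAtlas_iff, mem_maximalAtlas_iff] at he ⊢
  intro e' he'
  obtain ⟨h1, h2⟩ := he e' he'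
  have hΛ := mem_contDiffGroupoid_of_linear Λ
  refine ⟨?_, ?_⟩
  · rw [OpenPartialHomeomorph.trans_symm_eq_symm_trans_symm, OpenPartialHomeomorph.trans_assoc]
    exact (contDiffGroupoid ∞ (𝓡 n)).trans ((contDiffGroupoid ∞ (𝓡 n)).symm hΛ) h1
  · rw [← OpenPartialHomeomorph.trans_assoc]
    exact (contDiffGroupoid ∞ (𝓡 n)).trans h2 hΛ

theorem IsSmoothChart.restr (he : IsSmoothChart e) {s : Set N} (hs : IsOpen s) :
    IsSmoothChart (e.restr s) :=
  restr_mem_maximalAtlas (contDiffGroupoid ∞ (𝓡 n)) he hs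

end LinearCharts

/-! ### Charts in which a hypersurface is a coordinate hyperplane -/

section Slice

variable {m : ℕ}

/-- Splitting off the first coordinate of `ℝ^(m+1)`. -/
def consEquiv (m : ℕ) : (Eu m × ℝ) ≃L[ℝ] Eu (m + 1) :=
  LinearEquiv.toContinuousLinearEquiv
    { toFun := fun p => consE p.2 p.1
      invFun := fun u => (WithLp.toLp 2 fun i => u i.succ, u 0)
      map_add' := fun p q => by
        ext i; refine Fin.cases ?_ (fun j => ?_) i <;> simp
      map_smul' := fun c p => by
        ext i; refine Fin.cases ?_ (fun j => ?_) i <;> simp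
      left_inv := fun p => rfl
      right_inv := fun u => by
        ext i; refine Fin.cases ?_ (fun j => ?_) i <;> simp }

theorem consEquiv_apply (w : Eu m) (t : ℝ) : consEquiv m (w, t) = consE t w := rfl

/-- The last coordinates of a point of `ℝ^(m+1)`. -/
def tailE (u : Eu (m + 1)) : Eu m := WithLp.toLp 2 fun i => u i.succ

theorem consE_tailE (u : Eu (m + 1)) : consE (u 0) (tailE u) = u := by
  ext i; refine Fin.cases ?_ (fun j => ?_) i <;> simp [tailE]

theorem tailE_consE (t : ℝ) (w : Eu m) : tailE (consE t w) = w := rfl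

theorem continuous_tailE : Continuous (tailE : Eu (m + 1) → Eu m) :=
  continuous_fst.comp (consEquiv m).symm.continuous

/-- The normal form of an immersion has an unspecified complement `F'`. By a count of dimensions it
is a line, which is moved to the first coordinate. -/
theorem exists_linear_slice {F' : Type*} [NormedAddCommGroup F'] [NormedSpace ℝ F']
    (L : (Eu m × F') ≃L[ℝ] Eu (m + 1)) :
    ∃ Λ : Eu (m + 1) ≃L[ℝ] Eu (m + 1), ∀ w, Λ (L (w, 0)) = consE 0 w := by
  have h1 : FiniteDimensional ℝ F' := by
    refine Module.Finite.of_injective ((L : (Eu m × F') →ₗ[ℝ] Eu (m + 1)) ∘ₗ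
      LinearMap.inr ℝ (Eu m) F') ?_
    exact L.injective.comp (LinearMap.inr_injective)
  have h2 : Module.finrank ℝ F' = Module.finrank ℝ ℝ := by
    have := L.toLinearEquiv.finrank_eq
    rw [Module.finrank_prod, finrank_euclideanSpace_fin, finrank_euclideanSpace_fin] at this
    rw [Module.finrank_self]
    omega
  let ι : F' ≃L[ℝ] ℝ := ContinuousLinearEquiv.ofFinrankEq h2
  refine ⟨(L.symm.trans ((ContinuousLinearEquiv.refl ℝ (Eu m)).prodCongr ι)).trans (consEquiv m),
    fun w => ?_⟩
  simp only [ContinuousLinearEquiv.trans_apply, ContinuousLinearEquiv.symm_apply_apply]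
  change consEquiv m (w, ι 0) = _
  rw [map_zero, consEquiv_apply]

/-- The reflection in the hyperplane on which the first coordinate vanishes. -/
def reflE (m : ℕ) : Eu (m + 1) ≃L[ℝ] Eu (m + 1) :=
  ((consEquiv m).symm.trans ((ContinuousLinearEquiv.refl ℝ (Eu m)).prodCongr
    (ContinuousLinearEquiv.neg ℝ))).trans (consEquiv m)

theorem reflE_apply (u : Eu (m + 1)) : reflE m u = consE (-u 0) (tailE u) := rfl

theorem reflE_reflE (u : Eu (m + 1)) : reflE m (reflE m u) = u := by
  rw [reflE_apply, reflE_apply, consE_zero, neg_neg, tailE_consE, consE_tailE]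

theorem reflE_symm (u : Eu (m + 1)) : (reflE m).symm u = reflE m u := by
  rw [ContinuousLinearEquiv.symm_apply_eq, reflE_reflE]

variable {M : Type*} [TopologicalSpace M] [ChartedSpace (Eu (m + 1)) M]
  {S : Set M} [ChartedSpace (Eu m) S] {e : OpenPartialHomeomorph M (Eu (m + 1))}
  {ψ : OpenPartialHomeomorph S (Eu m)}

/-- A chart of the manifold, with convex image, in which the hypersurface `S` is given by the
vanishing of the first coordinate, with the induced chart of `S`. -/
structure IsSliceChart (e : OpenPartialHomeomorph M (Eu (m + 1)))
    (ψ : OpenPartialHomeomorph S (Eu m)) : Prop where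
  chart : IsSmoothChart e
  chart' : IsSmoothChart ψ
  convex : Convex ℝ e.target
  mem_iff : ∀ u ∈ e.target, e.symm u ∈ S ↔ u 0 = 0
  mem_target : ∀ w, w ∈ ψ.target ↔ consE 0 w ∈ e.target
  symm_apply : ∀ w ∈ ψ.target, (ψ.symm w : M) = e.symm (consE 0 w)
  mem_source : ∀ y : S, (y : M) ∈ e.source → y ∈ ψ.source

/-- The normal form of an immersion straightens only a patch of `S`. As `S` has the induced
topology, an open set `V` of the manifold cuts this patch out of `S`. Shrinking to a ball whose
points lie in `V` keeps all other sheets of `S` away. -/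
theorem exists_isSliceChart
    (hS : Manifold.IsSmoothEmbedding (𝓡 m) (𝓡 (m + 1)) ∞ (Subtype.val : S → M)) (s : S) :
    ∃ (e : OpenPartialHomeomorph M (Eu (m + 1))) (ψ : OpenPartialHomeomorph S (Eu m)),
      IsSliceChart e ψ ∧ (s : M) ∈ e.source := by
  have h := hS.isImmersion.isImmersionAt s
  obtain ⟨Λ, hΛ⟩ := exists_linear_slice h.equiv
  set φ := h.domChart with hφ
  set c := h.codChart.trans Λ.toHomeomorph.toOpenPartialHomeomorph with hc
  have hφs : IsSmoothChart φ := h.domChart_mem_maximalAtlas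
  have hcs : IsSmoothChart c := IsSmoothChart.trans_linear h.codChart_mem_maximalAtlas Λ
  have hsrc : ∀ y : S, y ∈ φ.source → (y : M) ∈ c.source := fun y hy => by
    have : (y : M) ∈ h.codChart.source := h.source_subset_preimage_source hy
    simpa [hc] using this
  have hc1 : ∀ y : S, y ∈ φ.source → c y = consE 0 (φ y) := fun y hy => by
    have h0 : φ y ∈ (h.domChart.extend (𝓡 m)).target := by
      rw [OpenPartialHomeomorph.extend_target]
      exact ⟨φ.map_source hy, mem_range_self _⟩
    have h1 := h.writtenInCharts h0
    have h2 : h.codChart (y : M) = h.equiv (φ y, 0) := by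
      have h3 : h.codChart ((φ.symm (φ y) : S) : M) = h.equiv (φ y, 0) := h1
      rwa [φ.left_inv hy] at h3
    change Λ (h.codChart (y : M)) = _
    rw [h2, hΛ]
  have hs : s ∈ φ.source := h.mem_domChart_source
  obtain ⟨V, hV, hVφ⟩ := isOpen_induced_iff.1 φ.open_source
  have hVmem : ∀ y : S, (y : M) ∈ V ↔ y ∈ φ.source := fun y => by rw [← hVφ]; rfl
  -- Points of the ball must come from `V`, and their last coordinates must lie in the chart of `S`.
  -- Choosing a ball also makes the target convex.
  obtain ⟨δ, hδ, hB⟩ : ∃ δ > 0, Metric.ball (c s) δ ⊆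
      (c.target ∩ c.symm ⁻¹' V) ∩ tailE ⁻¹' φ.target := by
    refine Metric.mem_nhds_iff.1 (inter_mem ?_ ?_)
    · refine (c.symm.isOpen_inter_preimage hV).mem_nhds ⟨c.map_source (hsrc s hs), ?_⟩
      change c.symm (c s) ∈ V
      rw [c.left_inv (hsrc s hs)]
      exact (hVmem s).2 hs
    · refine (φ.open_target.preimage continuous_tailE).mem_nhds ?_
      change tailE (c s) ∈ φ.target
      rw [hc1 s hs, tailE_consE]
      exact φ.map_source hs
  set B := Metric.ball (c s) δ with hBdef
  have hUo : IsOpen (c.source ∩ c ⁻¹' B) := c.isOpen_inter_preimage Metric.isOpen_ball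
  set e := c.restr (c.source ∩ c ⁻¹' B) with he
  have hesrc : e.source = c.source ∩ c ⁻¹' B := by
    rw [he, OpenPartialHomeomorph.restr_source' _ _ hUo, ← inter_assoc, inter_self]
  have hcsymm : ∀ u, e.symm u = c.symm u := fun u => rfl
  have hecoe : ∀ x, e x = c x := fun u => rfl
  have hetgt : e.target = B := by
    ext u
    constructor
    · intro hu
      have := e.map_target hu
      rw [hesrc] at this
      have h2 : e (e.symm u) ∈ B := this.2
      rwa [e.right_inv hu] at h2
    · intro hu
      have h1 : c.symm u ∈ e.source := by
        rw [hesrc]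
        refine ⟨c.map_target (hB hu).1.1, ?_⟩
        change c (c.symm u) ∈ B
        rwa [c.right_inv (hB hu).1.1]
      have := e.map_source h1
      rwa [hecoe, c.right_inv (hB hu).1.1] at this
  have hWo : IsOpen ((Subtype.val : S → M) ⁻¹' e.source) :=
    e.open_source.preimage continuous_subtype_val
  set ψ := φ.restr ((Subtype.val : S → M) ⁻¹' e.source) with hψ
  have hψsrc : ψ.source = φ.source ∩ (Subtype.val : S → M) ⁻¹' e.source :=
    OpenPartialHomeomorph.restr_source' _ _ hWo
  have hsrcφ : ∀ y : S, (y : M) ∈ e.source → y ∈ φ.source := fun y hy => by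
    rw [hesrc] at hy
    have := (hB hy.2).1.2
    change c.symm (c y) ∈ V at this
    rw [c.left_inv hy.1] at this
    exact (hVmem y).1 this
  have hsymmψ : ∀ w, ψ.symm w = φ.symm w := fun w => rfl
  have hkey : ∀ w, consE 0 w ∈ B → w ∈ φ.target ∧ (φ.symm w : M) = c.symm (consE 0 w) := by
    intro w hw
    have h1 : w ∈ φ.target := (hB hw).2
    have h2 := φ.map_target h1
    have h3 := hc1 _ h2
    rw [φ.right_inv h1] at h3
    refine ⟨h1, ?_⟩
    rw [← h3, c.left_inv (hsrc _ h2)]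
  have htgt : ∀ w, w ∈ ψ.target ↔ consE 0 w ∈ e.target := by
    intro w
    rw [hetgt]
    constructor
    · intro hw
      have h1 := ψ.map_target hw
      rw [hψsrc, hesrc] at h1
      have h2 : c (ψ.symm w : M) ∈ B := h1.2.2
      rw [hc1 _ h1.1] at h2
      have h3 : φ (ψ.symm w) = w := ψ.right_inv hw
      rwa [h3] at h2
    · intro hw
      obtain ⟨h1, h2⟩ := hkey w hw
      have h3 : φ.symm w ∈ ψ.source := by
        rw [hψsrc]
        refine ⟨φ.map_target h1, ?_⟩
        change (φ.symm w : M) ∈ e.source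
        rw [h2]
        exact e.map_target (hetgt ▸ hw)
      have h4 : ψ (φ.symm w) ∈ ψ.target := ψ.map_source h3
      have h5 : ψ (φ.symm w) = w := φ.right_inv h1
      rwa [h5] at h4
  refine ⟨e, ψ, ⟨hcs.restr hUo, hφs.restr hWo, hetgt ▸ convex_ball _ _, ?_, htgt, ?_, ?_⟩, ?_⟩
  · intro u hu
    constructor
    · intro huS
      have h1 : (⟨e.symm u, huS⟩ : S) ∈ φ.source := hsrcφ _ (e.map_target hu)
      have h2 := hc1 _ h1
      have h3 : c (e.symm u) = u := e.right_inv hu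
      have h4 : u = consE 0 (φ ⟨e.symm u, huS⟩) := h3.symm.trans h2
      rw [h4, consE_zero]
    · intro hu0
      have h1 : consE 0 (tailE u) = u := by rw [← hu0, consE_tailE]
      obtain ⟨-, h2⟩ := hkey (tailE u) (by rw [h1, ← hetgt]; exact hu)
      rw [h1] at h2
      rw [hcsymm, ← h2]
      exact (φ.symm (tailE u)).2
  · intro w hw
    have h1 := (htgt w).1 hw
    rw [hetgt] at h1
    exact (hkey w h1).2
  · intro y hy
    rw [hψsrc]
    exact ⟨hsrcφ y hy, hy⟩
  · rw [hesrc]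
    exact ⟨hsrc s hs, Metric.mem_ball_self hδ⟩

/-- Reflection of a slice chart. -/
theorem IsSliceChart.reflect (h : IsSliceChart e ψ) :
    IsSliceChart (e.trans (reflE m).toHomeomorph.toOpenPartialHomeomorph) ψ := by
  have htgt : (e.trans (reflE m).toHomeomorph.toOpenPartialHomeomorph).target =
      reflE m ⁻¹' e.target := by
    ext u
    simp only [OpenPartialHomeomorph.trans_target, mem_inter_iff, mem_preimage]
    change (u ∈ univ ∧ (reflE m).symm u ∈ e.target) ↔ _
    rw [reflE_symm]
    simp
  have hsymm : ∀ u, (e.trans (reflE m).toHomeomorph.toOpenPartialHomeomorph).symm u =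
      e.symm (reflE m u) := fun u => by
    change e.symm ((reflE m).symm u) = _
    rw [reflE_symm]
  have hcons : ∀ w : Eu m, reflE m (consE 0 w) = consE 0 w := fun w => by
    rw [reflE_apply, consE_zero, neg_zero, tailE_consE]
  refine ⟨h.chart.trans_linear _, h.chart', ?_, fun u hu => ?_, fun w => ?_, fun w hw => ?_,
    fun y hy => h.mem_source y ?_⟩
  · rw [htgt]
    exact h.convex.linear_preimage ((reflE m : Eu (m + 1) →L[ℝ] Eu (m + 1)) : Eu (m + 1) →ₗ[ℝ] Eu (m + 1))
  · rw [htgt] at hu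
    rw [hsymm, h.mem_iff _ hu, reflE_apply, consE_zero, neg_eq_zero]
  · rw [htgt, mem_preimage, hcons, h.mem_target]
  · rw [hsymm, hcons, h.symm_apply w hw]
  · simpa using hy

end Slice

/-! ### Slice charts of Cauchy surfaces -/

section CauchyCharts

variable {m : ℕ} {M : Type*} [TopologicalSpace M] [ChartedSpace (Eu (m + 1)) M]
  {S : Set M} [ChartedSpace (Eu m) S] {e : OpenPartialHomeomorph M (Eu (m + 1))}
  {ψ : OpenPartialHomeomorph S (Eu m)}

/-- The inclusion of the hyperplane on which the first coordinate vanishes. -/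
def consL (m : ℕ) : Eu m →L[ℝ] Eu (m + 1) :=
  ((consEquiv m : (Eu m × ℝ) →L[ℝ] Eu (m + 1))).comp (ContinuousLinearMap.inl ℝ (Eu m) ℝ)

theorem consE_stdBasis (i : Fin m) : consE 0 (stdBasis m i) = stdBasis (m + 1) i.succ := by
  rw [stdBasis_apply, stdBasis_apply]
  ext j
  refine Fin.cases ?_ (fun k => ?_) j
  · simp
  · rw [consE_succ]
    simp

theorem IsSliceChart.fderiv_val (h : IsSliceChart e ψ) {w : Eu m} (hw : w ∈ ψ.target) :
    fderiv ℝ (e ∘ (Subtype.val : S → M) ∘ ψ.symm) w = consL m := by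
  have h1 : (e ∘ (Subtype.val : S → M) ∘ ψ.symm) =ᶠ[𝓝 w] consL m := by
    filter_upwards [ψ.open_target.mem_nhds hw] with w' hw'
    change e (ψ.symm w' : M) = consE 0 w'
    rw [h.symm_apply w' hw', e.right_inv ((h.mem_target w').1 hw')]
  rw [h1.fderiv_eq, ContinuousLinearMap.fderiv]

/-- The inclusion is linear in these charts, so the coordinate frame of `S` is that of the ambient
chart without its first vector. -/
theorem IsSliceChart.symmD_val (h : IsSliceChart e ψ)
    (hι : ContMDiff (𝓡 m) (𝓡 (m + 1)) ∞ (Subtype.val : S → M)) {w : Eu m} (hw : w ∈ ψ.target)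
    (v : Eu m) : (symmD e (consE 0 w) (consE 0 v) : Eu (m + 1)) =
      mfderiv (𝓡 m) (𝓡 (m + 1)) (Subtype.val : S → M) (ψ.symm w) (symmD ψ w v) := by
  have h0 := (h.mem_target w).1 hw
  have h1 : ((ψ.symm w : S) : M) ∈ e.source := by
    rw [h.symm_apply w hw]; exact e.map_target h0
  have h2 := h.chart'.symmD_map h.chart hw (hι.mdifferentiable (by simp) _) h1 v
  rw [h.fderiv_val hw] at h2
  have h3 : (e ∘ (Subtype.val : S → M) ∘ ψ.symm) w = consE 0 w := by
    change e (ψ.symm w : M) = consE 0 w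
    rw [h.symm_apply w hw, e.right_inv h0]
  rw [← h2, h3]
  rfl

theorem IsSliceChart.coeff_pullback (h : IsSliceChart e ψ)
    (hι : ContMDiff (𝓡 m) (𝓡 (m + 1)) ∞ (Subtype.val : S → M)) {w : Eu m} (hw : w ∈ ψ.target)
    (θ : Form (m + 1) M m) : (Form.pullback (Subtype.val : S → M) θ).coeff ψ w =
      θ.coord e (consE 0 w) fun i => stdBasis (m + 1) i.succ := by
  refine θ.apply_congr (h.symm_apply w hw) (funext fun i => ?_)
  have h1 := h.symmD_val hι hw (EuclideanSpace.single i (1 : ℝ))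
  have h2 : consE 0 (EuclideanSpace.single i (1 : ℝ)) = stdBasis (m + 1) i.succ := by
    rw [← stdBasis_apply, consE_stdBasis]
  rw [h2] at h1
  exact h1.symm

variable [IsManifold (𝓡 (m + 1)) ∞ M]

namespace ChronalConeBundle

variable {C : ChronalConeBundle m M}

theorem cone_congr (C : ChronalConeBundle m M) {x y : M} (h : x = y) :
    (C.cone x : Set (Eu (m + 1))) = C.cone y := by subst h; rfl

/-- A slice chart which maps the past of the surface to negative and its future to positive values
of the first coordinate. -/
structure IsCauchyChart (C : ChronalConeBundle m M) (e : OpenPartialHomeomorph M (Eu (m + 1)))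
    (ψ : OpenPartialHomeomorph S (Eu m)) : Prop extends IsSliceChart e ψ where
  mem_past : ∀ u ∈ e.target, e.symm u ∈ C.strictPast S ↔ u 0 < 0
  mem_future : ∀ u ∈ e.target, e.symm u ∈ C.strictFuture S ↔ 0 < u 0

omit [ChartedSpace (Eu m) S] in
-- The ends of a short timelike segment through a point of `S` tell which side of a slice chart is
-- the future.
theorem exists_timelike (C : ChronalConeBundle m M) (he : IsSmoothChart e) {u : Eu (m + 1)}
    (hu : u ∈ e.target) (huS : e.symm u ∈ S) :
    ∃ v ∈ C.coordCone e u, u + v ∈ e.target ∧ u - v ∈ e.target ∧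
      e.symm (u + v) ∈ C.strictFuture S ∧ e.symm (u - v) ∈ C.strictPast S := by
  obtain ⟨v, ε, hε, δ, hδ, hvδ, hB, hK⟩ := C.exists_ball_coordCone he hu
  have hv := Metric.mem_ball_self (x := v) hε
  have h0 : u ∈ Metric.closedBall u δ := Metric.mem_closedBall_self hδ.le
  have h1 : u + v ∈ Metric.closedBall u δ := by
    rw [mem_closedBall_iff_norm, add_sub_cancel_left]; exact hvδ
  have h2 : u - v ∈ Metric.closedBall u δ := by
    rw [mem_closedBall_iff_norm, sub_sub_cancel_left, norm_neg]; exact hvδ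
  refine ⟨v, hK u h0 v hv, hB h1, hB h2, ⟨_, huS, ?_⟩, ⟨_, huS, ?_⟩⟩
  · exact precedes_segment he hB (convex_closedBall u δ) h0 h1 fun u' hu' => by
      rw [add_sub_cancel_left]; exact hK u' hu' v hv
  · exact precedes_segment he hB (convex_closedBall u δ) h2 h0 fun u' hu' => by
      rw [sub_sub_cancel]; exact hK u' hu' v hv

variable [T2Space M] [SecondCountableTopology M]

/-- Each open half of a slice chart is convex and misses `S`, so by connectedness it lies in the
past or in the future. A timelike vector decides which, and a reflection corrects the wrong order.
-/
theorem IsCauchySurface.exists_isCauchyChart (hS : C.IsCauchySurface S) (s : S) :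
    ∃ (e : OpenPartialHomeomorph M (Eu (m + 1))) (ψ : OpenPartialHomeomorph S (Eu m)),
      C.IsCauchyChart e ψ ∧ (s : M) ∈ e.source := by
  obtain ⟨e, ψ, h, hs⟩ := exists_isSliceChart hS.isSmoothEmbedding s
  have hsplit := hS.causalSplitting
  have hPF : ∀ x, x ∈ C.strictPast S → x ∉ C.strictFuture S := fun x h1 h2 =>
    hsplit.disjoint.le_bot ⟨h1, h2⟩
  have hPS : ∀ x, x ∈ C.strictPast S → x ∉ S := fun x h1 h2 =>
    hsplit.disjoint_past.le_bot ⟨h1, h2⟩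
  have hFS : ∀ x, x ∈ C.strictFuture S → x ∉ S := fun x h1 h2 =>
    hsplit.disjoint_future.le_bot ⟨h1, h2⟩
  have hside : ∀ H : Set (Eu (m + 1)), Convex ℝ H → (∀ u ∈ H, u 0 ≠ 0) →
      (∀ u ∈ e.target ∩ H, e.symm u ∈ C.strictPast S) ∨
      (∀ u ∈ e.target ∩ H, e.symm u ∈ C.strictFuture S) := by
    intro H hH h0
    have h1 : IsPreconnected (e.symm '' (e.target ∩ H)) :=
      (h.convex.inter hH).isPreconnected.image _ (e.continuousOn_symm.mono inter_subset_left)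
    have h2 : e.symm '' (e.target ∩ H) ⊆ C.strictPast S ∪ C.strictFuture S := by
      rintro _ ⟨u, hu, rfl⟩
      rcases hsplit.cover (e.symm u) with h3 | h3 | h3
      · exact Or.inl h3
      · exact absurd ((h.mem_iff u hu.1).1 h3) (h0 u hu.2)
      · exact Or.inr h3
    rcases isPreconnected_iff_subset_of_disjoint.1 h1 _ _ hsplit.isOpen_past hsplit.isOpen_future
      h2 (by rw [hsplit.disjoint.inter_eq, inter_empty]) with h3 | h3
    · exact Or.inl fun u hu => h3 (mem_image_of_mem _ hu)
    · exact Or.inr fun u hu => h3 (mem_image_of_mem _ hu)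
  have hneg : Convex ℝ {u : Eu (m + 1) | u 0 < 0} :=
    convex_halfSpace_lt (EuclideanSpace.proj (𝕜 := ℝ) (0 : Fin (m + 1))).isLinear 0
  have hpos : Convex ℝ {u : Eu (m + 1) | 0 < u 0} :=
    convex_halfSpace_gt (EuclideanSpace.proj (𝕜 := ℝ) (0 : Fin (m + 1))).isLinear 0
  have hes := e.map_source hs
  have hesS : e.symm (e s) ∈ S := by rw [e.left_inv hs]; exact s.2
  obtain ⟨v, -, hv1, hv2, hv3, hv4⟩ := C.exists_timelike h.chart hes hesS
  have hs0 : e s 0 = 0 := (h.mem_iff _ hes).1 hesS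
  have e1 : (e s + v) 0 = v 0 := by simp [hs0]
  have e2 : (e s - v) 0 = -v 0 := by simp [hs0]
  -- The timelike vector is transverse to the hyperplane: otherwise the future point `e s + v` would
  -- belong to `S`.
  have hv0 : v 0 ≠ 0 := fun h0 => hFS _ hv3 ((h.mem_iff _ hv1).2 (by rw [e1, h0]))
  rcases lt_or_gt_of_ne hv0 with hlt | hgt
  · have hP : ∀ u ∈ e.target, 0 < u 0 → e.symm u ∈ C.strictPast S := by
      rcases hside _ hpos fun u hu => ne_of_gt hu with h3 | h3
      · exact fun u hu hu' => h3 u ⟨hu, hu'⟩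
      · exact absurd (h3 _ ⟨hv2, show 0 < (e s - v) 0 by rw [e2]; linarith⟩) (hPF _ hv4)
    have hF : ∀ u ∈ e.target, u 0 < 0 → e.symm u ∈ C.strictFuture S := by
      rcases hside _ hneg fun u hu => ne_of_lt hu with h3 | h3
      · exact absurd hv3 (hPF _ (h3 _ ⟨hv1, show (e s + v) 0 < 0 by rw [e1]; exact hlt⟩))
      · exact fun u hu hu' => h3 u ⟨hu, hu'⟩
    have hrt : ∀ u, u ∈ (e.trans (reflE m).toHomeomorph.toOpenPartialHomeomorph).target →
        reflE m u ∈ e.target := fun u hu => by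
      have := hu.2
      change (reflE m).symm u ∈ e.target at this
      rwa [reflE_symm] at this
    have hrs : ∀ u, (e.trans (reflE m).toHomeomorph.toOpenPartialHomeomorph).symm u =
        e.symm (reflE m u) := fun u => by
      change e.symm ((reflE m).symm u) = _
      rw [reflE_symm]
    have hr0 : ∀ u, reflE m u 0 = -u 0 := fun u => rfl
    refine ⟨_, ψ, ⟨h.reflect, fun u hu => ?_, fun u hu => ?_⟩, by simpa using hs⟩
    · rw [hrs]
      refine ⟨fun h1 => ?_, fun h1 => hP _ (hrt u hu) (by rw [hr0]; linarith)⟩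
      by_contra! h2
      rcases h2.eq_or_lt with h3 | h3
      · exact hPS _ h1 ((h.mem_iff _ (hrt u hu)).2 (by rw [hr0, ← h3, neg_zero]))
      · exact hPF _ h1 (hF _ (hrt u hu) (by rw [hr0]; linarith))
    · rw [hrs]
      refine ⟨fun h1 => ?_, fun h1 => hF _ (hrt u hu) (by rw [hr0]; linarith)⟩
      by_contra! h2
      rcases h2.eq_or_lt with h3 | h3
      · exact hFS _ h1 ((h.mem_iff _ (hrt u hu)).2 (by rw [hr0, h3, neg_zero]))
      · exact hPF _ (hP _ (hrt u hu) (by rw [hr0]; linarith)) h1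
  · have hF : ∀ u ∈ e.target, 0 < u 0 → e.symm u ∈ C.strictFuture S := by
      rcases hside _ hpos fun u hu => ne_of_gt hu with h3 | h3
      · exact absurd hv3 (hPF _ (h3 _ ⟨hv1, show 0 < (e s + v) 0 by rw [e1]; exact hgt⟩))
      · exact fun u hu hu' => h3 u ⟨hu, hu'⟩
    have hP : ∀ u ∈ e.target, u 0 < 0 → e.symm u ∈ C.strictPast S := by
      rcases hside _ hneg fun u hu => ne_of_lt hu with h3 | h3
      · exact fun u hu hu' => h3 u ⟨hu, hu'⟩
      · exact absurd (h3 _ ⟨hv2, show (e s - v) 0 < 0 by rw [e2]; linarith⟩) (hPF _ hv4)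
    refine ⟨e, ψ, ⟨h, fun u hu => ⟨fun h1 => ?_, hP u hu⟩, fun u hu => ⟨fun h1 => ?_, hF u hu⟩⟩, hs⟩
    · by_contra! h2
      rcases h2.eq_or_lt with h3 | h3
      · exact hPS _ h1 ((h.mem_iff u hu).2 h3.symm)
      · exact hPF _ h1 (hF u hu h3)
    · by_contra! h2
      rcases h2.eq_or_lt with h3 | h3
      · exact hFS _ h1 ((h.mem_iff u hu).2 h3)
      · exact hPF _ (hP u hu h3) h1

omit [T2Space M] [SecondCountableTopology M] in
/-- The signs of the two charts in a Cauchy chart agree if the surface is future oriented. -/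
theorem IsCauchyChart.sgn_eq (h : C.IsCauchyChart e ψ) {oM : ManifoldOrientation (m + 1) M}
    {oS : ManifoldOrientation m S} (hoS : C.IsFutureOriented oM S oS)
    (hι : ContMDiff (𝓡 m) (𝓡 (m + 1)) ∞ (Subtype.val : S → M)) {w : Eu m} (hw : w ∈ ψ.target) :
    oS.sgn ψ w = oM.sgn e (consE 0 w) := by
  set u : Eu (m + 1) := consE 0 w with hu
  have hut : u ∈ e.target := (h.mem_target w).1 hw
  have hs : (ψ.symm w : M) = e.symm u := h.symm_apply w hw
  obtain ⟨l, hl, hl0, hlo⟩ := hoS (ψ.symm w)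
  let ℓ : Eu (m + 1) →L[ℝ] ℝ := l
  let D : Eu (m + 1) →L[ℝ] Eu (m + 1) := symmD e u
  obtain ⟨v, hv, hv1, -, hv3, -⟩ := C.exists_timelike h.chart hut (by rw [← hs]; exact (ψ.symm w).2)
  have hv0 : 0 < v 0 := by
    have := (h.mem_future _ hv1).1 hv3
    simpa [hu] using this
  have hDv : D v ∈ (C.cone (ψ.symm w : M) : Set (Eu (m + 1))) := by
    rw [C.cone_congr hs]; exact hv
  have hlv : 0 < ℓ (D v) := by
    refine hl (D v) (subset_closure hDv) fun h0 => ?_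
    exact C.zero_notMem_cone (ψ.symm w : M) (by rw [← h0]; exact hDv)
  set b₀ : Eu (m + 1) := EuclideanSpace.single 0 1 with hb
  -- The conormal is positive on the timelike vector and zero on vectors tangent to `S`. As `v 0 >
  -- 0`, this splitting makes it positive on the first coordinate vector, so the orientation
  -- condition applies to the coordinate frame.
  have hdec : v = v 0 • b₀ + consE 0 (tailE v) := by
    ext i
    refine Fin.cases ?_ (fun j => ?_) i
    · simp [hb]
    · simp [hb, tailE]
  have hl1 : ℓ (D (consE 0 (tailE v))) = 0 := by
    have h1 := h.symmD_val hι hw (tailE v)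
    have h2 : D (consE 0 (tailE v)) =
      mfderiv (𝓡 m) (𝓡 (m + 1)) (Subtype.val : S → M) (ψ.symm w) (symmD ψ w (tailE v)) := h1
    rw [h2]
    exact hl0 _
  have hl2 : 0 < ℓ (D b₀) := by
    rw [hdec, map_add, map_add, hl1, add_zero, map_smul, map_smul, smul_eq_mul] at hlv
    exact pos_of_mul_pos_right hlv hv0.le
  have key := hlo (D b₀) hl2 (chartFrame ψ w)
  have hframe : (Fin.cons (D b₀) fun i => mfderiv (𝓡 m) (𝓡 (m + 1)) (Subtype.val : S → M)
      (ψ.symm w) (chartFrame ψ w i) : Fin (m + 1) → Eu (m + 1)) =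
      (chartFrame e u : Fin (m + 1) → Eu (m + 1)) := by
    funext i
    refine Fin.cases rfl (fun j => ?_) i
    have h1 := h.symmD_val hι hw (EuclideanSpace.single j (1 : ℝ))
    refine h1.symm.trans ?_
    change D (consE 0 (EuclideanSpace.single j (1 : ℝ))) = D (EuclideanSpace.single j.succ (1 : ℝ))
    rw [← stdBasis_apply, ← stdBasis_apply, consE_stdBasis]
  have hpos : IsPositiveFrame (oM.at' (ψ.symm w : M)) (Fin.cons (D b₀) fun i =>
      mfderiv (𝓡 m) (𝓡 (m + 1)) (Subtype.val : S → M) (ψ.symm w) (chartFrame ψ w i)) ↔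
      IsPositiveFrame (oM.at' (e.symm u)) (chartFrame e u) := by
    change @IsPositiveFrame (Eu (m + 1)) _ _ _ (oM.at' (ψ.symm w : M))
      (Fin.cons (D b₀) fun i => mfderiv (𝓡 m) (𝓡 (m + 1)) (Subtype.val : S → M)
        (ψ.symm w) (chartFrame ψ w i) : Fin (m + 1) → Eu (m + 1)) ↔
      @IsPositiveFrame (Eu (m + 1)) _ _ _ (oM.at' (e.symm u))
        (chartFrame e u : Fin (m + 1) → Eu (m + 1))
    rw [hframe, oM.at_congr hs]
    exact Iff.rfl
  have key2 := key.trans hpos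
  by_cases h2 : IsPositiveFrame (oM.at' (e.symm u)) (chartFrame e u)
  · rw [oM.sgn_of_pos h2, oS.sgn_of_pos (key2.2 h2)]
  · rw [oM.sgn_of_not h2, oS.sgn_of_not fun h3 => h2 (key2.1 h3)]

end ChronalConeBundle

end CauchyCharts

/-! ### Calculus of forms on manifolds -/

section FormCalculus

variable {n : ℕ} {N : Type*} [TopologicalSpace N] [ChartedSpace (Eu n) N]
  {n' : ℕ} {N' : Type*} [TopologicalSpace N'] [ChartedSpace (Eu n') N']
  {e : OpenPartialHomeomorph N (Eu n)} {k : ℕ}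

/-- The product of a function and a form. -/
def Form.smulFun (ρ : N → ℝ) (θ : Form n N k) : Form n N k := fun x => ρ x • θ x

theorem Form.coord_congr {θ η : Form n N k} {u : Eu n} (h : θ (e.symm u) = η (e.symm u)) :
    θ.coord e u = η.coord e u := by
  unfold Form.coord
  rw [h]

theorem Form.d_congr {θ η : Form n N k} {x : N} (h : ∀ᶠ y in 𝓝 x, θ y = η y) :
    Form.d θ x = Form.d η x := by
  have h1 : θ.inChart x =ᶠ[𝓝 (extChartAt (𝓡 n) x x)] η.inChart x := by
    have h2 : ContinuousAt (chartAt (Eu n) x).symm (chartAt (Eu n) x x) :=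
      (chartAt (Eu n) x).continuousAt_symm (mem_chart_target _ _)
    have h3 := h2.eventually (p := fun y => θ y = η y)
      (by rwa [(chartAt (Eu n) x).left_inv (mem_chart_source _ _)])
    exact h3.mono fun u hu => Form.coord_congr hu
  unfold Form.d
  rw [h1.extDeriv_eq]

theorem Form.d_zero : Form.d (0 : Form n N k) = 0 := by
  funext x
  have h1 : (0 : Form n N k).inChart x = fun _ => 0 := rfl
  have h2 : extDeriv (fun _ : Eu n => (0 : Eu n [⋀^Fin k]→L[ℝ] ℝ)) (extChartAt (𝓡 n) x x) = 0 := by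
    rw [extDeriv, fderiv_const_apply]
    exact (ContinuousAlternatingMap.alternatizeUncurryFinCLM ℝ (Eu n) ℝ).map_zero
  unfold Form.d
  rw [h1, h2]
  rfl

theorem Form.d_eq_zero_of_eventually {θ : Form n N k} {x : N} (h : ∀ᶠ y in 𝓝 x, θ y = 0) :
    Form.d θ x = 0 := by
  rw [Form.d_congr (η := 0) h, Form.d_zero]
  rfl

variable [IsManifold (𝓡 n) ∞ N]

theorem Form.d_add {θ η : Form n N k} (hθ : θ.IsSmooth) (hη : η.IsSmooth) :
    Form.d (θ + η) = Form.d θ + Form.d η := by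
  funext x
  have h1 := ((hθ.contDiffAt_coord (isSmoothChart_chartAt x)
    (mem_chart_target _ x)).differentiableAt (by simp))
  have h2 := ((hη.contDiffAt_coord (isSmoothChart_chartAt x)
    (mem_chart_target _ x)).differentiableAt (by simp))
  have h3 : extDeriv ((θ + η).inChart x) (extChartAt (𝓡 n) x x) =
      extDeriv (θ.inChart x) (extChartAt (𝓡 n) x x) +
        extDeriv (η.inChart x) (extChartAt (𝓡 n) x x) := extDeriv_add h1 h2
  rw [Pi.add_apply]
  unfold Form.d
  rw [h3]
  rfl

omit [IsManifold (𝓡 n) ∞ N] in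
theorem Form.IsSmooth.add {θ η : Form n N k} (hθ : θ.IsSmooth) (hη : η.IsSmooth) :
    (θ + η).IsSmooth := (smoothForms n N k).add_mem hθ hη

omit [IsManifold (𝓡 n) ∞ N] in
theorem Form.IsSmooth.zero : (0 : Form n N k).IsSmooth := (smoothForms n N k).zero_mem

theorem Form.IsSmooth.smulFun {θ : Form n N k} (hθ : θ.IsSmooth) {ρ : N → ℝ}
    (hρ : ContMDiff (𝓡 n) 𝓘(ℝ, ℝ) ∞ ρ) : (Form.smulFun ρ θ).IsSmooth := by
  rw [Form.isSmooth_iff]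
  intro x
  have he : IsSmoothChart (chartAt (Eu n) x) := isSmoothChart_chartAt x
  have hx := mem_chart_target (Eu n) x
  have h1 : ContDiffAt ℝ ∞ (fun u => ρ ((chartAt (Eu n) x).symm u)) (chartAt (Eu n) x x) := by
    rw [← contMDiffAt_iff_contDiffAt]
    exact hρ.contMDiffAt.comp _ (he.contMDiffOn_symm.contMDiffAt
      ((chartAt (Eu n) x).open_target.mem_nhds hx))
  exact h1.smul (hθ.contDiffAt_coord he hx)

theorem Form.IsSmooth.d {θ : Form n N k} (hθ : θ.IsSmooth) : (Form.d θ).IsSmooth := by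
  rw [Form.isSmooth_iff]
  intro x
  have he : IsSmoothChart (chartAt (Eu n) x) := isSmoothChart_chartAt x
  have hx := mem_chart_target (Eu n) x
  have h1 : (Form.d θ).coord (chartAt (Eu n) x) =ᶠ[𝓝 (chartAt (Eu n) x x)]
      fun u => ContinuousAlternatingMap.alternatizeUncurryFinCLM ℝ (Eu n) ℝ
        (fderiv ℝ (θ.coord (chartAt (Eu n) x)) u) := by
    filter_upwards [(chartAt (Eu n) x).open_target.mem_nhds hx] with u hu
    exact Form.coord_d hθ he hu
  refine ContDiffAt.congr_of_eventuallyEq ?_ h1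
  exact (ContinuousAlternatingMap.alternatizeUncurryFinCLM ℝ (Eu n) ℝ).contDiff.contDiffAt.comp _
    ((hθ.contDiffAt_coord he hx).fderiv_right (m := ∞) (by simp))

theorem Form.IsSmooth.pullback [IsManifold (𝓡 n') ∞ N'] {θ : Form n N k} (hθ : θ.IsSmooth)
    {F : N' → N} (hF : ContMDiff (𝓡 n') (𝓡 n) ∞ F) : (Form.pullback (n' := n') F θ).IsSmooth := by
  rw [Form.isSmooth_iff]
  intro y
  set ψ := chartAt (Eu n') y with hψdef
  set e := chartAt (Eu n) (F y) with hedef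
  have hψ : IsSmoothChart ψ := isSmoothChart_chartAt y
  have he : IsSmoothChart e := isSmoothChart_chartAt (F y)
  have hy : ψ y ∈ ψ.target := mem_chart_target _ y
  have hFy : F (ψ.symm (ψ y)) = F y := by rw [ψ.left_inv (mem_chart_source _ y)]
  have hsrc : F (ψ.symm (ψ y)) ∈ e.source := by rw [hFy]; exact mem_chart_source _ _
  have h0 : ContMDiffAt (𝓡 n') (𝓡 n) ∞ (F ∘ ψ.symm) (ψ y) := hF.contMDiffAt.comp _
    (hψ.contMDiffOn_symm.contMDiffAt (ψ.open_target.mem_nhds hy))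
  have h1 : ContDiffAt ℝ ∞ (e ∘ F ∘ ψ.symm) (ψ y) := by
    rw [← contMDiffAt_iff_contDiffAt]
    exact ContMDiffAt.comp (ψ y) (g := e) (f := F ∘ ψ.symm) (he.contMDiffOn.contMDiffAt (e.open_source.mem_nhds hsrc)) h0
  have h2 : (Form.pullback (n' := n') F θ).coord ψ =ᶠ[𝓝 (ψ y)] fun u =>
      (θ.coord e ((e ∘ F ∘ ψ.symm) u)).compContinuousLinearMap (fderiv ℝ (e ∘ F ∘ ψ.symm) u) := by
    filter_upwards [ψ.open_target.mem_nhds hy,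
      h0.continuousAt.preimage_mem_nhds (e.open_source.mem_nhds hsrc)] with u hu hu'
    exact Form.coord_pullback hψ he θ hu (hF.mdifferentiable (by simp) _) hu'
  exact (contDiffAt_pullback (hθ.contDiffAt_coord he (e.map_source hsrc)) h1).congr_of_eventuallyEq h2

/-- Every point has arbitrarily small charts with convex image. -/
theorem exists_convex_chart {x : N} {U : Set N} (hU : IsOpen U) (hx : x ∈ U) :
    ∃ e : OpenPartialHomeomorph N (Eu n),
      IsSmoothChart e ∧ x ∈ e.source ∧ e.source ⊆ U ∧ Convex ℝ e.target := by
  set c := chartAt (Eu n) x with hc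
  have hcs : IsSmoothChart c := isSmoothChart_chartAt x
  have hxc : x ∈ c.source := mem_chart_source _ x
  obtain ⟨δ, hδ, hB⟩ : ∃ δ > 0, Metric.ball (c x) δ ⊆ c.target ∩ c.symm ⁻¹' U := by
    refine Metric.mem_nhds_iff.1 ((c.symm.isOpen_inter_preimage hU).mem_nhds
      ⟨c.map_source hxc, ?_⟩)
    change c.symm (c x) ∈ U
    rwa [c.left_inv hxc]
  have hUo : IsOpen (c.source ∩ c ⁻¹' Metric.ball (c x) δ) :=
    c.isOpen_inter_preimage Metric.isOpen_ball
  set e := c.restr (c.source ∩ c ⁻¹' Metric.ball (c x) δ) with he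
  have hesrc : e.source = c.source ∩ c ⁻¹' Metric.ball (c x) δ := by
    rw [he, OpenPartialHomeomorph.restr_source' _ _ hUo, ← inter_assoc, inter_self]
  have hetgt : e.target = Metric.ball (c x) δ := by
    ext u
    constructor
    · intro hu
      have := e.map_target hu
      rw [hesrc] at this
      have h2 : e (e.symm u) ∈ Metric.ball (c x) δ := this.2
      rwa [e.right_inv hu] at h2
    · intro hu
      have h1 : c.symm u ∈ e.source := by
        rw [hesrc]
        refine ⟨c.map_target (hB hu).1, ?_⟩
        change c (c.symm u) ∈ Metric.ball (c x) δ
        rwa [c.right_inv (hB hu).1]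
      have h2 : c (c.symm u) ∈ e.target := e.map_source h1
      rwa [c.right_inv (hB hu).1] at h2
  refine ⟨e, hcs.restr hUo, ?_, ?_, hetgt ▸ convex_ball _ _⟩
  · rw [hesrc]; exact ⟨hxc, Metric.mem_ball_self hδ⟩
  · rw [hesrc]
    rintro y ⟨hy, hy'⟩
    have := (hB hy').2
    change c.symm (c y) ∈ U at this
    rwa [c.left_inv hy] at this

end FormCalculus

/-! ### Stokes' theorem on the past and the future of a Cauchy surface -/

section Stokes

variable {m : ℕ} {M : Type*} [TopologicalSpace M] [ChartedSpace (Eu (m + 1)) M]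
  [IsManifold (𝓡 (m + 1)) ∞ M] [T2Space M]
  {e : OpenPartialHomeomorph M (Eu (m + 1))}

omit [T2Space M] in
-- Extended by zero, the coordinate expression stays differentiable because it vanishes off a
-- compact subset of the chart's target.
theorem exists_coord_extension (he : IsSmoothChart e) {θ : Form (m + 1) M m} (hθ : θ.IsSmooth)
    {K : Set M} (hK : IsCompact K) (hKe : K ⊆ e.source) (hθK : ∀ x, x ∉ K → θ x = 0) :
    ∃ η : Eu (m + 1) → Eu (m + 1) [⋀^Fin m]→L[ℝ] ℝ, ContDiff ℝ 1 η ∧ HasCompactSupport η ∧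
      (∀ u ∈ e.target, η u = θ.coord e u) ∧ (∀ u, u ∉ e.target → η u = 0) ∧
      (∀ u ∈ e.target, (Form.d θ).coeff e u = extDeriv η u fun i => stdBasis (m + 1) i) ∧
      ∀ u, u ∉ e.target → extDeriv η u = 0 := by
  classical
  set η : Eu (m + 1) → Eu (m + 1) [⋀^Fin m]→L[ℝ] ℝ :=
    fun u => if u ∈ e.target then θ.coord e u else 0 with hη
  have hKc := isCompact_image_chart hK hKe
  have h1 : ∀ u ∈ e.target, η u = θ.coord e u := fun u hu => if_pos hu
  have h2 : ∀ u, u ∉ e.target → η u = 0 := fun u hu => if_neg hu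
  have h3 : ∀ u, u ∉ e '' K → η u = 0 := fun u hu => by
    by_cases h : u ∈ e.target
    · rw [h1 u h]
      have : θ (e.symm u) = 0 := hθK _ (notMem_of_notMem_image h hu)
      unfold Form.coord
      rw [this]
      rfl
    · exact h2 u h
  have h4 : ∀ u ∈ e.target, η =ᶠ[𝓝 u] θ.coord e := fun u hu =>
    Filter.mem_of_superset (e.open_target.mem_nhds hu) h1
  have h5 : ∀ u, u ∉ e.target → η =ᶠ[𝓝 u] fun _ => 0 := fun u hu =>
    Filter.mem_of_superset (hKc.isClosed.isOpen_compl.mem_nhds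
      fun h => hu (image_chart_subset hKe h)) h3
  refine ⟨η, ?_, HasCompactSupport.intro hKc h3, h1, h2, fun u hu => ?_, fun u hu => ?_⟩
  · rw [contDiff_iff_contDiffAt]
    intro u
    by_cases h : u ∈ e.target
    · exact ((hθ.contDiffAt_coord he h).congr_of_eventuallyEq (h4 u h)).of_le (by simp)
    · exact contDiffAt_const.congr_of_eventuallyEq (h5 u h)
  · rw [Form.coeff_eq, Form.coord_d hθ he hu, (h4 u hu).extDeriv_eq]
  · rw [(h5 u hu).extDeriv_eq, extDeriv, fderiv_const_apply]
    exact (ContinuousAlternatingMap.alternatizeUncurryFinCLM ℝ (Eu (m + 1)) ℝ).map_zero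

omit [T2Space M] [IsManifold (𝓡 (m + 1)) ∞ M] in
theorem Form.d_eq_zero_of_notMem {θ : Form (m + 1) M m} {K : Set M} (hK : IsClosed K)
    (hθK : ∀ x, x ∉ K → θ x = 0) {x : M} (hx : x ∉ K) : Form.d θ x = 0 :=
  Form.d_eq_zero_of_eventually (Filter.mem_of_superset (hK.isOpen_compl.mem_nhds hx) hθK)

variable [SecondCountableTopology M]

/-- `H` describes `A` in the chart. A half space, the whole space and the empty set cover all
positions of the charts relative to the surface. -/
theorem formIntegral_restrict_d (he : IsSmoothChart e) {oM : ManifoldOrientation (m + 1) M}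
    {c : ℝ} (hc : ∀ u ∈ e.target, oM.sgn e u = c) {θ : Form (m + 1) M m} (hθ : θ.IsSmooth)
    {K : Set M} (hK : IsCompact K) (hKe : K ⊆ e.source) (hθK : ∀ x, x ∉ K → θ x = 0)
    {η : Eu (m + 1) → Eu (m + 1) [⋀^Fin m]→L[ℝ] ℝ}
    (hη : ∀ u ∈ e.target, (Form.d θ).coeff e u = extDeriv η u fun i => stdBasis (m + 1) i)
    (hη0 : ∀ u, u ∉ e.target → extDeriv η u = 0) {A : Set M} (hA : IsOpen A)
    {H : Set (Eu (m + 1))} (hH : MeasurableSet H) (hHA : ∀ u ∈ e.target, e.symm u ∈ A ↔ u ∈ H) :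
    formIntegral oM (Form.restrict A (Form.d θ)) =
      c * ∫ u in H, extDeriv η u fun i => stdBasis (m + 1) i := by
  rw [he.formIntegral_eq (hθ.d.locallyIntegrable_restrict hA) hK hKe fun x hx => ?_]
  swap
  · by_cases h : x ∈ A
    · rw [Form.restrict_of_mem h, Form.d_eq_zero_of_notMem hK.isClosed hθK hx]
    · exact Form.restrict_of_notMem h
  rw [← integral_const_mul, ← integral_indicator hH]
  refine Eq.trans ?_ (setIntegral_eq_integral_of_forall_compl_eq_zero (s := e.target) ?_)
  · refine setIntegral_congr_fun e.open_target.measurableSet fun u hu => ?_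
    rw [Form.density_restrict]
    by_cases h : u ∈ H
    · rw [indicator_of_mem h, indicator_of_mem (show u ∈ e.symm ⁻¹' A from (hHA u hu).2 h),
        Form.density, hc u hu, hη u hu]
    · rw [indicator_of_notMem h,
        indicator_of_notMem (show u ∉ e.symm ⁻¹' A from fun h' => h ((hHA u hu).1 h'))]
  · intro u hu
    by_cases h : u ∈ H
    · rw [indicator_of_mem h, hη0 u hu]
      exact mul_zero c
    · exact indicator_of_notMem h _

namespace ChronalConeBundle

variable {C : ChronalConeBundle m M} {S : Set M} [ChartedSpace (Eu m) S]
  {ψ : OpenPartialHomeomorph S (Eu m)} [IsManifold (𝓡 m) ∞ S]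

/-- Stokes' theorem for a form and the two sides of a Cauchy surface. -/
def StokesHolds (C : ChronalConeBundle m M) (oM : ManifoldOrientation (m + 1) M)
    (oS : ManifoldOrientation m S) (θ : Form (m + 1) M m) : Prop :=
  formIntegral oM (Form.restrict (C.strictPast S) (Form.d θ)) =
      formIntegral oS (Form.pullback (n' := m) (Subtype.val : S → M) θ) ∧
    formIntegral oM (Form.restrict (C.strictFuture S) (Form.d θ)) =
      -formIntegral oS (Form.pullback (n' := m) (Subtype.val : S → M) θ)

omit [T2Space M] [SecondCountableTopology M] [IsManifold (𝓡 m) ∞ S] in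
theorem IsCauchySurface.contMDiff_val (hS : C.IsCauchySurface S) :
    ContMDiff (𝓡 m) (𝓡 (m + 1)) ∞ (Subtype.val : S → M) := hS.isSmoothEmbedding.isImmersion.contMDiff

omit [T2Space M] [SecondCountableTopology M] [IsManifold (𝓡 (m + 1)) ∞ M] [IsManifold (𝓡 m) ∞ S] in
theorem pullback_eq_zero {θ : Form (m + 1) M m} {s : S} (h : θ s = 0) :
    Form.pullback (n' := m) (Subtype.val : S → M) θ s = 0 := by
  unfold Form.pullback
  rw [h]
  rfl

/-- By future orientation the chart and its trace on `S` have the same sign `c`, so both integrals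
are `c` times the two sides of Stokes' theorem on a half space. -/
theorem IsCauchyChart.stokesHolds (h : C.IsCauchyChart e ψ) (hS : C.IsCauchySurface S)
    {oM : ManifoldOrientation (m + 1) M} {oS : ManifoldOrientation m S}
    (hoS : C.IsFutureOriented oM S oS) {θ : Form (m + 1) M m} (hθ : θ.IsSmooth)
    {K : Set M} (hK : IsCompact K) (hKe : K ⊆ e.source) (hθK : ∀ x, x ∉ K → θ x = 0) :
    C.StokesHolds oM oS θ := by
  obtain ⟨η, hη1, hη2, hη3, hη4, hη5, hη6⟩ := exists_coord_extension h.chart hθ hK hKe hθK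
  obtain ⟨c, hc⟩ : ∃ c : ℝ, ∀ u ∈ e.target, oM.sgn e u = c := by
    by_cases hne : e.target.Nonempty
    · obtain ⟨u₀, hu₀⟩ := hne
      exact ⟨oM.sgn e u₀, fun u hu =>
        h.chart.sgn_eq_of_isPreconnected oM h.convex.isPreconnected le_rfl hu hu₀⟩
    · exact ⟨0, fun u hu => absurd ⟨u, hu⟩ hne⟩
  obtain ⟨s1, s2, -⟩ := integral_extDeriv_halfSpace hη1 hη2
  have hneg : MeasurableSet {u : Eu (m + 1) | u 0 < 0} :=
    (isOpen_Iio.preimage (EuclideanSpace.proj (𝕜 := ℝ) (0 : Fin (m + 1))).continuous).measurableSet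
  have hpos : MeasurableSet {u : Eu (m + 1) | 0 < u 0} :=
    (isOpen_Ioi.preimage (EuclideanSpace.proj (𝕜 := ℝ) (0 : Fin (m + 1))).continuous).measurableSet
  have hside : formIntegral oS (Form.pullback (n' := m) (Subtype.val : S → M) θ) =
      c * ∫ w : Eu m, η (consE 0 w) fun i => stdBasis (m + 1) i.succ := by
    have hK' : IsCompact ((Subtype.val : S → M) ⁻¹' K) :=
      hS.isClosed.isClosedEmbedding_subtypeVal.isCompact_preimage hK
    rw [h.chart'.formIntegral_eq (hθ.pullback hS.contMDiff_val).locallyIntegrable hK'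
      (fun y hy => h.mem_source y (hKe hy)) fun y hy => pullback_eq_zero (hθK _ hy),
      ← integral_const_mul]
    refine Eq.trans ?_ (setIntegral_eq_integral_of_forall_compl_eq_zero (s := ψ.target) ?_)
    · refine setIntegral_congr_fun ψ.open_target.measurableSet fun w hw => ?_
      have hw' := (h.mem_target w).1 hw
      rw [Form.density, h.sgn_eq hoS hS.contMDiff_val hw, hc _ hw',
        h.toIsSliceChart.coeff_pullback hS.contMDiff_val hw, hη3 _ hw']
    · intro w hw
      rw [hη4 _ fun h' => hw ((h.mem_target w).2 h')]
      exact mul_zero c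
  have hP := hS.isOpen_strictPast
  have hF := hS.isOpen_strictFuture
  constructor
  · rw [formIntegral_restrict_d h.chart hc hθ hK hKe hθK hη5 hη6 hP hneg h.mem_past, s1, hside]
  · rw [formIntegral_restrict_d h.chart hc hθ hK hKe hθK hη5 hη6 hF hpos h.mem_future, s2, hside]
    ring

/-- On its own side of `S` the exact form with compact support integrates to zero; on the other side
and on `S` there is nothing to integrate. -/
theorem stokesHolds_of_disjoint (hS : C.IsCauchySurface S) (he : IsSmoothChart e)
    (hconv : Convex ℝ e.target) (hside : e.source ⊆ C.strictPast S ∨ e.source ⊆ C.strictFuture S)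
    (oM : ManifoldOrientation (m + 1) M) (oS : ManifoldOrientation m S)
    {θ : Form (m + 1) M m} (hθ : θ.IsSmooth) {K : Set M} (hK : IsCompact K) (hKe : K ⊆ e.source)
    (hθK : ∀ x, x ∉ K → θ x = 0) : C.StokesHolds oM oS θ := by
  obtain ⟨η, hη1, hη2, hη3, hη4, hη5, hη6⟩ := exists_coord_extension he hθ hK hKe hθK
  obtain ⟨c, hc⟩ : ∃ c : ℝ, ∀ u ∈ e.target, oM.sgn e u = c := by
    by_cases hne : e.target.Nonempty
    · obtain ⟨u₀, hu₀⟩ := hne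
      exact ⟨oM.sgn e u₀, fun u hu =>
        he.sgn_eq_of_isPreconnected oM hconv.isPreconnected le_rfl hu hu₀⟩
    · exact ⟨0, fun u hu => absurd ⟨u, hu⟩ hne⟩
  obtain ⟨-, -, s3⟩ := integral_extDeriv_halfSpace hη1 hη2
  have hsplit := hS.causalSplitting
  have key : ∀ A : Set M, IsOpen A → (e.source ⊆ A ∨ Disjoint e.source A) →
      formIntegral oM (Form.restrict A (Form.d θ)) = 0 := by
    intro A hA hA'
    rcases hA' with h1 | h1
    · rw [formIntegral_restrict_d he hc hθ hK hKe hθK hη5 hη6 hA MeasurableSet.univ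
        fun u hu => ⟨fun _ => mem_univ u, fun _ => h1 (e.map_target hu)⟩, setIntegral_univ, s3,
        mul_zero]
    · rw [formIntegral_restrict_d he hc hθ hK hKe hθK hη5 hη6 hA MeasurableSet.empty
        fun u hu => ⟨fun h2 => (h1.le_bot ⟨e.map_target hu, h2⟩).elim, fun h2 => h2.elim⟩,
        setIntegral_empty, mul_zero]
  have hS0 : Form.pullback (n' := m) (Subtype.val : S → M) θ = 0 := by
    funext s
    refine pullback_eq_zero (hθK _ fun hsK => ?_)
    rcases hside with h1 | h1
    · exact hsplit.disjoint_past.le_bot ⟨h1 (hKe hsK), s.2⟩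
    · exact hsplit.disjoint_future.le_bot ⟨h1 (hKe hsK), s.2⟩
  unfold StokesHolds
  rw [hS0, formIntegral_zero, neg_zero]
  refine ⟨key _ hS.isOpen_strictPast (hside.imp_right fun h1 => ?_),
    key _ hS.isOpen_strictFuture (hside.symm.imp_right fun h1 => ?_)⟩
  · exact (hsplit.disjoint.mono_right h1).symm
  · exact hsplit.disjoint.mono_left h1

omit [IsManifold (𝓡 m) ∞ S] in
theorem exists_stokes_nhds [IsManifold (𝓡 m) ∞ S] (hS : C.IsCauchySurface S)
    {oM : ManifoldOrientation (m + 1) M} {oS : ManifoldOrientation m S}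
    (hoS : C.IsFutureOriented oM S oS) (x : M) :
    ∃ U : Set M, IsOpen U ∧ x ∈ U ∧ ∀ θ : Form (m + 1) M m, θ.IsSmooth → ∀ K : Set M, IsCompact K →
      K ⊆ U → (∀ x, x ∉ K → θ x = 0) → C.StokesHolds oM oS θ := by
  rcases hS.causalSplitting.cover x with h | h | h
  · obtain ⟨e, he, hx, heU, hconv⟩ := exists_convex_chart (n := m + 1) hS.isOpen_strictPast h
    exact ⟨e.source, e.open_source, hx, fun θ hθ K hK hKe hθK =>
      stokesHolds_of_disjoint hS he hconv (Or.inl heU) oM oS hθ hK hKe hθK⟩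
  · obtain ⟨e, ψ, he, hx⟩ := hS.exists_isCauchyChart ⟨x, h⟩
    exact ⟨e.source, e.open_source, hx, fun θ hθ K hK hKe hθK =>
      he.stokesHolds hS hoS hθ hK hKe hθK⟩
  · obtain ⟨e, he, hx, heU, hconv⟩ := exists_convex_chart (n := m + 1) hS.isOpen_strictFuture h
    exact ⟨e.source, e.open_source, hx, fun θ hθ K hK hKe hθK =>
      stokesHolds_of_disjoint hS he hconv (Or.inr heU) oM oS hθ hK hKe hθK⟩

theorem StokesHolds.add (hS : C.IsCauchySurface S) {oM : ManifoldOrientation (m + 1) M}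
    {oS : ManifoldOrientation m S} {θ η : Form (m + 1) M m} (hθ : θ.IsSmooth) (hη : η.IsSmooth)
    {K : Set M} (hK : IsCompact K) (hθK : ∀ x, x ∉ K → θ x = 0) (hηK : ∀ x, x ∉ K → η x = 0)
    (h1 : C.StokesHolds oM oS θ) (h2 : C.StokesHolds oM oS η) : C.StokesHolds oM oS (θ + η) := by
  have hK' : IsCompact ((Subtype.val : S → M) ⁻¹' K) :=
    hS.isClosed.isClosedEmbedding_subtypeVal.isCompact_preimage hK
  have hpb : Form.pullback (n' := m) (Subtype.val : S → M) (θ + η) =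
      Form.pullback (n' := m) (Subtype.val : S → M) θ + Form.pullback (n' := m) (Subtype.val : S → M) η := rfl
  have hres : ∀ A : Set M, IsOpen A → formIntegral oM (Form.restrict A (Form.d (θ + η))) =
      formIntegral oM (Form.restrict A (Form.d θ)) + formIntegral oM (Form.restrict A (Form.d η)) := by
    intro A hA
    have hadd : Form.restrict A (Form.d (θ + η)) =
        Form.restrict A (Form.d θ) + Form.restrict A (Form.d η) := by
      rw [Form.d_add hθ hη]
      funext x
      by_cases h : x ∈ A
      · rw [Pi.add_apply, Form.restrict_of_mem h, Form.restrict_of_mem h, Form.restrict_of_mem h,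
          Pi.add_apply]
      · rw [Pi.add_apply, Form.restrict_of_notMem h, Form.restrict_of_notMem h,
          Form.restrict_of_notMem h, add_zero]
    have hzero : ∀ ω' : Form (m + 1) M m, (∀ x, x ∉ K → ω' x = 0) →
        ∀ x, x ∉ K → Form.restrict A (Form.d ω') x = 0 := fun ω' h' x hx => by
      by_cases h : x ∈ A
      · rw [Form.restrict_of_mem h, Form.d_eq_zero_of_notMem hK.isClosed h' hx]
      · exact Form.restrict_of_notMem h
    rw [hadd, formIntegral_add (hθ.d.locallyIntegrable_restrict hA)
      (hη.d.locallyIntegrable_restrict hA) hK (hzero θ hθK) (hzero η hηK)]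
  have hpull : formIntegral oS (Form.pullback (n' := m) (Subtype.val : S → M) (θ + η)) =
      formIntegral oS (Form.pullback (n' := m) (Subtype.val : S → M) θ) +
        formIntegral oS (Form.pullback (n' := m) (Subtype.val : S → M) η) := by
    rw [hpb, formIntegral_add (hθ.pullback hS.contMDiff_val).locallyIntegrable
      (hη.pullback hS.contMDiff_val).locallyIntegrable hK'
      (fun y hy => pullback_eq_zero (hθK _ hy)) fun y hy => pullback_eq_zero (hηK _ hy)]
  unfold StokesHolds at h1 h2 ⊢
  rw [hres _ hS.isOpen_strictPast, hres _ hS.isOpen_strictFuture, hpull, h1.1, h1.2, h2.1, h2.2]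
  exact ⟨rfl, by ring⟩

/-- Stokes' theorem for compactly supported forms. -/
theorem IsCauchySurface.stokesHolds (hS : C.IsCauchySurface S)
    {oM : ManifoldOrientation (m + 1) M} {oS : ManifoldOrientation m S}
    (hoS : C.IsFutureOriented oM S oS) {θ : Form (m + 1) M m} (hθ : θ.IsSmooth) {K : Set M}
    (hK : IsCompact K) (hθK : ∀ x, x ∉ K → θ x = 0) : C.StokesHolds oM oS θ := by
  classical
  have : LocallyCompactSpace M := Manifold.locallyCompact_of_finiteDimensional (𝓡 (m + 1))
  choose U hUo hxU hU using exists_stokes_nhds hS hoS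
  obtain ⟨ρ, hρ⟩ := SmoothPartitionOfUnity.exists_isSubordinate (𝓡 (m + 1)) isClosed_univ U hUo
    fun x _ => mem_iUnion.2 ⟨x, hxU x⟩
  have hfin : {x | (Function.support (ρ x) ∩ K).Nonempty}.Finite :=
    ρ.locallyFinite.finite_nonempty_inter_compact hK
  have hsm : ∀ i, (Form.smulFun (ρ i) θ).IsSmooth := fun i => hθ.smulFun (ρ i).contMDiff
  have hzero : ∀ i, ∀ x, x ∉ K → Form.smulFun (ρ i) θ x = 0 := fun i x hx => by
    rw [Form.smulFun, hθK x hx, smul_zero]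
  have hst : ∀ i, C.StokesHolds oM oS (Form.smulFun (ρ i) θ) := fun i => by
    refine hU i _ (hsm i) (K ∩ tsupport (ρ i)) (hK.inter_right (isClosed_tsupport _))
      (inter_subset_right.trans (hρ i)) fun x hx => ?_
    by_cases h : x ∈ K
    · rw [Form.smulFun, image_eq_zero_of_notMem_tsupport fun h' => hx ⟨h, h'⟩, zero_smul]
    · exact hzero i x h
  have hsum : ∀ t : Finset M, (∑ i ∈ t, Form.smulFun (ρ i) θ).IsSmooth ∧
      (∀ x, x ∉ K → (∑ i ∈ t, Form.smulFun (ρ i) θ) x = 0) ∧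
      C.StokesHolds oM oS (∑ i ∈ t, Form.smulFun (ρ i) θ) := by
    intro t
    induction t using Finset.induction_on with
    | empty =>
      have h0 : ∀ x, x ∉ (∅ : Set M) → (0 : Form (m + 1) M m) x = 0 := fun x _ => rfl
      rw [Finset.sum_empty]
      refine ⟨Form.IsSmooth.zero, fun x _ => rfl, ?_⟩
      have hr : ∀ A : Set M, Form.restrict A (0 : Form (m + 1) M (m + 1)) = 0 := fun A => by
        funext x
        by_cases h : x ∈ A
        · exact Form.restrict_of_mem h
        · exact Form.restrict_of_notMem h
      have hp : Form.pullback (n' := m) (Subtype.val : S → M) (0 : Form (m + 1) M m) = 0 := rfl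
      unfold StokesHolds
      rw [Form.d_zero, hr, hr, hp, formIntegral_zero, formIntegral_zero, neg_zero]
      exact ⟨rfl, rfl⟩
    | insert i t hi ih =>
      rw [Finset.sum_insert hi]
      refine ⟨(hsm i).add ih.1, fun x hx => ?_,
        StokesHolds.add hS (hsm i) ih.1 hK (hzero i) ih.2.1 (hst i) ih.2.2⟩
      rw [Pi.add_apply, hzero i x hx, ih.2.1 x hx, add_zero]
  have heq : θ = ∑ i ∈ hfin.toFinset, Form.smulFun (ρ i) θ := by
    funext x
    rw [Finset.sum_apply]
    by_cases h : x ∈ K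
    · have h7 : ∑ i ∈ hfin.toFinset, ρ i x = 1 := by
        rw [← ρ.sum_eq_one (mem_univ x), finsum_eq_sum_of_support_subset (s := hfin.toFinset)]
        intro i hi
        rw [Finite.coe_toFinset]
        exact ⟨_, hi, h⟩
      simp only [Form.smulFun]
      rw [← Finset.sum_smul, h7, one_smul]
    · rw [hθK x h]
      exact (Finset.sum_eq_zero fun i _ => hzero i x h).symm
  rw [heq]
  exact (hsum _).2.2

theorem exists_cutoff {Q : Set M} (hQ : IsCompact Q) :
    ∃ (χ : M → ℝ) (K : Set M), ContMDiff (𝓡 (m + 1)) 𝓘(ℝ, ℝ) ∞ χ ∧ IsCompact K ∧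
      (∀ x ∈ Q, ∀ᶠ y in 𝓝 x, χ y = 1) ∧ ∀ x, x ∉ K → χ x = 0 := by
  have : LocallyCompactSpace M := Manifold.locallyCompact_of_finiteDimensional (𝓡 (m + 1))
  obtain ⟨K, hK, hQK⟩ := exists_compact_superset hQ
  obtain ⟨χ, h1, h2, -⟩ := exists_contMDiffMap_one_nhds_of_subset_interior (n := ⊤) (𝓡 (m + 1))
    hQ.isClosed hQK
  exact ⟨χ, K, χ.contMDiff, hK, fun x hx => (eventually_nhdsSet_iff_forall.1 h1) x hx, h2⟩

omit [SecondCountableTopology M] [IsManifold (𝓡 (m + 1)) ∞ M] [IsManifold (𝓡 m) ∞ S] in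
-- On `A ∪ S` the form vanishes off `Q`, and the cutoff is one near `Q`. Neither the exterior
-- derivative on the open set `A` nor the pullback to `S` notices it, so only the support on one
-- side of `S` has to be compact.
theorem cutoff_side {θ : Form (m + 1) M m} {χ : M → ℝ}
    {Q A : Set M} (hQ : IsCompact Q) (hA : IsOpen A) (hχ : ∀ x ∈ Q, ∀ᶠ y in 𝓝 x, χ y = 1)
    (hθQ : ∀ x ∈ A ∪ S, x ∉ Q → θ x = 0) :
    Form.restrict A (Form.d (Form.smulFun χ θ)) = Form.restrict A (Form.d θ) ∧
      Form.pullback (n' := m) (Subtype.val : S → M) (Form.smulFun χ θ) =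
        Form.pullback (n' := m) (Subtype.val : S → M) θ := by
  constructor
  · funext x
    by_cases h : x ∈ A
    · rw [Form.restrict_of_mem h, Form.restrict_of_mem h]
      refine Form.d_congr ?_
      by_cases hx : x ∈ Q
      · filter_upwards [hχ x hx] with y hy
        rw [Form.smulFun, hy, one_smul]
      · filter_upwards [hA.mem_nhds h, hQ.isClosed.isOpen_compl.mem_nhds hx] with y hy hy'
        rw [Form.smulFun, hθQ y (Or.inl hy) hy', smul_zero]
    · rw [Form.restrict_of_notMem h, Form.restrict_of_notMem h]
  · funext s
    have : Form.smulFun χ θ s = θ s := by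
      by_cases hx : (s : M) ∈ Q
      · rw [Form.smulFun, (hχ s hx).self_of_nhds, one_smul]
      · rw [Form.smulFun, hθQ s (Or.inr s.2) hx, smul_zero]
    unfold Form.pullback
    rw [this]

/-- Stokes' theorem for forms with compact support to the past of a Cauchy surface. -/
theorem IsCauchySurface.stokes_past (hS : C.IsCauchySurface S)
    {oM : ManifoldOrientation (m + 1) M} {oS : ManifoldOrientation m S}
    (hoS : C.IsFutureOriented oM S oS) {θ : Form (m + 1) M m} (hθ : θ.IsSmooth) {Q : Set M}
    (hQ : IsCompact Q) (hθQ : ∀ x ∈ C.strictPast S ∪ S, x ∉ Q → θ x = 0) :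
    formIntegral oM (Form.restrict (C.strictPast S) (Form.d θ)) =
      formIntegral oS (Form.pullback (n' := m) (Subtype.val : S → M) θ) := by
  obtain ⟨χ, K, hχ, hK, h1, h2⟩ := exists_cutoff (m := m) hQ
  obtain ⟨h3, h4⟩ := cutoff_side hQ hS.isOpen_strictPast h1 hθQ
  rw [← h3, ← h4]
  exact (hS.stokesHolds hoS (hθ.smulFun hχ) hK fun x hx => by
    rw [Form.smulFun, h2 x hx, zero_smul]).1

/-- Stokes' theorem for forms with compact support to the future of a Cauchy surface. -/
theorem IsCauchySurface.stokes_future (hS : C.IsCauchySurface S)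
    {oM : ManifoldOrientation (m + 1) M} {oS : ManifoldOrientation m S}
    (hoS : C.IsFutureOriented oM S oS) {θ : Form (m + 1) M m} (hθ : θ.IsSmooth) {Q : Set M}
    (hQ : IsCompact Q) (hθQ : ∀ x ∈ C.strictFuture S ∪ S, x ∉ Q → θ x = 0) :
    formIntegral oM (Form.restrict (C.strictFuture S) (Form.d θ)) =
      -formIntegral oS (Form.pullback (n' := m) (Subtype.val : S → M) θ) := by
  obtain ⟨χ, K, hχ, hK, h1, h2⟩ := exists_cutoff (m := m) hQ
  obtain ⟨h3, h4⟩ := cutoff_side hQ hS.isOpen_strictFuture h1 hθQ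
  rw [← h3, ← h4]
  exact (hS.stokesHolds hoS (hθ.smulFun hχ) hK fun x hx => by
    rw [Form.smulFun, h2 x hx, zero_smul]).2

end ChronalConeBundle

end Stokes

/-! ### Splitting integrals along a Cauchy surface -/

section SplitIntegral

variable {m : ℕ} {M : Type*} [TopologicalSpace M] [ChartedSpace (Eu (m + 1)) M]
  [IsManifold (𝓡 (m + 1)) ∞ M] [T2Space M] [SecondCountableTopology M]

theorem volume_first_coordinate (m : ℕ) : volume {u : Eu (m + 1) | u 0 = 0} = 0 := by
  have h1 : {u : Eu (m + 1) | u 0 = 0} =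
      ((EuclideanSpace.proj (𝕜 := ℝ) (0 : Fin (m + 1)) : Eu (m + 1) →L[ℝ] ℝ).ker : Set _) := by
    ext u
    simp
  rw [h1]
  refine Measure.addHaar_submodule _ _ fun h => ?_
  have h2 : EuclideanSpace.single (0 : Fin (m + 1)) (1 : ℝ) ∈
      (EuclideanSpace.proj (𝕜 := ℝ) (0 : Fin (m + 1)) : Eu (m + 1) →L[ℝ] ℝ).ker := by
    rw [h]
    exact Submodule.mem_top
  rw [LinearMap.mem_ker] at h2
  simp at h2

namespace ChronalConeBundle

variable {C : ChronalConeBundle m M} {S : Set M} [ChartedSpace (Eu m) S]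

/-- A Cauchy surface is a null set in every chart. -/
theorem IsCauchySurface.volume_chart (hS : C.IsCauchySurface S)
    {e : OpenPartialHomeomorph M (Eu (m + 1))} (he : IsSmoothChart e) :
    volume (e.target ∩ e.symm ⁻¹' S) = 0 := by
  refine measure_null_of_locally_null _ fun u hu => ?_
  obtain ⟨c, ψ, hc, hx⟩ := hS.exists_isCauchyChart ⟨e.symm u, hu.2⟩
  refine ⟨(e.target ∩ e.symm ⁻¹' c.source) ∩ (e.target ∩ e.symm ⁻¹' S),
    Filter.inter_mem (mem_nhdsWithin_of_mem_nhds
      ((IsSmoothChart.isOpen_transition e c).mem_nhds ⟨hu.1, hx⟩)) self_mem_nhdsWithin, ?_⟩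
  -- In a Cauchy chart `S` is a hyperplane, and a differentiable transition map carries null sets to
  -- null sets.
  have h0 : volume ((c.target ∩ c.symm ⁻¹' e.source) ∩ {u : Eu (m + 1) | u 0 = 0}) = 0 :=
    measure_mono_null inter_subset_right (volume_first_coordinate m)
  refine measure_mono_null ?_ (addHaar_image_eq_zero_of_differentiableOn_of_addHaar_eq_zero
    (f := e ∘ c.symm) volume
    (((hc.chart.contDiffOn_transition he).differentiableOn (by simp)).mono inter_subset_left) h0)
  rintro w ⟨⟨hw, hwc⟩, -, hwS⟩
  have hwc' : c (e.symm w) ∈ c.target := c.map_source hwc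
  have hinv : c.symm (c (e.symm w)) = e.symm w := c.left_inv hwc
  refine ⟨c (e.symm w), ⟨⟨hwc', ?_⟩, ?_⟩, ?_⟩
  · change c.symm (c (e.symm w)) ∈ e.source
    rw [hinv]
    exact e.map_target hw
  · have hsplit := hS.causalSplitting
    have hmem : c.symm (c (e.symm w)) ∈ S := by rw [hinv]; exact hwS
    rcases lt_trichotomy (c (e.symm w) 0) 0 with h | h | h
    · exact (hsplit.disjoint_past.le_bot ⟨(hc.mem_past _ hwc').2 h, hmem⟩).elim
    · exact h
    · exact (hsplit.disjoint_future.le_bot ⟨(hc.mem_future _ hwc').2 h, hmem⟩).elim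
  · change e (c.symm (c (e.symm w))) = w
    rw [hinv, e.right_inv hw]

/-- Only the null set `S` is missing from the past and the future together. -/
theorem IsCauchySurface.formIntegral_split (hS : C.IsCauchySurface S)
    {oM : ManifoldOrientation (m + 1) M} {θ : Form (m + 1) M (m + 1)} (hθ : θ.IsSmooth) {K : Set M}
    (hK : IsCompact K) (hθK : ∀ x, x ∉ K → θ x = 0) :
    formIntegral oM θ = formIntegral oM (Form.restrict (C.strictPast S) θ) +
      formIntegral oM (Form.restrict (C.strictFuture S) θ) := by
  have hz : ∀ A : Set M, ∀ x, x ∉ K → Form.restrict A θ x = 0 := fun A x hx => by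
    by_cases h : x ∈ A
    · rw [Form.restrict_of_mem h, hθK x hx]
    · exact Form.restrict_of_notMem h
  rw [← formIntegral_add (hθ.locallyIntegrable_restrict hS.isOpen_strictPast)
    (hθ.locallyIntegrable_restrict hS.isOpen_strictFuture) hK (hz _) (hz _),
    formIntegral_eq, formIntegral_eq]
  refine finsum_congr fun x => ?_
  set e := chartAt (Eu (m + 1)) x
  have hnull := hS.volume_chart (e := e) (isSmoothChart_chartAt x)
  refine setIntegral_congr_ae e.open_target.measurableSet ?_
  have h1 : ∀ᵐ u, u ∉ e.target ∩ e.symm ⁻¹' S := measure_eq_zero_iff_ae_notMem.1 hnull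
  filter_upwards [h1] with u hu hut
  have hsplit := hS.causalSplitting
  have h2 : θ.density oM e u = (Form.restrict (C.strictPast S) θ +
      Form.restrict (C.strictFuture S) θ).density oM e u := by
    rw [Form.density_add, Form.density_restrict, Form.density_restrict]
    rcases hsplit.cover (e.symm u) with h | h | h
    · have h' : u ∉ e.symm ⁻¹' C.strictFuture S := fun h' => hsplit.disjoint.le_bot ⟨h, h'⟩
      rw [indicator_of_mem (show u ∈ e.symm ⁻¹' C.strictPast S from h), indicator_of_notMem h',
        add_zero]
    · exact (hu ⟨hut, h⟩).elim
    · have h' : u ∉ e.symm ⁻¹' C.strictPast S := fun h' => hsplit.disjoint.le_bot ⟨h', h⟩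
      rw [indicator_of_mem (show u ∈ e.symm ⁻¹' C.strictFuture S from h), indicator_of_notMem h',
        zero_add]
  rw [h2]

end ChronalConeBundle

end SplitIntegral

/-! ### Green functions and the Green pairing -/

section Green

variable {m : ℕ} {M : Type*} [TopologicalSpace M] [ChartedSpace (Eu (m + 1)) M]
  [IsManifold (𝓡 (m + 1)) ∞ M]
  {V : Type*} [NormedAddCommGroup V] [NormedSpace ℝ V]
  {F : M → Type*} [TopologicalSpace (TotalSpace V F)] [∀ x, AddCommGroup (F x)]
  [∀ x, Module ℝ (F x)] [∀ x, TopologicalSpace (F x)] [FiberBundle V F] [VectorBundle ℝ V F]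

theorem LinearMap.map_sub_add_map {A B : Type*} [AddCommGroup A] [Module ℝ A] [AddCommMonoid B]
    [Module ℝ B] (T : A →ₗ[ℝ] B) (a b : A) : T (a - b) + T b = T a := by
  rw [← map_add, sub_add_cancel]

theorem eq_zero_of_notMem_supp {X : Type*} [TopologicalSpace X] {V : X → Type*} [∀ x, Zero (V x)]
    {φ : ∀ x, V x} {x : X} (hx : x ∉ supp φ) : φ x = 0 := by
  by_contra h
  exact hx (subset_closure h)

theorem supp_subset {X : Type*} [TopologicalSpace X] {V : X → Type*} [∀ x, Zero (V x)]
    {φ : ∀ x, V x} {A : Set X} (hA : IsClosed A) (h : ∀ x, x ∉ A → φ x = 0) : supp φ ⊆ A :=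
  closure_minimal (fun x hx => by_contra fun hxA => hx (h x hxA)) hA

omit [IsManifold (𝓡 (m + 1)) ∞ M] in
-- Off its support a section vanishes in a neighbourhood. Hence a Green form vanishes off the
-- support of either argument.
theorem jetVanishes_of_notMem_supp (k : ℕ) {φ : Sections m V F} {x : M} (hx : x ∉ supp φ) :
    JetVanishes k φ x := by
  intro i _
  have h0 : ∀ᶠ y in 𝓝 x, φ y = 0 :=
    Filter.mem_of_superset (isClosed_closure.isOpen_compl.mem_nhds hx)
      fun y hy => eq_zero_of_notMem_supp hy
  have h1 : ∀ᶠ y in 𝓝 x, y ∈ (trivializationAt V F x).baseSet :=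
    (trivializationAt V F x).open_baseSet.mem_nhds (FiberBundle.mem_baseSet_trivializationAt' x)
  have h2 : Tendsto (extChartAt (𝓡 (m + 1)) x).symm (𝓝 (extChartAt (𝓡 (m + 1)) x x)) (𝓝 x) := by
    have := continuousAt_extChartAt_symm (I := 𝓡 (m + 1)) x
    unfold ContinuousAt at this
    rwa [extChartAt_to_inv] at this
  have h3 : (fun u : Eu (m + 1) =>
      (trivializationAt V F x (TotalSpace.mk' V ((extChartAt (𝓡 (m + 1)) x).symm u)
        (φ ((extChartAt (𝓡 (m + 1)) x).symm u)))).2) =ᶠ[𝓝 (extChartAt (𝓡 (m + 1)) x x)]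
      fun _ => 0 := by
    filter_upwards [h2.eventually h0, h2.eventually h1] with u hu hu'
    rw [hu]
    exact congrArg Prod.snd ((trivializationAt V F x).zeroSection ℝ hu')
  rw [(h3.iteratedFDeriv ℝ i).self_of_nhds]
  simp

variable {f fs : Sections m V F →ₗ[ℝ] DualDensities m V F}
  {G : Sections m V F →ₗ[ℝ] Sections m V F →ₗ[ℝ] smoothForms (m + 1) M m}

omit [IsManifold (𝓡 (m + 1)) ∞ M] in
theorem IsGreenForm.eq_zero_of_left (hG : IsGreenForm f fs G) {φ ψ : Sections m V F} {x : M}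
    (hx : x ∉ supp φ) : (G φ ψ).1 x = 0 :=
  hG.isBilinDiffOp.choose_spec φ ψ x (Or.inl (jetVanishes_of_notMem_supp _ hx))

/-- The Green form of the adjoint pair. -/
theorem IsGreenForm.flip (hG : IsGreenForm f fs G) : IsGreenForm fs f ((-1 : ℝ) • G.flip) where
  isBilinDiffOp := by
    obtain ⟨k, hk⟩ := hG.isBilinDiffOp
    refine ⟨k, fun φ ψ x h => ?_⟩
    change (-1 : ℝ) • ((G ψ φ).1 x) = 0
    rw [hk ψ φ x h.symm, smul_zero]
  green φ ψ := by
    have h1 : Form.d (G ψ φ).1 + Form.d (-(G ψ φ).1) = 0 := by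
      rw [← Form.d_add (G ψ φ).2 ((smoothForms (m + 1) M m).neg_mem (G ψ φ).2), add_neg_cancel,
        Form.d_zero]
    have h2 : (((-1 : ℝ) • G.flip) φ ψ).1 = -(G ψ φ).1 := neg_one_smul ℝ (G ψ φ).1
    rw [h2, ← neg_eq_of_add_eq_zero_right h1, ← hG.green ψ φ, neg_sub]

omit [IsManifold (𝓡 (m + 1)) ∞ M] in
theorem DualDensities.eq_zero_of_add_right {α β : DualDensities m V F} (h : α + β = β) : α = 0 := by
  refine Subtype.ext (funext fun x => LinearMap.ext fun v => ?_)
  have h1 : α.1 x v + β.1 x v = β.1 x v := congrArg (fun γ : DualDensities m V F => γ.1 x v) h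
  exact left_eq_add.1 (h1.symm.trans (add_comm _ _))

namespace IsGreenHyperbolic

variable {C : ChronalConeBundle m M}

/-- Uniqueness identifies the chosen solution with the one that has the sharp support bound. -/
theorem retardedGreen_spec (h : IsGreenHyperbolic C f) {α : DualDensities m V F}
    (hα : C.IsRetarded (supp α.1)) :
    C.IsRetarded (supp (retardedGreen C f α)) ∧ f (retardedGreen C f α) = α ∧
      supp (retardedGreen C f α) ⊆ closure (C.future (supp α.1)) := by
  obtain ⟨φ, h1, h2, h3, h4⟩ := h.retarded α hα
  have hex : ∃ φ : Sections m V F, C.IsRetarded (supp φ) ∧ f φ = α := ⟨φ, h1, h2⟩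
  have h5 : retardedGreen C f α = φ := by
    rw [retardedGreen, dif_pos hex]
    exact h4 _ hex.choose_spec.1 hex.choose_spec.2
  rw [h5]
  exact ⟨h1, h2, h3⟩

theorem advancedGreen_spec (h : IsGreenHyperbolic C f) {α : DualDensities m V F}
    (hα : C.IsAdvanced (supp α.1)) :
    C.IsAdvanced (supp (advancedGreen C f α)) ∧ f (advancedGreen C f α) = α ∧
      supp (advancedGreen C f α) ⊆ closure (C.past (supp α.1)) := by
  obtain ⟨φ, h1, h2, h3, h4⟩ := h.advanced α hα
  have hex : ∃ φ : Sections m V F, C.IsAdvanced (supp φ) ∧ f φ = α := ⟨φ, h1, h2⟩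
  have h5 : advancedGreen C f α = φ := by
    rw [advancedGreen, dif_pos hex]
    exact h4 _ hex.choose_spec.1 hex.choose_spec.2
  rw [h5]
  exact ⟨h1, h2, h3⟩

theorem causalGreen_mem (h : IsGreenHyperbolic C f) {α : DualDensities m V F}
    (hα : α ∈ compactDualDensities m V F) : causalGreen C f α ∈ solutionsSC C f := by
  have hα' : IsCompact (supp α.1) := hα
  obtain ⟨-, h1, h2⟩ := h.retardedGreen_spec hα'.isRetarded
  obtain ⟨-, h3, h4⟩ := h.advancedGreen_spec hα'.isAdvanced
  refine ⟨DualDensities.eq_zero_of_add_right (β := α) ?_, supp α.1, hα', ?_⟩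
  · have h0 := LinearMap.map_sub_add_map f (retardedGreen C f α) (advancedGreen C f α)
    rw [h1, h3] at h0
    exact h0
  refine supp_subset isClosed_closure fun x hx => ?_
  have h5 : retardedGreen C f α x = 0 := eq_zero_of_notMem_supp fun h' => hx
    (closure_mono (fun y hy => Or.inl (Or.inl hy)) (h2 h'))
  have h6 : advancedGreen C f α x = 0 := eq_zero_of_notMem_supp fun h' => hx
    (closure_mono (fun y hy => Or.inl (Or.inr hy)) (h4 h'))
  rw [causalGreen, ContMDiffSection.coe_sub, Pi.sub_apply, h5, h6, sub_zero]

variable [T2Space M] [SecondCountableTopology M] {S : Set M} [ChartedSpace (Eu m) S]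

/-- The support of `ψ` alone controls that of the Green form, and it meets the Cauchy surface in a
compact set. -/
theorem isCompact_supp_greenIntegrand (hS : C.IsCauchySurface S) (hG : IsGreenForm f fs G)
    {ψ : Sections m V F} (hψ : C.IsSpacelikeCompact (supp ψ)) (ξ : Sections m V F) :
    IsCompact (supp (greenIntegrand G S ψ ξ)) := by
  obtain ⟨Q, hQ, hQS⟩ := hS.exists_compact_spacelikeCompact hψ
  have hK : IsCompact ((Subtype.val : S → M) ⁻¹' Q) :=
    hS.isClosed.isClosedEmbedding_subtypeVal.isCompact_preimage hQ
  have hc : IsClosed ((Subtype.val : S → M) ⁻¹' Q) := hQ.isClosed.preimage continuous_subtype_val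
  refine hK.of_isClosed_subset isClosed_closure (supp_subset hc fun s hs => ?_)
  exact ChronalConeBundle.pullback_eq_zero (hG.eq_zero_of_left fun h => hs (hQS ⟨h, s.2⟩))

variable [IsManifold (𝓡 m) ∞ S]

/-- The Green pairing of a causal solution `G[α]` with a solution of the adjoint equation. -/
theorem greenPairing_causalGreen (hC : IsGreenHyperbolic C f) (hG : IsGreenForm f fs G)
    (hS : C.IsCauchySurface S) {oM : ManifoldOrientation (m + 1) M} {oS : ManifoldOrientation m S}
    (hoS : C.IsFutureOriented oM S oS) {α : DualDensities m V F}
    (hα : α ∈ compactDualDensities m V F) {ξ : Sections m V F} (hξ : fs ξ = 0) :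
    greenPairing G S oS (causalGreen C f α) ξ = formIntegral oM (contract α ξ) := by
  have hα' : IsCompact (supp α.1) := hα
  obtain ⟨h1, h2, -⟩ := hC.retardedGreen_spec hα'.isRetarded
  obtain ⟨h3, h4, -⟩ := hC.advancedGreen_spec hα'.isAdvanced
  set φ := retardedGreen C f α
  set φ' := advancedGreen C f α
  obtain ⟨Q, hQ, hQS⟩ := hS.exists_compact_retarded h1
  obtain ⟨Q', hQ', hQS'⟩ := hS.exists_compact_advanced h3
  -- As `fs ξ = 0`, the Green forms of the retarded and of the advanced solution with `ξ` have the
  -- same exterior derivative.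
  have hd : ∀ χ : Sections m V F, f χ = α → Form.d (G χ ξ).1 = contract α ξ := fun χ hχ => by
    rw [← hG.green χ ξ, hχ, hξ]
    exact sub_zero _
  have hz : ∀ x ∈ C.strictPast S ∪ S, x ∉ Q → (G φ ξ).1 x = 0 := fun x hx hxQ =>
    hG.eq_zero_of_left fun h => hxQ (hQS ⟨h, hx⟩)
  have hz' : ∀ x ∈ C.strictFuture S ∪ S, x ∉ Q' → (G φ' ξ).1 x = 0 := fun x hx hxQ =>
    hG.eq_zero_of_left fun h => hxQ (hQS' ⟨h, hx⟩)
  have e1 := hS.stokes_past hoS (G φ ξ).2 hQ hz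
  have e2 := hS.stokes_future hoS (G φ' ξ).2 hQ' hz'
  rw [hd φ h2] at e1
  rw [hd φ' h4] at e2
  -- The two boundary forms have compact support separately, so their integrals over `S` may be
  -- subtracted.
  have hK : IsCompact ((Subtype.val : S → M) ⁻¹' (Q ∪ Q')) :=
    hS.isClosed.isClosedEmbedding_subtypeVal.isCompact_preimage (hQ.union hQ')
  have hsm : (Form.pullback (n' := m) (Subtype.val : S → M) (G φ ξ).1).IsSmooth :=
    (G φ ξ).2.pullback hS.contMDiff_val
  have hsm' : (-Form.pullback (n' := m) (Subtype.val : S → M) (G φ' ξ).1).IsSmooth :=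
    (smoothForms m S m).neg_mem ((G φ' ξ).2.pullback hS.contMDiff_val)
  have e3 : greenIntegrand G S (causalGreen C f α) ξ =
      Form.pullback (n' := m) (Subtype.val : S → M) (G φ ξ).1 +
        -Form.pullback (n' := m) (Subtype.val : S → M) (G φ' ξ).1 := by
    have h5 : (G (φ - φ') ξ).1 + (G φ' ξ).1 = (G φ ξ).1 := by
      rw [← LinearMap.map_sub_add_map G φ φ']
      rfl
    rw [← eq_sub_iff_add_eq] at h5
    change Form.pullback (n' := m) (Subtype.val : S → M) (G (φ - φ') ξ).1 = _
    rw [h5, sub_eq_add_neg]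
    rfl
  rw [greenPairing, e3, formIntegral_add hsm.locallyIntegrable hsm'.locallyIntegrable hK
    (fun s hs => ChronalConeBundle.pullback_eq_zero (hz s (Or.inr s.2) fun h => hs (Or.inl h)))
    (fun s hs => by
      rw [Pi.neg_apply,
        ChronalConeBundle.pullback_eq_zero (hz' s (Or.inr s.2) fun h => hs (Or.inr h)), neg_zero]),
    formIntegral_neg, ← e1, ← e2]
  refine (hS.formIntegral_split (α.2 ξ) hα' fun x hx => ?_).symm
  change α.1 x (ξ x) = 0
  rw [eq_zero_of_notMem_supp hx]
  rfl

/-- The Green pairing of a solution with a causal solution of the adjoint equation. -/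
theorem greenPairing_causalGreen_right (hC : IsGreenHyperbolic C fs) (hG : IsGreenForm f fs G)
    (hS : C.IsCauchySurface S) {oM : ManifoldOrientation (m + 1) M} {oS : ManifoldOrientation m S}
    (hoS : C.IsFutureOriented oM S oS) {β : DualDensities m V F}
    (hβ : β ∈ compactDualDensities m V F) {ψ : Sections m V F} (hψ : f ψ = 0) :
    greenPairing G S oS ψ (causalGreen C fs β) = -formIntegral oM (contract β ψ) := by
  -- The roles of `f` and `fs` are exchanged; the Green form of the exchanged pair contributes the
  -- sign.
  rw [← hC.greenPairing_causalGreen hG.flip hS hoS hβ hψ, greenPairing, greenPairing,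
    ← formIntegral_neg]
  congr 1
  have h1 : (((-1 : ℝ) • G.flip) (causalGreen C fs β) ψ).1 = -(G ψ (causalGreen C fs β)).1 :=
    neg_one_smul ℝ (G ψ (causalGreen C fs β)).1
  rw [greenIntegrand, greenIntegrand, h1]
  funext s
  ext v
  exact (neg_neg _).symm

end IsGreenHyperbolic

end Green

/-! ### Test densities -/

section TestForms

variable {n : ℕ} {N : Type*} [TopologicalSpace N] [ChartedSpace (Eu n) N]
  {e : OpenPartialHomeomorph N (Eu n)}

/-- The determinant of `n` vectors of `ℝⁿ`. -/
def detForm (n : ℕ) : Eu n [⋀^Fin n]→L[ℝ] ℝ :=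
  { (stdBasis n).det with
    cont := by
      have h1 : Continuous fun v : Fin n → Eu n =>
          (Matrix.of fun i j => v j i : Matrix (Fin n) (Fin n) ℝ).det :=
        Continuous.matrix_det (continuous_matrix fun i j =>
          (EuclideanSpace.proj (𝕜 := ℝ) i).continuous.comp (continuous_apply j))
      exact h1 }

theorem detForm_stdBasis (n : ℕ) : (detForm n fun i => stdBasis n i) = 1 := (stdBasis n).det_self

/-- The coordinate volume form of a chart. -/
def chartVolume (e : OpenPartialHomeomorph N (Eu n)) : Form n N n := fun y =>
  (detForm n).compContinuousLinearMap (chartD e y)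

theorem coord_smulFun_chartVolume (he : IsSmoothChart e) (h : N → ℝ) {u : Eu n}
    (hu : u ∈ e.target) : (Form.smulFun h (chartVolume e)).coord e u = h (e.symm u) • detForm n := by
  ext v
  change h (e.symm u) * detForm n (fun i => chartD e (e.symm u) (symmD e u (v i))) = _
  simp only [he.chartD_symmD hu]
  rfl

/-- Outside the domain of `e` the form `chartVolume e` carries no information. There the factor `h`
vanishes in a neighbourhood of each point, since `K` is closed and inside the domain. -/
theorem isSmooth_smulFun_chartVolume [IsManifold (𝓡 n) ∞ N] (he : IsSmoothChart e) {h : N → ℝ}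
    (hh : ContMDiffOn (𝓡 n) 𝓘(ℝ, ℝ) ∞ h e.source) {K : Set N} (hK : IsClosed K)
    (hKe : K ⊆ e.source) (hhK : ∀ y, y ∉ K → h y = 0) :
    (Form.smulFun h (chartVolume e)).IsSmooth := by
  refine Form.isSmooth_of_charts fun y => ?_
  by_cases hy : y ∈ e.source
  · refine ⟨e, he, hy, ?_⟩
    have hu := e.map_source hy
    have h1 : ContDiffAt ℝ ∞ (h ∘ e.symm) (e y) := by
      rw [← contMDiffAt_iff_contDiffAt]
      refine ContMDiffAt.comp (e y) (g := h) (f := e.symm) (hh.contMDiffAt ?_)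
        (he.contMDiffOn_symm.contMDiffAt (e.open_target.mem_nhds hu))
      exact e.open_source.mem_nhds (e.map_target hu)
    exact (h1.smul contDiffAt_const).congr_of_eventuallyEq
      (Filter.mem_of_superset (e.open_target.mem_nhds hu)
        fun u hu => coord_smulFun_chartVolume he h hu)
  · set c := chartAt (Eu n) y
    refine ⟨c, isSmoothChart_chartAt y, mem_chart_source _ y, ?_⟩
    have h1 : ∀ᶠ u in 𝓝 (c y), c.symm u ∉ K := by
      have h2 : ContinuousAt c.symm (c y) := c.continuousAt_symm (mem_chart_target _ y)
      refine h2.preimage_mem_nhds (hK.isOpen_compl.mem_nhds ?_)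
      rw [c.left_inv (mem_chart_source _ y)]
      exact fun h => hy (hKe h)
    refine (contDiffAt_const (c := 0)).congr_of_eventuallyEq (h1.mono fun u hu => ?_)
    ext v
    change h (c.symm u) * _ = 0
    rw [hhK _ hu, zero_mul]

/-- A convex chart has constant sign, so up to sign the integral is that of a continuous
non-negative function which is positive somewhere. -/
theorem formIntegral_smulFun_chartVolume_ne_zero [IsManifold (𝓡 n) ∞ N] [T2Space N]
    [SecondCountableTopology N] (he : IsSmoothChart e) (hconv : Convex ℝ e.target)
    (o : ManifoldOrientation n N) {h : N → ℝ}
    (hh : ContMDiffOn (𝓡 n) 𝓘(ℝ, ℝ) ∞ h e.source) {K : Set N} (hK : IsCompact K)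
    (hKe : K ⊆ e.source) (hhK : ∀ y, y ∉ K → h y = 0) (h0 : ∀ y, 0 ≤ h y) {x : N}
    (hx : x ∈ e.source) (hxh : 0 < h x) :
    formIntegral o (Form.smulFun h (chartVolume e)) ≠ 0 := by
  have hsm := isSmooth_smulFun_chartVolume he hh hK.isClosed hKe hhK
  have hθK : ∀ y, y ∉ K → Form.smulFun h (chartVolume e) y = 0 := fun y hy => by
    rw [Form.smulFun, hhK y hy, zero_smul]
  rw [he.formIntegral_eq hsm.locallyIntegrable hK hKe hθK]
  have hu := e.map_source hx
  set c := o.sgn e (e x) with hc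
  have hdens : ∀ u ∈ e.target, (Form.smulFun h (chartVolume e)).density o e u =
      c * h (e.symm u) := fun u hu' => by
    rw [Form.density, Form.coeff_eq, coord_smulFun_chartVolume he h hu',
      he.sgn_eq_of_isPreconnected o hconv.isPreconnected le_rfl hu' hu]
    change c * (h (e.symm u) * detForm n _) = _
    rw [detForm_stdBasis, mul_one]
  rw [setIntegral_congr_fun e.open_target.measurableSet hdens, integral_const_mul]
  have hc0 : c ≠ 0 := by
    rcases o.sgn_eq_one_or e (e x) with h | h <;> rw [hc, h] <;> norm_num
  refine mul_ne_zero hc0 (ne_of_gt ?_)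
  have hcont : ContinuousOn (fun u => h (e.symm u)) e.target :=
    hh.continuousOn.comp e.continuousOn_symm fun u hu => e.map_target hu
  have hKc := isCompact_image_chart hK hKe
  have hint : IntegrableOn (fun u => h (e.symm u)) e.target := by
    refine ((hcont.mono (image_chart_subset hKe)).integrableOn_compact hKc).of_forall_sdiff_eq_zero
      e.open_target.measurableSet fun u hu => ?_
    exact hhK _ (notMem_of_notMem_image hu.1 hu.2)
  rw [setIntegral_pos_iff_support_of_nonneg_ae (ae_of_all _ fun u => h0 _) hint]
  have hopen : IsOpen (e.target ∩ (fun u => h (e.symm u)) ⁻¹' Ioi 0) :=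
    hcont.isOpen_inter_preimage e.open_target isOpen_Ioi
  refine (hopen.measure_pos volume ⟨e x, hu, ?_⟩).trans_le (measure_mono ?_)
  · change 0 < h (e.symm (e x))
    rwa [e.left_inv hx]
  · exact fun u hu' => ⟨ne_of_gt hu'.2, hu'.1⟩

end TestForms

/-! ### Test densities separate sections -/

section TestDensities

variable {m : ℕ} {M : Type*} [TopologicalSpace M] [ChartedSpace (Eu (m + 1)) M]
  [IsManifold (𝓡 (m + 1)) ∞ M] [T2Space M] [SecondCountableTopology M]
  {V : Type*} [NormedAddCommGroup V] [NormedSpace ℝ V]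
  {F : M → Type*} [TopologicalSpace (TotalSpace V F)] [∀ x, AddCommGroup (F x)]
  [∀ x, Module ℝ (F x)] [∀ x, TopologicalSpace (F x)] [FiberBundle V F] [VectorBundle ℝ V F]

omit [IsManifold (𝓡 (m + 1)) ∞ M] [T2Space M] [SecondCountableTopology M] in
theorem contMDiffOn_trivialization [ContMDiffVectorBundle ∞ V F (𝓡 (m + 1))]
    (φ : Sections m V F) (l : V →L[ℝ] ℝ) (x : M) :
    ContMDiffOn (𝓡 (m + 1)) 𝓘(ℝ, ℝ) ∞
      (fun y => l ((trivializationAt V F x).linearMapAt ℝ y (φ y)))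
      (trivializationAt V F x).baseSet := by
  have h1 : ContMDiffOn (𝓡 (m + 1)) 𝓘(ℝ, V) ∞
      (fun y => (trivializationAt V F x ⟨y, φ y⟩).2) (trivializationAt V F x).baseSet :=
    (trivializationAt V F x).contMDiffOn_section_baseSet_iff.1 φ.contMDiff.contMDiffOn
  refine (l.contMDiff.comp_contMDiffOn h1).congr fun y hy => ?_
  rw [Trivialization.coe_linearMapAt_of_mem _ hy]
  rfl

/-- Sections are separated by their integrals against compactly supported dual densities. -/
theorem eq_zero_of_formIntegral_contract [ContMDiffVectorBundle ∞ V F (𝓡 (m + 1))]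
    (oM : ManifoldOrientation (m + 1) M) {ψ : Sections m V F}
    (hψ : ∀ β ∈ compactDualDensities m V F, formIntegral oM (contract β ψ) = 0) : ψ = 0 := by
  by_contra hne
  obtain ⟨x, hx⟩ : ∃ x, ψ x ≠ 0 := by
    by_contra hall
    push Not at hall
    exact hne (ContMDiffSection.ext hall)
  set t := trivializationAt V F x with ht
  have hxt : x ∈ t.baseSet := FiberBundle.mem_baseSet_trivializationAt' x
  set v := t.linearMapAt ℝ x (ψ x) with hv
  have hv0 : ‖v‖ ≠ 0 := by
    rw [norm_ne_zero_iff]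
    intro h
    have h1 := t.symmₗ_linearMapAt (R := ℝ) hxt (ψ x)
    rw [← hv, h, map_zero] at h1
    exact hx h1.symm
  -- `l` attains the norm of `ψ x` read in the trivialization, so the component `g` of `ψ` along `l`
  -- is positive at `x`, hence nearby.
  obtain ⟨l, -, hl⟩ := exists_dual_vector ℝ v hv0
  have hg := contMDiffOn_trivialization ψ l x
  set g : M → ℝ := fun y => l (t.linearMapAt ℝ y (ψ y)) with hgdef
  have hgx : 0 < g x := by
    have : g x = ‖v‖ := hl
    rw [this]
    positivity
  have hUo : IsOpen (t.baseSet ∩ g ⁻¹' Ioi 0) :=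
    hg.continuousOn.isOpen_inter_preimage t.open_baseSet isOpen_Ioi
  obtain ⟨e, he, hxe, heU, hconv⟩ := exists_convex_chart (n := m + 1) hUo ⟨hxt, hgx⟩
  have : LocallyCompactSpace M := Manifold.locallyCompact_of_finiteDimensional (𝓡 (m + 1))
  obtain ⟨K, hK, hxK, hKe⟩ := exists_compact_subset e.open_source hxe
  obtain ⟨χ, h1, h2, h3⟩ := exists_contMDiffMap_one_nhds_of_subset_interior (n := ⊤)
    (𝓡 (m + 1)) (isClosed_singleton (x := x)) (singleton_subset_iff.2 hxK)
  have hχx : χ x = 1 := (eventually_nhdsSet_iff_forall.1 h1 x rfl).self_of_nhds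
  -- The test density is a cutoff times the component functional times a coordinate volume form.
  -- Contracted with `ψ` it has the coefficient function `χ * g`, which is non-negative because `g >
  -- 0` on the chart domain.
  let βfun : ∀ y : M, F y →ₗ[ℝ] (TangentSpace (𝓡 (m + 1)) y [⋀^Fin (m + 1)]→L[ℝ] ℝ) := fun y =>
    (LinearMap.toSpanSingleton ℝ _ (chartVolume e y)) ∘ₗ (χ y • l.toLinearMap) ∘ₗ t.linearMapAt ℝ y
  have hform : ∀ φ : Sections m V F, (fun y => βfun y (φ y)) =
      Form.smulFun (fun y => χ y * l (t.linearMapAt ℝ y (φ y))) (chartVolume e) := fun φ => rfl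
  have hsm : ∀ φ : Sections m V F, ContMDiffOn (𝓡 (m + 1)) 𝓘(ℝ, ℝ) ∞
      (fun y => χ y * l (t.linearMapAt ℝ y (φ y))) e.source := fun φ =>
    χ.contMDiff.contMDiffOn.mul ((contMDiffOn_trivialization φ l x).mono
      (heU.trans inter_subset_left))
  have hz : ∀ φ : Sections m V F, ∀ y, y ∉ K → χ y * l (t.linearMapAt ℝ y (φ y)) = 0 :=
    fun φ y hy => by rw [h2 y hy, zero_mul]
  let β : DualDensities m V F := ⟨βfun, fun φ =>
    isSmooth_smulFun_chartVolume he (hsm φ) hK.isClosed hKe (hz φ)⟩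
  have hβ : β ∈ compactDualDensities m V F := by
    refine hK.of_isClosed_subset isClosed_closure (supp_subset hK.isClosed fun y hy => ?_)
    refine LinearMap.ext fun w => ?_
    change (χ y * l (t.linearMapAt ℝ y w)) • chartVolume e y = 0
    rw [h2 y hy, zero_mul, zero_smul]
  refine formIntegral_smulFun_chartVolume_ne_zero he hconv oM (hsm ψ) hK hKe (hz ψ) (fun y => ?_)
    hxe ?_ (hψ β hβ)
  · by_cases hy : y ∈ K
    · exact mul_nonneg (h3 y).1 (le_of_lt (heU (hKe hy)).2)
    · rw [hz ψ y hy]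
  · change 0 < χ x * g x
    rwa [hχx, one_mul]

end TestDensities

end Conal

end

theorem mainTheorem5 {m : ℕ} {M : Type*} [TopologicalSpace M] [T2Space M]
    [SecondCountableTopology M] [ChartedSpace (EuclideanSpace ℝ (Fin (m + 1))) M]
    [IsManifold (𝓡 (m + 1)) ∞ M] (oM : ManifoldOrientation (m + 1) M)
    {V : Type*} [NormedAddCommGroup V] [NormedSpace ℝ V] [FiniteDimensional ℝ V]
    {F : M → Type*} [TopologicalSpace (Bundle.TotalSpace V F)] [∀ x, AddCommGroup (F x)]
    [∀ x, Module ℝ (F x)] [∀ x, TopologicalSpace (F x)] [FiberBundle V F] [VectorBundle ℝ V F]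
    [ContMDiffVectorBundle ∞ V F (𝓡 (m + 1))]
    (f fs : Sections m V F →ₗ[ℝ] DualDensities m V F) (hf : IsDiffOp f) (hfs : IsDiffOp fs)
    (G : Sections m V F →ₗ[ℝ] Sections m V F →ₗ[ℝ] smoothForms (m + 1) M m)
    (hG : IsGreenForm f fs G)
    (C : ChronalConeBundle m M) (hfC : IsGreenHyperbolic C f) (hfsC : IsGreenHyperbolic C fs)
    (S : Set M) [ChartedSpace (EuclideanSpace ℝ (Fin m)) S] [IsManifold (𝓡 m) ∞ S]
    (hS : C.IsCauchySurface S) (oS : ManifoldOrientation m S)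
    (hoS : C.IsFutureOriented oM S oS) :
    -- the pairing is an integral of a compactly supported form
    (∀ ψ ∈ solutionsSC C f, ∀ ξ ∈ solutionsSC C fs, IsCompact (supp (greenIntegrand G S ψ ξ))) ∧
    -- alternative forms of the pairing
    (∀ α ∈ compactDualDensities m V F, ∀ β ∈ compactDualDensities m V F,
      ∀ ψ ξ : Sections m V F, ψ = causalGreen C f α → ξ = causalGreen C fs β →
        ψ ∈ solutionsSC C f ∧ ξ ∈ solutionsSC C fs ∧
        greenPairing G S oS ψ ξ = formIntegral oM (contract α ξ) ∧
        formIntegral oM (contract α ξ) = formIntegral oM (contract α (causalGreen C fs β)) ∧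
        formIntegral oM (contract α (causalGreen C fs β)) =
          - formIntegral oM (contract β (causalGreen C f α)) ∧
        - formIntegral oM (contract β (causalGreen C f α)) = - formIntegral oM (contract β ψ)) ∧
    -- non-degeneracy in both arguments
    (∀ ψ ∈ solutionsSC C f, (∀ ξ ∈ solutionsSC C fs, greenPairing G S oS ψ ξ = 0) → ψ = 0) ∧
    (∀ ξ ∈ solutionsSC C fs, (∀ ψ ∈ solutionsSC C f, greenPairing G S oS ψ ξ = 0) → ξ = 0) := by
  refine ⟨fun ψ hψ ξ _ => IsGreenHyperbolic.isCompact_supp_greenIntegrand hS hG hψ.2 ξ,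
    fun α hα β hβ ψ ξ hψ hξ => ?_, fun ψ hψ h => ?_, fun ξ hξ h => ?_⟩
  · subst hψ hξ
    have h1 := hfC.causalGreen_mem hα
    have h2 := hfsC.causalGreen_mem hβ
    have h3 := hfC.greenPairing_causalGreen hG hS (oM := oM) hoS hα h2.1
    have h4 := hfsC.greenPairing_causalGreen_right hG hS (oM := oM) hoS hβ h1.1
    exact ⟨h1, h2, h3, rfl, h3.symm.trans h4, rfl⟩
  -- The causal solutions `causalGreen C fs β` are already enough test solutions to force `ψ = 0`.
  · refine eq_zero_of_formIntegral_contract oM fun β hβ => ?_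
    rw [← neg_eq_zero, ← hfsC.greenPairing_causalGreen_right hG hS hoS hβ hψ.1]
    exact h _ (hfsC.causalGreen_mem hβ)
  · refine eq_zero_of_formIntegral_contract oM fun α hα => ?_
    rw [← hfC.greenPairing_causalGreen hG hS hoS hα hξ.1]
    exact h _ (hfC.causalGreen_mem hα)
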